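/- Let $A,B$ be natural numbers with $B>A>0$, and let $b\in\mathbb C$ satisfy $\operatorname{Im}(b^2)>0$ and $\operatorname{Re}(b)>0$. Put $q=e^{2\pi i b^2}$, $\tilde q=e^{-2\pi i b^{-2}}$, $c_b=\frac i2(b+b^{-1})$, $(x;q)_\infty=\prod_{k\ge0}(1-xq^k)$, $(q)_m=\prod_{k=1}^m(1-q^k)$, and let $$\Phi_b(x)=\frac{(e^{2\pi b(x+c_b)};q)_\infty}{(e^{2\pi b^{-1}(x-c_b)};\tilde q)_\infty}$$ be Faddeev's quantum dilogarithm. Let $$F_{A,B}(q,x)=\sum_{m\ge0}\frac{(-1)^{Am}q^{Am(m+1)/2}}{(q)_m^B}x^m,\qquad \widetilde F_{A,B}(q,x)=F_{B-A,B}(q,x).$$ On power series in $x$ let $\delta=x\partial_x$ and $(\delta_kF)(x)=\sum_{s\ge1}\frac{s^{k-1}q^s}{1-q^s}F(q^sx)$ for $k\ge1$ (the sum being taken coefficientwise), and let $\tilde\delta,\tilde\delta_k$ be the same operators acting on series in $\tilde x$, with $\tilde q$ in place of $q$; these operators commute. Put $e_l=\tilde\delta_l(1)=\sum_{s\ge1}\frac{s^{l-1}\tilde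 q^s}{1-\tilde q^s}$, $$\phi(w)=\exp\Big(-\sum_{l\ge1}\frac{\delta_l}{l!}w^l\Big),\qquad \tilde\phi(w)=\exp(-\tilde\delta w)\exp\Big(2\sum_{l>0\text{ even}}e_l\frac{w^l}{l!}\Big)\exp\Big(-\sum_{l\ge1}\frac{\tilde\delta_l}{l!}(-w)^l\Big),$$ $$P_{A,B}=\operatorname{Res}_{w=0}\;e^{\frac{A}{4\pi i}w^2+Aw\left(b(\delta+\frac12)+b^{-1}(\tilde\delta+\frac12)\right)}\left(\frac{\phi(bw)\,\tilde\phi(b^{-1}w)}{b(1-e^{b^{-1}w})}\right)^B .$$ Then $P_{A,B}$ is a polynomial in $\delta,\delta_1,\delta_2,\dots,\tilde\delta,\tilde\delta_1,\tilde\delta_2,\dots$ with coefficients in the ring $\mathbb Q[(2\pi i)^{-1},b^{\pm1},e_2,e_4,e_6,\dots]\subset\mathbb C$. For every $\varepsilon$ with $0<\varepsilon<\operatorname{Im}(c_b)$ the integral $$\mathcal I_{A,B}(b)=\int_{\mathbb R+i\varepsilon}\Phi_b(x)^Be^{-A\pi ix^2}\,dx$$ converges absolutely, and $$\mathcal I_{A,B}(b)=\Big(\frac{\tilde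 q}{q}\Big)^{\frac{B-3A}{24}}e^{\pi i\frac{B+2(A+1)}4}\Big\langle P_{A,B}\big(F_{A,B}(q,x)\,\widetilde F_{A,B}(\tilde q,\tilde x)\big)\Big\rangle ,$$ where $(\tilde q/q)^s=e^{-2\pi i s(b^2+b^{-2})}$ and $\langle G\rangle$ is the value of the (absolutely convergent) series $G$ at $x=\tilde x=1$. Moreover $P_{A,B}$ can be written as a finite sum $\sum_kp_kP_k$ with $p_k$ a polynomial in $\delta,\delta_1,\dots$ and $P_k$ a polynomial in $\tilde\delta,\tilde\delta_1,\dots$, both with coefficients in the above ring, and for every finite decomposition $P_{A,B}=\sum_kp_kP_k$ of this form (even with arbitrary complex coefficients) $$\mathcal I_{A,B}(b)=\Big(\frac{\tilde q}{q}\Big)^{\frac{B-3A}{24}}e^{\pi i\frac{B+2(A+1)}4}\sum_k\langle p_kF_{A,B}(q,x)\rangle\,\langle P_k\widetilde F_{A,B}(\tilde q,\tilde x)\rangle ,$$ where all the series involved converge absolutely. -/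

import Mathlib

open scoped PowerSeries

namespace StateIntegral

noncomputable section

/-! ### Faddeev's quantum dilogarithm and the state integral -/

/-- `q = exp(2πi b²)`. -/
def qParam (b : ℂ) : ℂ := Complex.exp (2 * Real.pi * Complex.I * b ^ 2)

/-- `q̃ = exp(-2πi b⁻²)`. -/
def qDual (b : ℂ) : ℂ := Complex.exp (-(2 * Real.pi * Complex.I * (b ^ 2)⁻¹))

/-- `c_b = (i/2)(b + b⁻¹)`. -/
def cb (b : ℂ) : ℂ := Complex.I / 2 * (b + b⁻¹)

/-- The infinite `q`-Pochhammer symbol `(x; q)_∞ = ∏_{k ≥ 0} (1 - x q^k)`. -/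
def qPochInf (x q : ℂ) : ℂ := ∏' k : ℕ, (1 - x * q ^ k)

/-- The finite symbol `(q)_m = ∏_{k=1}^m (1 - q^k)`. -/
def qPoch (q : ℂ) (m : ℕ) : ℂ := ∏ k ∈ Finset.range m, (1 - q ^ (k + 1))

/-- Faddeev's quantum dilogarithm
`Φ_b(x) = (e^{2πb(x+c_b)}; q)_∞ / (e^{2πb⁻¹(x-c_b)}; q̃)_∞`. -/
def faddeev (b x : ℂ) : ℂ :=
  qPochInf (Complex.exp (2 * Real.pi * b * (x + cb b))) (qParam b) /
    qPochInf (Complex.exp (2 * Real.pi * b⁻¹ * (x - cb b))) (qDual b)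

/-- The integrand `Φ_b(x)^B e^{-Aπi x²}`. -/
def integrand (A B : ℕ) (b x : ℂ) : ℂ :=
  faddeev b x ^ B * Complex.exp (-(A * Real.pi * Complex.I * x ^ 2))

/-- The state integral over the line `ℝ + iε`, parametrised by `x = t + iε`. -/
def stateIntegral (A B : ℕ) (b : ℂ) (ε : ℝ) : ℂ :=
  ∫ t : ℝ, integrand A B b (t + ε * Complex.I)

/-- The series `F_{A,B}(q,x) = ∑_m (-1)^{Am} q^{A m(m+1)/2} / (q)_m^B x^m`. -/
def FSeries (A B : ℕ) (q : ℂ) : ℂ⟦X⟧ :=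
  PowerSeries.mk fun m => (-1) ^ (A * m) * q ^ (A * (m * (m + 1) / 2)) / qPoch q m ^ B

/-- `(q̃/q)^{(B-3A)/24} e^{πi(B+2(A+1))/4}`, where `(q̃/q)^s = exp(s · 2πi(-b⁻² - b²))`. -/
def prefactor (A B : ℕ) (b : ℂ) : ℂ :=
  Complex.exp (((B : ℂ) - 3 * A) / 24 * (2 * Real.pi * Complex.I * (-(b ^ 2)⁻¹ - b ^ 2))) *
    Complex.exp (Real.pi * Complex.I * ((B + 2 * (A + 1)) / 4))

/-! ### The operators `δ`, `δ_l` on series in one variable -/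

/-- `δ = x ∂_x`. -/
def opTheta : Module.End ℂ ℂ⟦X⟧ :=
  (LinearMap.mulLeft ℂ (PowerSeries.X : ℂ⟦X⟧)).comp (PowerSeries.derivative ℂ).toLinearMap

theorem coeff_opTheta (F : ℂ⟦X⟧) (m : ℕ) :
    PowerSeries.coeff m (opTheta F) = m * PowerSeries.coeff m F := by
  cases m with
  | zero => simp [opTheta]
  | succ m =>
    simp only [opTheta, LinearMap.comp_apply, LinearMap.mulLeft_apply,
      PowerSeries.coeff_succ_X_mul]
    simp [PowerSeries.coeff_derivative, mul_comm]

/-- The eigenvalue of `δ_{l+1}` on `x^m`, that is `∑_{s ≥ 1} s^l q^s q^{sm} / (1 - q^s)`. -/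
def deltaEigen (q : ℂ) (l m : ℕ) : ℂ :=
  ∑' s : ℕ, ((s + 1 : ℕ) : ℂ) ^ l * q ^ (s + 1) / (1 - q ^ (s + 1)) * (q ^ (s + 1)) ^ m

theorem coeff_delta_aux (q : ℂ) (l m : ℕ) (F : ℂ⟦X⟧) :
    (∑' s : ℕ, ((s + 1 : ℕ) : ℂ) ^ l * q ^ (s + 1) / (1 - q ^ (s + 1)) *
      PowerSeries.coeff m (PowerSeries.rescale (q ^ (s + 1)) F)) =
    deltaEigen q l m * PowerSeries.coeff m F := by
  rw [deltaEigen, ← tsum_mul_right]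
  refine tsum_congr fun s => ?_
  rw [PowerSeries.coeff_rescale]
  ring

/-- `δ_{l+1}`, where `(δ_k F)(x) = ∑_{s ≥ 1} s^{k-1} q^s / (1 - q^s) F(q^s x)`; the sum of series
is taken coefficient by coefficient. (The index is shifted: `opDelta q 0` is `δ_1`.) -/
def opDelta (q : ℂ) (l : ℕ) : Module.End ℂ ℂ⟦X⟧ where
  toFun F := PowerSeries.mk fun m =>
    ∑' s : ℕ, ((s + 1 : ℕ) : ℂ) ^ l * q ^ (s + 1) / (1 - q ^ (s + 1)) *
      PowerSeries.coeff m (PowerSeries.rescale (q ^ (s + 1)) F)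
  map_add' F G := by
    ext m
    rw [map_add (PowerSeries.coeff m)]
    simp only [PowerSeries.coeff_mk, coeff_delta_aux]
    rw [map_add (PowerSeries.coeff m), mul_add]
  map_smul' c F := by
    ext m
    simp only [coeff_delta_aux, PowerSeries.coeff_mk, PowerSeries.coeff_smul, RingHom.id_apply,
      smul_eq_mul]
    ring

theorem coeff_opDelta (q : ℂ) (l m : ℕ) (F : ℂ⟦X⟧) :
    PowerSeries.coeff m (opDelta q l F) = deltaEigen q l m * PowerSeries.coeff m F := by
  simp only [opDelta, LinearMap.coe_mk, AddHom.coe_mk, PowerSeries.coeff_mk, coeff_delta_aux]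

/-- `e_{l+1}(q) = δ_{l+1}(1) = ∑_{s ≥ 1} s^l q^s / (1 - q^s)` (the index is shifted). -/
def eis (q : ℂ) (l : ℕ) : ℂ :=
  ∑' s : ℕ, ((s + 1 : ℕ) : ℂ) ^ l * q ^ (s + 1) / (1 - q ^ (s + 1))

/-- Symbols for the generators `δ` and `δ_{l+1}`, `l = 0, 1, 2, …`. -/
inductive Gen : Type
  | theta : Gen
  | delta (l : ℕ) : Gen

/-- The operator on series in one variable attached to a generator. -/
def genOp (q : ℂ) : Gen → Module.End ℂ ℂ⟦X⟧
  | Gen.theta => opTheta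
  | Gen.delta l => opDelta q l

/-- The eigenvalue on `x^m`. -/
def opEigen (q : ℂ) : Gen → ℕ → ℂ
  | Gen.theta, m => m
  | Gen.delta l, m => deltaEigen q l m

theorem coeff_genOp (q : ℂ) (g : Gen) (F : ℂ⟦X⟧) (m : ℕ) :
    PowerSeries.coeff m (genOp q g F) = opEigen q g m * PowerSeries.coeff m F := by
  cases g with
  | theta => exact coeff_opTheta F m
  | delta l => exact coeff_opDelta q l m F

theorem genOp_comm (q : ℂ) (g h : Gen) : genOp q g * genOp q h = genOp q h * genOp q g := by
  ext F m
  simp only [Module.End.mul_apply, coeff_genOp]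
  ring

/-! ### Series in two variables

A series `∑ a_{m,n} x^m x̃^n` is an element of `ℂ⟦x̃⟧⟦x⟧`: the coefficient of `x^m` is a series
in `x̃`. -/

/-- Formal power series in `x` (outer variable) and `x̃` (inner variable). -/
abbrev DSeries : Type := (ℂ⟦X⟧)⟦X⟧

/-- The product `F(x) G(x̃)`. -/
def prodSeries (F G : ℂ⟦X⟧) : DSeries :=
  PowerSeries.map (PowerSeries.C (R := ℂ)) F * PowerSeries.C G

/-- An operator on series in `x`, acting on series in `x, x̃` with `x̃` as a parameter. -/
def onX (T : Module.End ℂ ℂ⟦X⟧) : Module.End ℂ DSeries where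
  toFun G := PowerSeries.mk fun m => PowerSeries.mk fun n =>
    PowerSeries.coeff m (T (PowerSeries.mk fun k => PowerSeries.coeff n (PowerSeries.coeff k G)))
  map_add' G H := by
    ext m n
    simp only [PowerSeries.coeff_mk, map_add]
    rw [← map_add, ← map_add]
    rfl
  map_smul' c G := by
    ext m n
    simp only [PowerSeries.coeff_mk, RingHom.id_apply]
    change PowerSeries.coeff m (T (c • PowerSeries.mk fun k =>
      PowerSeries.coeff n (PowerSeries.coeff k G))) = _
    rw [map_smul]
    simp

/-- An operator on series in `x̃`, acting on series in `x, x̃` with `x` as a parameter. -/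
def onXt (T : Module.End ℂ ℂ⟦X⟧) : Module.End ℂ DSeries where
  toFun G := PowerSeries.mk fun m => T (PowerSeries.coeff m G)
  map_add' G H := by
    ext m n
    simp only [PowerSeries.coeff_mk, map_add]
  map_smul' c G := by
    ext m n
    simp only [PowerSeries.coeff_mk, RingHom.id_apply]
    change PowerSeries.coeff n (T (c • PowerSeries.coeff m G)) = _
    rw [map_smul]
    simp

/-- The operators `δ, δ_l` acting on `x` with parameter `q` (left generators) and
`δ̃, δ̃_l` acting on `x̃` with parameter `q̃` (right generators). -/
def genOp2 (q qt : ℂ) : Gen ⊕ Gen → Module.End ℂ DSeries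
  | Sum.inl g => onX (genOp q g)
  | Sum.inr g => onXt (genOp qt g)

/-- The eigenvalue on `x^m x̃^n`. -/
def op2Eigen (q qt : ℂ) : Gen ⊕ Gen → ℕ → ℕ → ℂ
  | Sum.inl g, m, _ => opEigen q g m
  | Sum.inr g, _, n => opEigen qt g n

theorem coeff_genOp2 (q qt : ℂ) (g : Gen ⊕ Gen) (G : DSeries) (m n : ℕ) :
    PowerSeries.coeff n (PowerSeries.coeff m (genOp2 q qt g G)) =
      op2Eigen q qt g m n * PowerSeries.coeff n (PowerSeries.coeff m G) := by
  cases g with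
  | inl g => simp [genOp2, onX, op2Eigen, coeff_genOp]
  | inr g => simp [genOp2, onXt, op2Eigen, coeff_genOp]

theorem genOp2_comm (q qt : ℂ) (g h : Gen ⊕ Gen) :
    genOp2 q qt g * genOp2 q qt h = genOp2 q qt h * genOp2 q qt g := by
  ext G m n
  simp only [Module.End.mul_apply, coeff_genOp2]
  ring

/-! ### Polynomials in commuting operators -/

open scoped IsMulCommutative in
/-- Evaluation of a polynomial at a commuting family of elements of a noncommutative algebra. -/
def polyEval {σ E : Type} [Ring E] [Algebra ℂ E] (f : σ → E)
    (hf : ∀ i j, f i * f j = f j * f i) : MvPolynomial σ ℂ →ₐ[ℂ] E :=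
  haveI : IsMulCommutative (Algebra.adjoin ℂ (Set.range f)) :=
    Algebra.isMulCommutative_adjoin ℂ (by rintro _ ⟨i, rfl⟩ _ ⟨j, rfl⟩; exact hf i j)
  (Algebra.adjoin ℂ (Set.range f)).val.comp
    (MvPolynomial.aeval fun i =>
      (⟨f i, Algebra.subset_adjoin ⟨i, rfl⟩⟩ : Algebra.adjoin ℂ (Set.range f)))

theorem polyEval_X {σ E : Type} [Ring E] [Algebra ℂ E] (f : σ → E)
    (hf : ∀ i j, f i * f j = f j * f i) (i : σ) :
    polyEval f hf (MvPolynomial.X i) = f i := by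
  simp [polyEval]

/-- The action on series in one variable of polynomials in `δ, δ_1, δ_2, …`. -/
def act (q : ℂ) : MvPolynomial Gen ℂ →ₐ[ℂ] Module.End ℂ ℂ⟦X⟧ :=
  polyEval (genOp q) (genOp_comm q)

/-- The action on series in `x, x̃` of polynomials in `δ, δ_1, δ_2, …, δ̃, δ̃_1, δ̃_2, …`. -/
def act2 (q qt : ℂ) : MvPolynomial (Gen ⊕ Gen) ℂ →ₐ[ℂ] Module.End ℂ DSeries :=
  polyEval (genOp2 q qt) (genOp2_comm q qt)

/-- `⟨F⟩ = F(1)`, the sum of the coefficients. -/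
def bracket (F : ℂ⟦X⟧) : ℂ := ∑' m : ℕ, PowerSeries.coeff m F

/-- `⟨F⟩ = F(1,1)`, the sum of the coefficients. -/
def bracket2 (G : DSeries) : ℂ :=
  ∑' p : ℕ × ℕ, PowerSeries.coeff p.2 (PowerSeries.coeff p.1 G)

/-! ### The operator valued polynomial `P_{A,B}` -/

/-- Polynomials in `δ, δ_1, δ_2, …` (left) and `δ̃, δ̃_1, δ̃_2, …` (right). -/
abbrev OpPoly : Type := MvPolynomial (Gen ⊕ Gen) ℂ

/-- The polynomial `δ`. -/
def dT : OpPoly := MvPolynomial.X (Sum.inl Gen.theta)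

/-- The polynomial `δ_{l+1}`. -/
def dD (l : ℕ) : OpPoly := MvPolynomial.X (Sum.inl (Gen.delta l))

/-- The polynomial `δ̃`. -/
def dtT : OpPoly := MvPolynomial.X (Sum.inr Gen.theta)

/-- The polynomial `δ̃_{l+1}`. -/
def dtD (l : ℕ) : OpPoly := MvPolynomial.X (Sum.inr (Gen.delta l))

/-- `exp(S)` for a series `S` in `w` without constant term. -/
def expSeries (S : OpPoly⟦X⟧) : OpPoly⟦X⟧ := (PowerSeries.exp OpPoly).subst S

/-- A complex number as a constant power series. -/
def cst (z : ℂ) : OpPoly⟦X⟧ := PowerSeries.C (MvPolynomial.C z)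

/-- `φ(w, δ_•) = exp(-∑_{l ≥ 1} δ_l w^l / l!)`. -/
def phi : OpPoly⟦X⟧ :=
  expSeries (-PowerSeries.mk fun
    | 0 => 0
    | l + 1 => MvPolynomial.C (((l + 1).factorial : ℂ)⁻¹) * dD l)

/-- `φ̃(w, δ̃_•) = exp(-δ̃ w) exp(2 ∑_{l even > 0} e_l(q̃) w^l / l!)
exp(-∑_{l ≥ 1} δ̃_l (-w)^l / l!)`. -/
def phiTilde (qt : ℂ) : OpPoly⟦X⟧ :=
  expSeries (-(PowerSeries.C dtT * PowerSeries.X)) *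
  expSeries (cst 2 * PowerSeries.mk fun
    | 0 => 0
    | l + 1 => if Even (l + 1) then
        MvPolynomial.C (((l + 1).factorial : ℂ)⁻¹ * eis qt l) else 0) *
  expSeries (-PowerSeries.mk fun
    | 0 => 0
    | l + 1 => MvPolynomial.C (((l + 1).factorial : ℂ)⁻¹ * (-1) ^ (l + 1)) * dtD l)

/-- `exp(A w² / (4πi) + A w (b (δ + 1/2) + b⁻¹ (δ̃ + 1/2)))`. -/
def gaussFactor (A : ℕ) (b : ℂ) : OpPoly⟦X⟧ :=
  expSeries (cst (A / (4 * Real.pi * Complex.I)) * PowerSeries.X ^ 2 +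
    cst A * PowerSeries.X *
      PowerSeries.C (MvPolynomial.C b * (dT + MvPolynomial.C (1 / 2)) +
        MvPolynomial.C b⁻¹ * (dtT + MvPolynomial.C (1 / 2))))

/-- The Laurent series of `1 / (b (1 - e^{b⁻¹ w}))` at `w = 0`. -/
def poleFactor (b : ℂ) : LaurentSeries ℂ :=
  (((PowerSeries.C b * (1 - PowerSeries.rescale b⁻¹ (PowerSeries.exp ℂ)) : ℂ⟦X⟧) :
    LaurentSeries ℂ))⁻¹

/-- The residue at `w = 0` of a Laurent series in `w`. -/
def residueAt (f : LaurentSeries OpPoly) : OpPoly := HahnSeries.coeff f (-1)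

/-- `P_{A,B} = Res_{w=0} exp(A w² / (4πi) + A w (b (δ + 1/2) + b⁻¹ (δ̃ + 1/2)))
(φ(b w, δ_•) φ̃(b⁻¹ w, δ̃_•) / (b (1 - e^{b⁻¹ w})))^B`. -/
def PAB (A B : ℕ) (b : ℂ) : OpPoly :=
  residueAt
    (((gaussFactor A b : OpPoly⟦X⟧) : LaurentSeries OpPoly) *
      (((PowerSeries.rescale (MvPolynomial.C b) phi *
          PowerSeries.rescale (MvPolynomial.C b⁻¹) (phiTilde (qDual b)) : OpPoly⟦X⟧) :
            LaurentSeries OpPoly) *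
        HahnSeries.map (poleFactor b) (MvPolynomial.C : ℂ →+* OpPoly)) ^ B)

/-- The ring of coefficients `ℚ[(2πi)⁻¹, b, b⁻¹, e_2(q̃), e_4(q̃), e_6(q̃), …]`. -/
def coeffRing (b : ℂ) : Subalgebra ℚ ℂ :=
  Algebra.adjoin ℚ
    ({(2 * Real.pi * Complex.I)⁻¹, b, b⁻¹} ∪ Set.range fun j : ℕ => eis (qDual b) (2 * j + 1))

/-- The polynomial `p` has its coefficients in `coeffRing b`. -/
def HasCoeffs {σ : Type} (b : ℂ) (p : MvPolynomial σ ℂ) : Prop :=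
  ∀ d, MvPolynomial.coeff d p ∈ coeffRing b

/-- `p = ∑_k p_k P_k`, where `p_k` is a polynomial in `δ, δ_1, …` and `P_k` one in
`δ̃, δ̃_1, …`. -/
def IsDecomposition (p : OpPoly) {N : ℕ} (u v : Fin N → MvPolynomial Gen ℂ) : Prop :=
  p = ∑ k, MvPolynomial.rename Sum.inl (u k) * MvPolynomial.rename Sum.inr (v k)

end

end StateIntegral

open StateIntegral

namespace StateIntegral

/-! ### Infinite `q`-Pochhammer symbols -/

section Pochhammer

variable {q : ℂ}

/-! Put p = r c_b with 0 < r < 1 and ε = r Im c_b, and cut the line ℝ + iε at p (up to a real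
shift). On the left half both q-products are bounded and bounded away from 0 and the Gaussian decays
because A > 0, so this half turns onto the ray p + ib·[0,∞). On the right half the inversion
relation Φ_b(x)Φ_b(-x) = K e^{πix²} trades the q-products at x for those at -x, which are again
under control. The Gaussian becomes e^{(B-A)πix²}, which decays there because A < B, and this half
turns onto p + ib⁻¹·[0,∞) (`stateIntegral_eq_rays`). Inversion itself is the Jacobi triple product
for q and for q̃, compared through the modular transformation of the theta function
(`exists_inversion`).

The two rays bound a sector tiled by the translates, by m·ib + n·ib⁻¹ with m, n ≥ 0, of one
parallelogram with corner p. A translation only multiplies Φ_b by finite products, which gives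
geometric decay in m and n. Common edges cancel, and the state integral is the sum of the boundary
integrals of the cells (`hasSum_cellIntegral`).

Cell (m,n) contains one singularity, the pole of order B at c_b + m·ib + n·ib⁻¹. In the local
coordinate w = 2π(x - pole), the logarithm of (q^{m+1}e^{bw};q)_∞ has a Taylor series whose
coefficients are sums ∑ s^{l-1}q^{s(m+1)}/(1-q^s), and these are the eigenvalues of δ_l on x^m. The
same holds for q̃. So the regular part of the integrand expands into the operator generating series
evaluated at the joint eigenvector x^m x̃^n, and the residue is the eigenvalue of P_{A,B} times the
coefficients of F and F̃ (`cellIntegral_eq`). The prefactor collects the Gaussian at c_b and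
(q)_∞/(q̃)_∞, which is known from the eta function (`qPochInf_ratio`).

Summation over the cells gives the bracket. For a decomposition ∑ p_k P_k the eigenvalue on x^m x̃^n
is a finite sum of products of a function of m and a function of n. Each grows polynomially while
the coefficients of F and F̃ decay at least geometrically, so the double series factors
(`hasSum_coeff_act2`). The coefficient ring is controlled by recursions for exponentials and
inverses of power series. -/

theorem summable_norm_mul_pow (x : ℂ) (hq : ‖q‖ < 1) : Summable fun k : ℕ => ‖-(x * q ^ k)‖ := by
  simpa using (summable_geometric_of_lt_one (norm_nonneg _) hq).mul_left ‖x‖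

theorem multipliable_one_sub_mul_pow (x : ℂ) (hq : ‖q‖ < 1) :
    Multipliable fun k : ℕ => 1 - x * q ^ k := by
  simpa [sub_eq_add_neg] using multipliable_one_add_of_summable (summable_norm_mul_pow x hq)

theorem qPochInf_eq_one_sub_mul (x : ℂ) (hq : ‖q‖ < 1) :
    qPochInf x q = (1 - x) * qPochInf (x * q) q := by
  have h := (multipliable_one_sub_mul_pow (x * q) hq)
  have h2 : Multipliable fun k : ℕ => 1 - x * q ^ (k + 1) := by
    simpa [pow_succ', mul_assoc] using h
  rw [qPochInf, tprod_eq_zero_mul' (f := fun k : ℕ => 1 - x * q ^ k) h2, qPochInf]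
  simp [pow_succ', mul_assoc]

theorem qPochInf_eq_prod_mul (x : ℂ) (hq : ‖q‖ < 1) (m : ℕ) :
    qPochInf x q = (∏ k ∈ Finset.range m, (1 - x * q ^ k)) * qPochInf (x * q ^ m) q := by
  induction m with
  | zero => simp
  | succ m ih =>
    rw [ih, Finset.prod_range_succ, qPochInf_eq_one_sub_mul (x * q ^ m) hq, pow_succ]
    ring_nf

theorem qPochInf_ne_zero {x : ℂ} (hq : ‖q‖ < 1) (h : ∀ k : ℕ, 1 - x * q ^ k ≠ 0) :
    qPochInf x q ≠ 0 := by
  have := tprod_one_add_ne_zero_of_summable (f := fun k : ℕ => -(x * q ^ k))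
    (fun k => by simpa [sub_eq_add_neg] using h k) (summable_norm_mul_pow x hq)
  simpa [qPochInf, sub_eq_add_neg] using this

theorem one_sub_mul_pow_ne_zero {x : ℂ} (hq : ‖q‖ < 1) (hx : ‖x‖ < 1) (k : ℕ) :
    1 - x * q ^ k ≠ 0 := by
  intro h
  have h1 : x * q ^ k = 1 := (sub_eq_zero.mp h).symm
  have h2 : ‖x * q ^ k‖ < 1 := by
    rw [norm_mul, norm_pow]
    calc ‖x‖ * ‖q‖ ^ k ≤ ‖x‖ * 1 := by
          gcongr
          exact pow_le_one₀ (norm_nonneg _) hq.le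
      _ < 1 := by simpa using hx
  rw [h1] at h2
  simp at h2

theorem qPochInf_ne_zero_of_norm_lt {x : ℂ} (hq : ‖q‖ < 1) (hx : ‖x‖ < 1) : qPochInf x q ≠ 0 :=
  qPochInf_ne_zero hq (one_sub_mul_pow_ne_zero hq hx)

theorem exists_of_qPochInf_eq_zero {x : ℂ} (hq : ‖q‖ < 1) (h : qPochInf x q = 0) :
    ∃ k : ℕ, x * q ^ k = 1 := by
  by_contra! hc
  exact qPochInf_ne_zero hq (fun k hk => hc k (sub_eq_zero.mp hk).symm) h

theorem differentiable_qPochInf (hq : ‖q‖ < 1) : Differentiable ℂ fun x => qPochInf x q := by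
  intro x
  set U := Metric.ball (0 : ℂ) (‖x‖ + 1)
  have hU : IsOpen U := Metric.isOpen_ball
  have hx : x ∈ U := by simp [U]
  have hm : MultipliableLocallyUniformlyOn (fun (n : ℕ) (y : ℂ) => 1 + -(y * q ^ n)) U := by
    refine Summable.multipliableLocallyUniformlyOn_nat_one_add hU
      (u := fun n => (‖x‖ + 1) * ‖q‖ ^ n)
      ((summable_geometric_of_lt_one (norm_nonneg _) hq).mul_left _)
      (Filter.Eventually.of_forall fun n y hy => ?_) (fun n => by fun_prop)
    rw [norm_neg, norm_mul, norm_pow]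
    gcongr
    exact (by simpa [U] using hy : ‖y‖ < ‖x‖ + 1).le
  have hd := hm.hasProdLocallyUniformlyOn.differentiableOn
    (.of_forall fun s => by
      simpa [Finset.prod_fn] using DifferentiableOn.finsetProd (fun _ _ => by fun_prop)) hU
  have := hd.differentiableAt (hU.mem_nhds hx)
  simpa [qPochInf, sub_eq_add_neg] using this

/-- Compactness of the closed disc together with absence of zeros in |x| < 1. Every decay estimate
for the integrand reduces to arguments staying in such a disc. -/
theorem exists_qPochInf_bounds (hq : ‖q‖ < 1) {ρ : ℝ} (hρ : ρ < 1) :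
    ∃ c C : ℝ, 0 < c ∧ 0 < C ∧ ∀ x : ℂ, ‖x‖ ≤ ρ → c ≤ ‖qPochInf x q‖ ∧ ‖qPochInf x q‖ ≤ C := by
  rcases lt_or_ge ρ 0 with h0 | h0
  -- For ρ < 0 the disc is empty and any constants do.
  · exact ⟨1, 1, one_pos, one_pos, fun x hx => absurd (hx.trans_lt h0) (norm_nonneg x).not_gt⟩
  have hK : IsCompact (Metric.closedBall (0 : ℂ) ρ) := isCompact_closedBall 0 ρ
  have hne : (Metric.closedBall (0 : ℂ) ρ).Nonempty := ⟨0, by simpa using h0⟩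
  have hc : ContinuousOn (fun x => ‖qPochInf x q‖) (Metric.closedBall (0 : ℂ) ρ) :=
    (differentiable_qPochInf hq).continuous.norm.continuousOn
  obtain ⟨x₁, hx₁, h₁⟩ := hK.exists_isMinOn hne hc
  obtain ⟨x₂, hx₂, h₂⟩ := hK.exists_isMaxOn hne hc
  have hp : ∀ x ∈ Metric.closedBall (0 : ℂ) ρ, 0 < ‖qPochInf x q‖ := fun x hx =>
    norm_pos_iff.mpr (qPochInf_ne_zero_of_norm_lt hq ((by simpa using hx : ‖x‖ ≤ ρ).trans_lt hρ))
  exact ⟨_, _, hp _ hx₁, hp _ hx₂, fun x hx => ⟨h₁ (by simpa using hx), h₂ (by simpa using hx)⟩⟩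

/-- A finite product is the quotient (x;q)_∞ / (xq^m;q)_∞, and both arguments lie in the same disc;
hence a bound independent of m. -/
theorem exists_prod_lower_bound (hq : ‖q‖ < 1) {ρ : ℝ} (hρ : ρ < 1) :
    ∃ c : ℝ, 0 < c ∧ ∀ x : ℂ, ‖x‖ ≤ ρ → ∀ m : ℕ,
      c ≤ ‖∏ k ∈ Finset.range m, (1 - x * q ^ k)‖ := by
  obtain ⟨c, C, hc, hC, h⟩ := exists_qPochInf_bounds hq hρ
  refine ⟨c / C, by positivity, fun x hx m => ?_⟩
  have h1 := (h x hx).1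
  have h2 : ‖x * q ^ m‖ ≤ ρ := by
    rw [norm_mul, norm_pow]
    exact (mul_le_of_le_one_right (norm_nonneg _) (pow_le_one₀ (norm_nonneg _) hq.le)).trans hx
  rw [qPochInf_eq_prod_mul x hq m, norm_mul] at h1
  rw [div_le_iff₀ hC]
  refine h1.trans ?_
  gcongr
  exact (h _ h2).2

theorem qPoch_eq_prod (q : ℂ) (m : ℕ) :
    qPoch q m = ∏ k ∈ Finset.range m, (1 - q * q ^ k) := by
  simp [qPoch, pow_succ']

theorem exists_qPoch_lower_bound (hq : ‖q‖ < 1) : ∃ c : ℝ, 0 < c ∧ ∀ m, c ≤ ‖qPoch q m‖ := by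
  obtain ⟨c, hc, h⟩ := exists_prod_lower_bound hq hq
  exact ⟨c, hc, fun m => by rw [qPoch_eq_prod]; exact h q le_rfl m⟩

theorem qPoch_ne_zero (hq : ‖q‖ < 1) (m : ℕ) : qPoch q m ≠ 0 := by
  obtain ⟨c, hc, h⟩ := exists_qPoch_lower_bound hq
  exact norm_pos_iff.mp (hc.trans_le (h m))

theorem norm_pow_le_of_ne_zero (hq : ‖q‖ < 1) {n : ℕ} (hn : n ≠ 0) : ‖q ^ n‖ ≤ ‖q‖ := by
  rw [norm_pow]
  exact pow_le_of_le_one (norm_nonneg _) hq.le hn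

theorem one_sub_norm_le (hq : ‖q‖ < 1) {n : ℕ} (hn : n ≠ 0) : 1 - ‖q‖ ≤ ‖1 - q ^ n‖ := by
  have h1 := norm_sub_norm_le (1 : ℂ) (q ^ n)
  have h2 := norm_pow_le_of_ne_zero hq hn
  rw [norm_one] at h1
  linarith

theorem one_sub_pow_ne_zero (hq : ‖q‖ < 1) {n : ℕ} (hn : n ≠ 0) : 1 - q ^ n ≠ 0 := by
  have := one_sub_norm_le hq hn
  exact norm_pos_iff.mp (by linarith)

/-- `(x; q)_∞ = exp(-∑_{s ≥ 1} x^s / (s (1 - q^s)))` for `|x| < 1`. -/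
theorem qPochInf_eq_exp {x : ℂ} (hq : ‖q‖ < 1) (hx : ‖x‖ < 1) :
    qPochInf x q = Complex.exp (-∑' s : ℕ, x ^ (s + 1) / ((s + 1 : ℕ) * (1 - q ^ (s + 1)))) := by
  have hxk : ∀ k : ℕ, ‖x * q ^ k‖ < 1 := fun k => by
    rw [norm_mul, norm_pow]
    exact (mul_le_of_le_one_right (norm_nonneg _) (pow_le_one₀ (norm_nonneg _) hq.le)).trans_lt hx
  have hlog : ∀ k : ℕ, HasSum (fun s : ℕ => (x * q ^ k) ^ (s + 1) / (s + 1 : ℕ))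
      (-Complex.log (1 - x * q ^ k)) := fun k => by
    have h1 := Complex.hasSum_taylorSeries_neg_log (hxk k)
    have h2 := (hasSum_nat_add_iff' (f := fun n : ℕ => (x * q ^ k) ^ n / (n : ℂ)) 1).mpr h1
    simpa using h2
  -- Absolute summability of the double series of logarithms, so that it may be summed over k first;
  -- for fixed s that is a geometric series with ratio q^{s+1}.
  have hsum : Summable fun p : ℕ × ℕ => (x * q ^ p.1) ^ (p.2 + 1) / ((p.2 + 1 : ℕ) : ℂ) := by
    have h1 : Summable fun p : ℕ × ℕ => ‖q‖ ^ p.1 * ‖x‖ ^ p.2 :=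
      (summable_geometric_of_lt_one (norm_nonneg _) hq).mul_of_nonneg
        (summable_geometric_of_lt_one (norm_nonneg _) hx) (fun _ => by positivity)
        (fun _ => by positivity)
    refine Summable.of_norm_bounded h1 fun p => ?_
    rw [norm_div, norm_pow, norm_mul, norm_pow, mul_pow, Complex.norm_natCast]
    calc ‖x‖ ^ (p.2 + 1) * (‖q‖ ^ p.1) ^ (p.2 + 1) / ((p.2 + 1 : ℕ) : ℝ)
        ≤ ‖x‖ ^ (p.2 + 1) * (‖q‖ ^ p.1) ^ (p.2 + 1) := by
          apply div_le_self (by positivity)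
          push_cast
          linarith [(Nat.cast_nonneg p.2 : (0 : ℝ) ≤ p.2)]
      _ ≤ ‖x‖ ^ p.2 * ‖q‖ ^ p.1 := by
          gcongr ?_ * ?_
          · exact pow_le_pow_of_le_one (norm_nonneg _) hx.le (Nat.le_succ _)
          · exact pow_le_of_le_one (by positivity) (pow_le_one₀ (norm_nonneg _) hq.le)
              (Nat.succ_ne_zero _)
      _ = ‖q‖ ^ p.1 * ‖x‖ ^ p.2 := mul_comm _ _
  have hne : ∀ k : ℕ, 1 - x * q ^ k ≠ 0 := one_sub_mul_pow_ne_zero hq hx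
  have hsl : Summable fun k : ℕ => Complex.log (1 - x * q ^ k) := by
    have := hsum.prod.neg
    refine this.congr fun k => ?_
    rw [(hlog k).tsum_eq, neg_neg]
  rw [qPochInf, ← Complex.cexp_tsum_eq_tprod hne hsl]
  congr 1
  have h3 : ∑' k : ℕ, Complex.log (1 - x * q ^ k) =
      -∑' (k : ℕ) (s : ℕ), (x * q ^ k) ^ (s + 1) / ((s + 1 : ℕ) : ℂ) := by
    rw [← tsum_neg]
    exact tsum_congr fun k => by rw [(hlog k).tsum_eq, neg_neg]
  rw [h3, ← hsum.tsum_comm (f := fun k s : ℕ => (x * q ^ k) ^ (s + 1) / ((s + 1 : ℕ) : ℂ))]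
  congr 1
  refine tsum_congr fun s => ?_
  have hqs : ‖q ^ (s + 1)‖ < 1 := (norm_pow_le_of_ne_zero hq (Nat.succ_ne_zero s)).trans_lt hq
  have h4 : ∀ k : ℕ, (x * q ^ k) ^ (s + 1) / ((s + 1 : ℕ) : ℂ) =
      x ^ (s + 1) / ((s + 1 : ℕ) : ℂ) * (q ^ (s + 1)) ^ k := fun k => by
    rw [mul_pow, ← pow_mul, ← pow_mul, mul_comm k]
    ring
  simp_rw [h4]
  rw [tsum_mul_left, tsum_geometric_of_norm_lt_one hqs]
  rw [div_mul_eq_div_div]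
  rfl

end Pochhammer

end StateIntegral

namespace StateIntegral

/-! ### The Jacobi triple product -/

section TripleProduct

variable {q : ℂ}

/-- The `q`-binomial coefficient, with value `0` for `k > n`. -/
noncomputable def qBinom (q : ℂ) (n k : ℕ) : ℂ :=
  if k ≤ n then qPoch q n / (qPoch q k * qPoch q (n - k)) else 0

theorem qPoch_succ (q : ℂ) (m : ℕ) : qPoch q (m + 1) = qPoch q m * (1 - q ^ (m + 1)) := by
  rw [qPoch, Finset.prod_range_succ, qPoch]

theorem qBinom_zero_right (hq : ‖q‖ < 1) (n : ℕ) : qBinom q n 0 = 1 := by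
  have := qPoch_ne_zero hq n
  simp [qBinom, this, show qPoch q 0 = 1 by simp [qPoch]]

/-- The q-Pascal rule, which drives the induction for the q-binomial theorem. The case k = n uses
the value 0 outside the range. -/
theorem qBinom_succ_succ (hq : ‖q‖ < 1) (n k : ℕ) :
    qBinom q (n + 1) (k + 1) = q ^ (k + 1) * qBinom q n (k + 1) + qBinom q n k := by
  have h0 : qPoch q 0 = 1 := by simp [qPoch]
  rcases lt_trichotomy k n with h | h | h
  · obtain ⟨d, rfl⟩ := Nat.exists_eq_add_of_lt h
    have e1 : k + d + 1 + 1 - (k + 1) = d + 1 := by omega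
    have e2 : k + d + 1 - (k + 1) = d := by omega
    have e3 : k + d + 1 - k = d + 1 := by omega
    rw [qBinom, qBinom, qBinom, if_pos (by omega), if_pos (by omega), if_pos (by omega), e1, e2, e3]
    have n1 := qPoch_ne_zero hq k
    have n2 := qPoch_ne_zero hq d
    have n3 : 1 - q ^ (k + 1) ≠ 0 := one_sub_pow_ne_zero hq (by omega)
    have n4 : 1 - q ^ (d + 1) ≠ 0 := one_sub_pow_ne_zero hq (by omega)
    rw [qPoch_succ q (k + d + 1), qPoch_succ q k, qPoch_succ q d]
    field_simp
    ring
  · subst h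
    have n1 := qPoch_ne_zero hq k
    have n2 := qPoch_ne_zero hq (k + 1)
    simp [qBinom, h0, n1, n2]
  · rw [qBinom, qBinom, qBinom, if_neg (by omega), if_neg (by omega), if_neg (by omega)]
    simp

theorem prod_one_add_mul_pow (hq : ‖q‖ < 1) (n : ℕ) (x : ℂ) :
    ∏ j ∈ Finset.range n, (1 + x * q ^ j) =
      ∑ k ∈ Finset.range (n + 1), qBinom q n k * q ^ (k.choose 2) * x ^ k := by
  induction n generalizing x with
  | zero => simp [qBinom_zero_right hq]
  | succ n ih =>
    have h1 : ∏ j ∈ Finset.range (n + 1), (1 + x * q ^ j) =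
        (1 + x) * ∏ j ∈ Finset.range n, (1 + (x * q) * q ^ j) := by
      rw [Finset.prod_range_succ', mul_comm]
      simp [pow_succ', mul_assoc]
    have hz : qBinom q n (n + 1) = 0 := by simp [qBinom]
    have h2 : ∑ k ∈ Finset.range (n + 1), qBinom q n k * q ^ (k.choose 2) * (x * q) ^ k =
        1 + ∑ k ∈ Finset.range (n + 1),
          qBinom q n (k + 1) * q ^ ((k + 1).choose 2) * (x * q) ^ (k + 1) := by
      have := Finset.sum_range_succ'
        (fun k => qBinom q n k * q ^ (k.choose 2) * (x * q) ^ k) (n + 1)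
      rw [Finset.sum_range_succ, hz] at this
      simp only [zero_mul, add_zero] at this
      rw [this, add_comm]
      simp [qBinom_zero_right hq]
    rw [h1, ih, Finset.sum_range_succ' _ (n + 1), add_mul, one_mul]
    nth_rewrite 1 [h2]
    rw [Finset.mul_sum]
    simp only [qBinom_zero_right hq, Nat.choose_zero_succ, pow_zero, mul_one]
    rw [add_assoc, ← Finset.sum_add_distrib, add_comm]
    congr 1
    refine Finset.sum_congr rfl fun k _ => ?_
    rw [qBinom_succ_succ hq, Nat.choose_succ_succ' k 1, Nat.choose_one_right, pow_add]
    ring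

theorem tendsto_qPoch (hq : ‖q‖ < 1) :
    Filter.Tendsto (qPoch q) Filter.atTop (nhds (qPochInf q q)) := by
  have := (multipliable_one_sub_mul_pow q hq).hasProd.tendsto_prod_nat
  refine this.congr fun n => ?_
  rw [qPoch_eq_prod]

theorem exists_qPoch_upper_bound (hq : ‖q‖ < 1) : ∃ C : ℝ, 0 < C ∧ ∀ m, ‖qPoch q m‖ ≤ C := by
  obtain ⟨C, hC⟩ := (tendsto_qPoch hq).norm.bddAbove_range
  exact ⟨max C 1, by positivity, fun m => le_max_of_le_left (hC ⟨m, rfl⟩)⟩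

theorem exists_qBinom_bound (hq : ‖q‖ < 1) : ∃ C : ℝ, 0 < C ∧ ∀ n k, ‖qBinom q n k‖ ≤ C := by
  obtain ⟨C, hC, hC'⟩ := exists_qPoch_upper_bound hq
  obtain ⟨c, hc, hc'⟩ := exists_qPoch_lower_bound hq
  refine ⟨C / (c * c), by positivity, fun n k => ?_⟩
  unfold qBinom
  split_ifs
  · rw [norm_div, norm_mul]
    gcongr
    exacts [hC' _, hc' _, hc' _]
  · rw [norm_zero]
    positivity

end TripleProduct

/-! ### Limit of the centred q-binomial theorem, and the theta function -/

section Theta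

open Complex Filter Topology

/-- The central `q`-binomial coefficient with index `N + n`, `n ∈ ℤ`. -/
noncomputable def centralBinom (q : ℂ) (N : ℕ) (n : ℤ) : ℂ :=
  if 0 ≤ N + n then qBinom q (2 * N) (N + n).toNat else 0

/-- The coefficient is (q)_{2N} / ((q)_{N+n} (q)_{N-n}) as soon as N ≥ |n|, and each of the three
symbols tends to (q)_∞. -/
theorem tendsto_centralBinom {q : ℂ} (hq : ‖q‖ < 1) (n : ℤ) :
    Tendsto (fun N => centralBinom q N n) atTop (𝓝 (qPochInf q q)⁻¹) := by
  have hne : qPochInf q q ≠ 0 := qPochInf_ne_zero_of_norm_lt hq hq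
  have t0 : Tendsto (fun N : ℕ => 2 * N) atTop atTop :=
    tendsto_atTop_mono (fun N => by simp only [id]; omega) tendsto_id
  have t1 : Tendsto (fun N : ℕ => (N + n).toNat) atTop atTop :=
    tendsto_atTop.mpr fun b => by
      filter_upwards [eventually_ge_atTop (b + n.natAbs)] with N hN
      omega
  have t2 : Tendsto (fun N : ℕ => 2 * N - (N + n).toNat) atTop atTop :=
    tendsto_atTop.mpr fun b => by
      filter_upwards [eventually_ge_atTop (b + n.natAbs)] with N hN
      omega
  have h := ((tendsto_qPoch hq).comp t0).div
    (((tendsto_qPoch hq).comp t1).mul ((tendsto_qPoch hq).comp t2)) (mul_ne_zero hne hne)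
  rw [div_mul_cancel_left₀ hne] at h
  refine h.congr' ?_
  filter_upwards [eventually_ge_atTop n.natAbs] with N hN
  rw [centralBinom, if_pos (by omega), qBinom, if_pos (by omega)]
  rfl

/-- The q-binomial theorem with 2N factors at Zq^{-N}. The last N factors are the 1 + Zq^k. The
first N, read backwards, are 1 + Zq^{-(k+1)} = Zq^{-(k+1)}(1 + Wq^k) with ZW = q. The extracted
monomials recentre the sum at k = N. -/
theorem finite_triple_product {τ : ℂ} (v : ℂ) (N : ℕ)
    (hq : ‖exp (2 * Real.pi * I * τ)‖ < 1) :
    (∏ k ∈ Finset.range N,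
        (1 - -exp (Real.pi * I * τ + 2 * Real.pi * I * v) * exp (2 * Real.pi * I * τ) ^ k)) *
      (∏ k ∈ Finset.range N,
        (1 - -exp (Real.pi * I * τ - 2 * Real.pi * I * v) * exp (2 * Real.pi * I * τ) ^ k)) =
    ∑' n : ℤ, centralBinom (exp (2 * Real.pi * I * τ)) N n * jacobiTheta₂_term n v τ := by
  set q := exp (2 * Real.pi * I * τ) with hqdef
  set Z := exp (Real.pi * I * τ + 2 * Real.pi * I * v) with hZ
  set W := exp (Real.pi * I * τ - 2 * Real.pi * I * v) with hW
  have hq0 : q ≠ 0 := exp_ne_zero _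
  have hZ0 : Z ≠ 0 := exp_ne_zero _
  have hZW : Z * W = q := by
    rw [hZ, hW, hqdef, ← exp_add]
    ring_nf
  have h1 := prod_one_add_mul_pow hq (2 * N) (Z * (q ^ N)⁻¹)
  have h2 : ∏ j ∈ Finset.range (2 * N), (1 + Z * (q ^ N)⁻¹ * q ^ j) =
      (∏ k ∈ Finset.range N, (1 - -Z * q ^ k)) * (∏ k ∈ Finset.range N, (1 - -W * q ^ k)) *
        ∏ k ∈ Finset.range N, (Z * (q ^ (k + 1))⁻¹) := by
    rw [two_mul, Finset.prod_range_add, mul_assoc]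
    rw [← Finset.prod_mul_distrib (f := fun k => 1 - -W * q ^ k), mul_comm]
    congr 1
    · refine Finset.prod_congr rfl fun k _ => ?_
      rw [pow_add]
      field_simp
      ring
    · rw [← Finset.prod_range_reflect (fun j => 1 + Z * (q ^ N)⁻¹ * q ^ j)]
      refine Finset.prod_congr rfl fun k hk => ?_
      have hk' := Finset.mem_range.mp hk
      have : q ^ N = q ^ (N - 1 - k) * q ^ (k + 1) := by
        rw [← pow_add]
        congr 1
        omega
      rw [this]
      have hw : W = q * Z⁻¹ := by
        rw [← hZW]
        field_simp
      rw [hw]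
      field_simp
      ring
  have h3 : ∏ k ∈ Finset.range N, (Z * (q ^ (k + 1))⁻¹) =
      exp (N * (Real.pi * I * τ + 2 * Real.pi * I * v) - Real.pi * I * τ * (N * (N + 1))) := by
    clear h1 h2
    induction N with
    | zero => simp
    | succ N ih =>
      rw [Finset.prod_range_succ, ih, hZ, hqdef, ← exp_nat_mul, ← exp_neg, ← exp_add, ← exp_add]
      congr 1
      push_cast
      ring
  have h4 : ∀ k : ℕ, q ^ (k.choose 2) = exp (Real.pi * I * τ * (k * (k - 1))) := fun k => by
    rw [hqdef, ← exp_nat_mul, Nat.cast_choose_two]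
    ring_nf
  have h5 : ∑' n : ℤ, centralBinom q N n * jacobiTheta₂_term n v τ =
      ∑ k ∈ Finset.range (2 * N + 1), qBinom q (2 * N) k * jacobiTheta₂_term (k - N) v τ := by
    have hs : ∀ n ∉ (Finset.range (2 * N + 1)).image (fun k : ℕ => (k - N : ℤ)),
        centralBinom q N n * jacobiTheta₂_term n v τ = 0 := fun n hn => by
      have : centralBinom q N n = 0 := by
        unfold centralBinom qBinom
        split_ifs with h h'
        · exact absurd (Finset.mem_image.mpr ⟨(N + n).toNat,
            Finset.mem_range.mpr (by omega), by omega⟩) hn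
        · rfl
        · rfl
      rw [this, zero_mul]
    rw [tsum_eq_sum hs, Finset.sum_image (fun a _ b _ h => by simpa using h)]
    refine Finset.sum_congr rfl fun k _ => ?_
    rw [centralBinom, if_pos (by omega)]
    congr 3
    omega
  rw [h5]
  have h6 : ∏ k ∈ Finset.range N, (Z * (q ^ (k + 1))⁻¹) ≠ 0 := by
    rw [h3]
    exact exp_ne_zero _
  apply mul_right_cancel₀ h6
  rw [← h2, h1, Finset.sum_mul]
  refine Finset.sum_congr rfl fun k _ => ?_
  rw [mul_assoc, mul_assoc]
  congr 1
  rw [h3, h4, jacobiTheta₂_term, mul_pow, inv_pow, ← pow_mul, hZ, hqdef, ← exp_nat_mul,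
    ← exp_nat_mul, ← exp_neg, ← exp_add, ← exp_add, ← exp_add]
  congr 1
  push_cast
  ring

theorem norm_exp_two_pi_I_lt_one {τ : ℂ} (hτ : 0 < τ.im) : ‖exp (2 * Real.pi * I * τ)‖ < 1 := by
  rw [norm_exp, Real.exp_lt_one_iff]
  have : (2 * Real.pi * I * τ).re = -(2 * Real.pi * τ.im) := by simp
  rw [this]
  have := Real.pi_pos
  simp only [neg_lt_zero]
  positivity

/-- The Jacobi triple product identity. -/
theorem jacobi_triple_product {τ : ℂ} (hτ : 0 < τ.im) (v : ℂ) :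
    qPochInf (-exp (Real.pi * I * τ + 2 * Real.pi * I * v)) (exp (2 * Real.pi * I * τ)) *
      qPochInf (-exp (Real.pi * I * τ - 2 * Real.pi * I * v)) (exp (2 * Real.pi * I * τ)) *
      qPochInf (exp (2 * Real.pi * I * τ)) (exp (2 * Real.pi * I * τ)) = jacobiTheta₂ v τ := by
  have hq := norm_exp_two_pi_I_lt_one hτ
  have hne := qPochInf_ne_zero_of_norm_lt hq hq
  obtain ⟨C, hC, hCb⟩ := exists_qBinom_bound hq
  have hl := ((multipliable_one_sub_mul_pow (-exp (Real.pi * I * τ + 2 * Real.pi * I * v))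
    hq).hasProd.tendsto_prod_nat).mul ((multipliable_one_sub_mul_pow
      (-exp (Real.pi * I * τ - 2 * Real.pi * I * v)) hq).hasProd.tendsto_prod_nat)
  have hr : Tendsto (fun N => ∑' n : ℤ, centralBinom (exp (2 * Real.pi * I * τ)) N n *
      jacobiTheta₂_term n v τ) atTop
      (𝓝 (∑' n : ℤ, (qPochInf (exp (2 * Real.pi * I * τ)) (exp (2 * Real.pi * I * τ)))⁻¹ *
        jacobiTheta₂_term n v τ)) := by
    -- Dominated convergence: the binomials are bounded uniformly in N and n, and the theta series
    -- converges absolutely.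
    refine tendsto_tsum_of_dominated_convergence
      (bound := fun n => C * ‖jacobiTheta₂_term n v τ‖)
      (((summable_jacobiTheta₂_term_iff v τ).mpr hτ).norm.mul_left C)
      (fun n => (tendsto_centralBinom hq n).mul_const _)
      (Eventually.of_forall fun N n => ?_)
    rw [norm_mul]
    gcongr
    unfold centralBinom
    split_ifs
    · exact hCb _ _
    · simpa using hC.le
  have hu := tendsto_nhds_unique hl (hr.congr fun N => (finite_triple_product v N hq).symm)
  unfold qPochInf at hu ⊢
  rw [hu, tsum_mul_left, jacobiTheta₂]
  unfold qPochInf at hne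
  field_simp

end Theta

end StateIntegral

namespace StateIntegral

/-! ### Faddeev's quantum dilogarithm: inversion and modularity -/

section Inversion

open Complex Filter Topology

/-- The numerator of Faddeev's quantum dilogarithm. -/
noncomputable def faddeevNum (b x : ℂ) : ℂ :=
  qPochInf (exp (2 * Real.pi * b * (x + cb b))) (qParam b)

/-- The denominator of Faddeev's quantum dilogarithm. -/
noncomputable def faddeevDen (b x : ℂ) : ℂ :=
  qPochInf (exp (2 * Real.pi * b⁻¹ * (x - cb b))) (qDual b)

theorem faddeev_eq_div (b x : ℂ) : faddeev b x = faddeevNum b x / faddeevDen b x := rfl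

variable {b : ℂ}

theorem ne_zero_of_im_sq_pos (hb : 0 < (b ^ 2).im) : b ≠ 0 := by
  rintro rfl
  simp at hb

theorem im_pos_of_im_sq_pos (hb : 0 < (b ^ 2).im) (hre : 0 < b.re) : 0 < b.im := by
  have : (b ^ 2).im = 2 * b.re * b.im := by rw [sq, mul_im]; ring
  rw [this] at hb
  by_contra! h
  nlinarith [mul_nonneg hre.le (neg_nonneg.mpr h)]

theorem im_neg_inv_sq_pos (hb : 0 < (b ^ 2).im) : 0 < (-(b ^ 2)⁻¹).im := by
  have h0 : b ^ 2 ≠ 0 := pow_ne_zero 2 (ne_zero_of_im_sq_pos hb)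
  rw [neg_im, inv_im, neg_div, neg_neg]
  exact div_pos hb (normSq_pos.mpr h0)

theorem qDual_eq (b : ℂ) : qDual b = exp (2 * Real.pi * I * (-(b ^ 2)⁻¹)) := by
  rw [qDual, mul_neg]

theorem norm_qParam_lt_one (hb : 0 < (b ^ 2).im) : ‖qParam b‖ < 1 :=
  norm_exp_two_pi_I_lt_one hb

theorem norm_qDual_lt_one (hb : 0 < (b ^ 2).im) : ‖qDual b‖ < 1 := by
  rw [qDual_eq]
  exact norm_exp_two_pi_I_lt_one (im_neg_inv_sq_pos hb)

theorem qDual_ne_zero (b : ℂ) : qDual b ≠ 0 := exp_ne_zero _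

theorem exp_num_eq (hb0 : b ≠ 0) (x : ℂ) : exp (2 * Real.pi * b * (x + cb b)) =
    -exp (Real.pi * I * b ^ 2 + 2 * Real.pi * b * x) := by
  have : 2 * Real.pi * b * (x + cb b) =
      (Real.pi * I * b ^ 2 + 2 * Real.pi * b * x) + Real.pi * I := by
    rw [cb]
    field_simp
    ring
  rw [this, exp_add, exp_pi_mul_I]
  ring

theorem exp_den_eq (hb0 : b ≠ 0) (x : ℂ) : exp (2 * Real.pi * b⁻¹ * (x - cb b)) =
    -exp (Real.pi * I * (-(b ^ 2)⁻¹) + 2 * Real.pi * b⁻¹ * x) := by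
  have : 2 * Real.pi * b⁻¹ * (x - cb b) =
      (Real.pi * I * (-(b ^ 2)⁻¹) + 2 * Real.pi * b⁻¹ * x) - Real.pi * I := by
    rw [cb]
    field_simp
    ring
  rw [this, exp_sub, exp_pi_mul_I]
  ring

/-- The inversion relation, in a form free of denominators. -/
theorem exists_inversion (hb : 0 < (b ^ 2).im) : ∃ K : ℂ, K ≠ 0 ∧ ∀ x : ℂ,
    faddeevNum b x * faddeevNum b (-x) =
      K * exp (Real.pi * I * x ^ 2) * (faddeevDen b x * faddeevDen b (-x)) := by
  have hb0 := ne_zero_of_im_sq_pos hb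
  have hq := qPochInf_ne_zero_of_norm_lt (norm_qParam_lt_one hb) (norm_qParam_lt_one hb)
  have hqt := qPochInf_ne_zero_of_norm_lt (norm_qDual_lt_one hb) (norm_qDual_lt_one hb)
  have hc : (-I * b ^ 2) ^ (1 / 2 : ℂ) ≠ 0 := by
    simp [cpow_eq_zero_iff, hb0]
  refine ⟨1 / (-I * b ^ 2) ^ (1 / 2 : ℂ) * qPochInf (qDual b) (qDual b) /
    qPochInf (qParam b) (qParam b), 
    div_ne_zero (mul_ne_zero (one_div_ne_zero hc) hqt) hq, fun x => ?_⟩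
  -- The arguments are chosen so that the triple product with τ = b² is `faddeevNum` at x and -x
  -- times (q)_∞, and the one with τ = -b⁻² is `faddeevDen` at x and -x times (q̃)_∞. The functional
  -- equation exchanges the two theta values and produces e^{πix²}.
  have h1 := jacobi_triple_product hb (-I * b * x)
  have h2 := jacobi_triple_product (im_neg_inv_sq_pos hb) (-I * b⁻¹ * x)
  rw [jacobiTheta₂_functional_equation] at h1
  have e1 : -I * b * x / b ^ 2 = -I * b⁻¹ * x := by field_simp
  have e2 : -1 / b ^ 2 = -(b ^ 2)⁻¹ := by field_simp
  have e3 : -Real.pi * I * (-I * b * x) ^ 2 / b ^ 2 = Real.pi * I * x ^ 2 := by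
    field_simp
    linear_combination (-x ^ 2) * I_sq
  have e4 : 2 * Real.pi * I * (-I * b * x) = 2 * Real.pi * b * x := by
    linear_combination (-2 * Real.pi * b * x) * I_sq
  have e5 : 2 * Real.pi * I * (-I * b⁻¹ * x) = 2 * Real.pi * b⁻¹ * x := by
    linear_combination (-2 * Real.pi * b⁻¹ * x) * I_sq
  rw [e1, e2, e3, ← h2, e4, e5, ← qDual_eq] at h1
  rw [faddeevNum, faddeevNum, faddeevDen, faddeevDen, exp_num_eq hb0, exp_num_eq hb0,
    exp_den_eq hb0, exp_den_eq hb0]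
  simp only [mul_neg, ← sub_eq_add_neg, ← neg_add'] at h1 ⊢
  rw [← qParam] at h1
  field_simp
  field_simp at h1
  linear_combination h1

theorem sqrt_sq_of_re_pos {z : ℂ} (hz : 0 < z.re) : Complex.sqrt (z ^ 2) = z := by
  rw [Complex.sqrt]
  have h := Complex.abs_arg_lt_pi_div_two_iff.mpr (Or.inl hz)
  rw [abs_lt] at h
  have := Complex.pow_cpow_nat_inv (x := z) (n := 2) two_ne_zero
    (by push_cast; linarith) (by push_cast; linarith)
  simpa using this

/-- The modular transformation of `(q)_∞`. -/
theorem qPochInf_ratio (hb : 0 < (b ^ 2).im) (hre : 0 < b.re) :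
    b * qPochInf (qParam b) (qParam b) = qPochInf (qDual b) (qDual b) *
      (exp (Real.pi * I / 4) *
        exp (1 / 24 * (2 * Real.pi * I * (-(b ^ 2)⁻¹ - b ^ 2)))) := by
  -- The transformation of η under τ ↦ -1/τ at τ = b². Since Re b > 0 the principal root of b² is b,
  -- and √i = e^{πi/4}.
  have h := ModularForm.eta_comp_eq_csqrt_I_inv (show b ^ 2 ∈ UpperHalfPlane.upperHalfPlaneSet from hb)
  have hpoch : ∀ z : ℂ, ∏' n, (1 - ModularForm.eta_q n z) =
      qPochInf (exp (2 * Real.pi * I * z)) (exp (2 * Real.pi * I * z)) := fun z => by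
    rw [qPochInf]
    refine tprod_congr fun n => ?_
    rw [ModularForm.eta_q_eq_pow, pow_succ']
  have hI : Complex.sqrt I = exp (Real.pi * I / 4) := by
    rw [Complex.sqrt, cpow_def_of_ne_zero I_ne_zero, log_I]
    ring_nf
  simp only [Function.comp_apply, Pi.smul_apply, Pi.mul_apply, smul_eq_mul, ModularForm.eta, hpoch,
    sqrt_sq_of_re_pos hre, hI, Function.Periodic.qParam] at h
  rw [show -1 / b ^ 2 = -(b ^ 2)⁻¹ by rw [neg_div, one_div], ← qDual_eq] at h
  rw [← qParam] at h
  have e : exp (1 / 24 * (2 * Real.pi * I * (-(b ^ 2)⁻¹ - b ^ 2))) =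
      exp (2 * Real.pi * I * -(b ^ 2)⁻¹ / 24) * (exp (2 * Real.pi * I * b ^ 2 / 24))⁻¹ := by
    rw [← exp_neg, ← exp_add]
    ring_nf
  rw [e]
  have n1 := exp_ne_zero (Real.pi * I / 4)
  have n2 := exp_ne_zero (2 * Real.pi * I * b ^ 2 / 24)
  push_cast at h
  field_simp at h ⊢
  linear_combination -h

end Inversion

end StateIntegral

namespace StateIntegral

/-! ### Contour integrals over parallelograms and sectors -/

section Contour

open Complex Filter Topology MeasureTheory Set

/-- Cauchy's theorem for a parallelogram. -/
theorem integral_parallelogram_eq_zero {g : ℂ → ℂ} {p u v : ℂ} {a c : ℝ} (ha : 0 ≤ a) (hc : 0 ≤ c)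
    (hd : ∀ s ∈ Icc 0 a, ∀ t ∈ Icc 0 c, DifferentiableAt ℂ g (p + s * u + t * v)) :
    u * (∫ s in (0 : ℝ)..a, g (p + s * u)) + v * (∫ t in (0 : ℝ)..c, g (p + a * u + t * v)) -
      u * (∫ s in (0 : ℝ)..a, g (p + s * u + c * v)) - v * (∫ t in (0 : ℝ)..c, g (p + t * v)) =
      0 := by
  set L : ℝ × ℝ → ℂ := fun x => p + x.1 * u + x.2 * v with hL
  set L' : ℝ × ℝ →L[ℝ] ℂ := (ContinuousLinearMap.fst ℝ ℝ ℝ).smulRight u +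
    (ContinuousLinearMap.snd ℝ ℝ ℝ).smulRight v with hL'
  have hLd : ∀ x, HasFDerivAt L L' x := fun x => by
    have h1 := (ContinuousLinearMap.smulRight (ContinuousLinearMap.fst ℝ ℝ ℝ) u).hasFDerivAt (x := x)
    have h2 := (ContinuousLinearMap.smulRight (ContinuousLinearMap.snd ℝ ℝ ℝ) v).hasFDerivAt (x := x)
    have h3 := (h1.add h2).const_add p
    refine h3.congr_of_eventuallyEq (Eventually.of_forall fun y => ?_)
    simp [hL, add_assoc]
  have hgd : ∀ x ∈ Icc 0 a ×ˢ Icc 0 c,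
      HasFDerivAt (fun y => g (L y)) (deriv g (L x) • L') x := fun x hx => by
    have := (hd x.1 hx.1 x.2 hx.2).hasDerivAt
    exact this.comp_hasFDerivAt (h₂ := g) x (hLd x)
  have hcont : ContinuousOn (fun y => g (L y)) (Icc 0 a ×ˢ Icc 0 c) := fun x hx =>
    (hgd x hx).continuousAt.continuousWithinAt
  -- Pull back along the real affine map (s,t) ↦ p + su + tv and apply the divergence theorem to the
  -- field (v·g, -u·g). By holomorphy its divergence is v·g'·u - u·g'·v = 0.
  have key := integral2_divergence_prod_of_hasFDerivAt_off_countable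
    (fun x => v * g (L x)) (fun x => -u * g (L x))
    (fun x => v • (deriv g (L x) • L')) (fun x => (-u) • (deriv g (L x) • L')) 0 0 a c ∅
    countable_empty (by rw [uIcc_of_le ha, uIcc_of_le hc]; exact continuousOn_const.mul hcont)
    (by rw [uIcc_of_le ha, uIcc_of_le hc]; exact continuousOn_const.mul hcont)
    (fun x hx => by
      rw [min_eq_left ha, max_eq_right ha, min_eq_left hc, max_eq_right hc] at hx
      exact (hgd x ⟨Ioo_subset_Icc_self hx.1.1, Ioo_subset_Icc_self hx.1.2⟩).const_mul v)
    (fun x hx => by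
      rw [min_eq_left ha, max_eq_right ha, min_eq_left hc, max_eq_right hc] at hx
      exact (hgd x ⟨Ioo_subset_Icc_self hx.1.1, Ioo_subset_Icc_self hx.1.2⟩).const_mul (-u))
    (by
      refine (integrableOn_zero).congr_fun (fun x _ => ?_) (measurableSet_uIcc.prod measurableSet_uIcc)
      simp [hL']
      ring)
  have hz : ∀ x : ℝ × ℝ, (v • (deriv g (L x) • L')) (1, 0) +
      ((-u) • (deriv g (L x) • L')) (0, 1) = 0 := fun x => by
    simp [hL']
    ring
  simp only [hz, intervalIntegral.integral_zero] at key
  simp only [hL, intervalIntegral.integral_const_mul, ofReal_zero, zero_mul, add_zero] at key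
  linear_combination -key

theorem continuousOn_ray {g : ℂ → ℂ} {p u : ℂ}
    (hd : ∀ s : ℝ, 0 ≤ s → DifferentiableAt ℂ g (p + s * u)) :
    ContinuousOn (fun s : ℝ => g (p + s * u)) (Ici 0) := fun s hs => by
  have h1 : ContinuousAt (fun s : ℝ => p + s * u) s := by fun_prop
  exact (ContinuousAt.comp (f := fun s : ℝ => p + s * u) (g := g)
    (hd s hs).continuousAt h1).continuousWithinAt

theorem integrableOn_ray {g : ℂ → ℂ} {p u : ℂ} {C κ : ℝ} (hκ : 0 < κ)
    (hd : ∀ s : ℝ, 0 ≤ s → DifferentiableAt ℂ g (p + s * u))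
    (hb : ∀ s : ℝ, 0 ≤ s → ‖g (p + s * u)‖ ≤ C * Real.exp (-κ * s)) :
    IntegrableOn (fun s : ℝ => g (p + s * u)) (Ioi 0) := by
  refine Integrable.mono' ((exp_neg_integrableOn_Ioi 0 hκ).const_mul C)
    (((continuousOn_ray hd).mono Ioi_subset_Ici_self).aestronglyMeasurable measurableSet_Ioi) ?_
  filter_upwards [ae_restrict_mem measurableSet_Ioi] with s hs
  exact hb s (le_of_lt hs)

/-- Rotation of a half line inside a sector where the integrand decays exponentially. -/
theorem integral_ray_rotate {g : ℂ → ℂ} {p u v : ℂ} {C κ : ℝ} (hκ : 0 < κ)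
    (hd : ∀ s t : ℝ, 0 ≤ s → 0 ≤ t → DifferentiableAt ℂ g (p + s * u + t * v))
    (hb : ∀ s t : ℝ, 0 ≤ s → 0 ≤ t →
      ‖g (p + s * u + t * v)‖ ≤ C * Real.exp (-κ * (s + t))) :
    u * ∫ s in Ioi (0 : ℝ), g (p + s * u) = v * ∫ t in Ioi (0 : ℝ), g (p + t * v) := by
  have hdu : ∀ s : ℝ, 0 ≤ s → DifferentiableAt ℂ g (p + s * u) := fun s hs => by
    simpa using hd s 0 hs le_rfl
  have hdv : ∀ s : ℝ, 0 ≤ s → DifferentiableAt ℂ g (p + s * v) := fun s hs => by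
    simpa using hd 0 s le_rfl hs
  have hiu := integrableOn_ray hκ hdu fun s hs => by simpa using hb s 0 hs le_rfl
  have hiv := integrableOn_ray hκ hdv fun s hs => by simpa using hb 0 s le_rfl hs
  have hN : Tendsto (fun n : ℕ => (n : ℝ)) atTop atTop := tendsto_natCast_atTop_atTop
  have hlu := (intervalIntegral_tendsto_integral_Ioi 0 hiu hN).const_mul u
  have hlv := (intervalIntegral_tendsto_integral_Ioi 0 hiv hN).const_mul v
  have hC : 0 ≤ C := by
    have := (norm_nonneg _).trans (hb 0 0 le_rfl le_rfl)
    simpa using this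
  have hdecay : Tendsto (fun n : ℕ => C * ((n : ℝ) * Real.exp (-κ * n))) atTop (𝓝 0) := by
    have h1 := (Real.tendsto_pow_mul_exp_neg_atTop_nhds_zero 1).comp
      (hN.const_mul_atTop hκ)
    have h2 := (h1.const_mul (C / κ))
    rw [mul_zero] at h2
    refine h2.congr fun n => ?_
    simp only [Function.comp_apply, pow_one, neg_mul]
    field_simp
  have hz : ∀ F : ℕ → ℝ → ℂ, (∀ (n : ℕ) (s : ℝ), 0 ≤ s → ‖F n s‖ ≤ C * Real.exp (-κ * n)) →
      Tendsto (fun n : ℕ => ∫ s in (0 : ℝ)..n, F n s) atTop (𝓝 0) := fun F hF => by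
    refine squeeze_zero_norm (fun n => ?_) hdecay
    have := intervalIntegral.norm_integral_le_of_norm_le_const (a := (0 : ℝ)) (b := n)
      (f := F n) (C := C * Real.exp (-κ * n)) (fun s hs => by
        rw [uIoc_of_le (Nat.cast_nonneg n)] at hs
        exact hF n s hs.1.le)
    rw [sub_zero, abs_of_nonneg (Nat.cast_nonneg n)] at this
    linarith
  have hmono : ∀ s t : ℝ, 0 ≤ s → C * Real.exp (-κ * (t + s)) ≤ C * Real.exp (-κ * t) :=
    fun s t hs => mul_le_mul_of_nonneg_left (Real.exp_le_exp.mpr (by nlinarith)) hC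
  -- The two far sides of the parallelogram of size n have length proportional to n and carry values
  -- of size e^{-κn}, so their contribution vanishes in the limit.
  have h1 := (hz (fun n s => g (p + (n : ℝ) * u + s * v)) (fun n s hs =>
    (hb n s (Nat.cast_nonneg n) hs).trans (hmono s n hs))).const_mul v
  have h2 := (hz (fun n s => g (p + s * u + (n : ℝ) * v)) (fun n s hs =>
    (hb s n hs (Nat.cast_nonneg n)).trans (by rw [add_comm]; exact hmono s n hs))).const_mul u
  have hlim := ((hlu.add h1).sub h2).sub hlv
  have h0 := tendsto_nhds_unique hlim (tendsto_const_nhds.congr fun n : ℕ =>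
    (integral_parallelogram_eq_zero (g := g) (p := p) (u := u) (v := v) (Nat.cast_nonneg n)
      (Nat.cast_nonneg n) fun s hs t ht => hd s t hs.1 ht.1).symm)
  rw [mul_zero, mul_zero, add_zero, sub_zero] at h0
  exact sub_eq_zero.mp h0

/-! ### Boundary integrals over a parallelogram and the residue theorem -/

/-- The boundary of the parallelogram with corner `p` and sides `u`, `v`. -/
def paraBoundary (p u v : ℂ) : Set ℂ :=
  {x | ∃ s ∈ Icc (0 : ℝ) 1, ∃ t ∈ Icc (0 : ℝ) 1,
    (s = 0 ∨ s = 1 ∨ t = 0 ∨ t = 1) ∧ x = p + s * u + t * v}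

/-- The integral over the boundary of the parallelogram with corner `p` and sides `u`, `v`. -/
noncomputable def paraIntegral (g : ℂ → ℂ) (p u v : ℂ) : ℂ :=
  u * (∫ s in (0 : ℝ)..1, g (p + s * u)) + v * (∫ t in (0 : ℝ)..1, g (p + u + t * v)) -
    u * (∫ s in (0 : ℝ)..1, g (p + s * u + v)) - v * (∫ t in (0 : ℝ)..1, g (p + t * v))

variable {g h : ℂ → ℂ} {p u v c : ℂ}

theorem mem_paraBoundary₁ {s : ℝ} (hs : s ∈ uIcc (0 : ℝ) 1) : p + s * u ∈ paraBoundary p u v := by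
  rw [uIcc_of_le zero_le_one] at hs
  exact ⟨s, hs, 0, by simp, by simp, by simp⟩

theorem mem_paraBoundary₂ {s : ℝ} (hs : s ∈ uIcc (0 : ℝ) 1) :
    p + u + s * v ∈ paraBoundary p u v := by
  rw [uIcc_of_le zero_le_one] at hs
  exact ⟨1, by simp, s, hs, by simp, by simp⟩

theorem mem_paraBoundary₃ {s : ℝ} (hs : s ∈ uIcc (0 : ℝ) 1) :
    p + s * u + v ∈ paraBoundary p u v := by
  rw [uIcc_of_le zero_le_one] at hs
  exact ⟨s, hs, 1, by simp, by simp, by simp⟩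

theorem mem_paraBoundary₄ {s : ℝ} (hs : s ∈ uIcc (0 : ℝ) 1) : p + s * v ∈ paraBoundary p u v := by
  rw [uIcc_of_le zero_le_one] at hs
  exact ⟨0, by simp, s, hs, by simp, by simp⟩

theorem paraIntegral_congr (hgh : EqOn g h (paraBoundary p u v)) :
    paraIntegral g p u v = paraIntegral h p u v := by
  unfold paraIntegral
  congr 1
  · congr 1
    · congr 1
      · congr 1
        exact intervalIntegral.integral_congr fun s hs => hgh (mem_paraBoundary₁ hs)
      · congr 1
        exact intervalIntegral.integral_congr fun s hs => hgh (mem_paraBoundary₂ hs)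
    · congr 1
      exact intervalIntegral.integral_congr fun s hs => hgh (mem_paraBoundary₃ hs)
  · congr 1
    exact intervalIntegral.integral_congr fun s hs => hgh (mem_paraBoundary₄ hs)

theorem edge_integrable (hg : ContinuousOn g (paraBoundary p u v)) {γ : ℝ → ℂ}
    (hγ : Continuous γ) (hm : ∀ s ∈ uIcc (0 : ℝ) 1, γ s ∈ paraBoundary p u v) :
    IntervalIntegrable (fun s : ℝ => g (γ s)) volume 0 1 :=
  (hg.comp hγ.continuousOn hm).intervalIntegrable

theorem paraIntegral_add (hg : ContinuousOn g (paraBoundary p u v))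
    (hh : ContinuousOn h (paraBoundary p u v)) :
    paraIntegral (fun x => g x + h x) p u v = paraIntegral g p u v + paraIntegral h p u v := by
  unfold paraIntegral
  rw [intervalIntegral.integral_add
      (edge_integrable hg (γ := fun s : ℝ => p + s * u) (by fun_prop) fun s => mem_paraBoundary₁)
      (edge_integrable hh (γ := fun s : ℝ => p + s * u) (by fun_prop) fun s => mem_paraBoundary₁),
    intervalIntegral.integral_add
      (edge_integrable hg (γ := fun s : ℝ => p + u + s * v) (by fun_prop) fun s => mem_paraBoundary₂)
      (edge_integrable hh (γ := fun s : ℝ => p + u + s * v) (by fun_prop) fun s => mem_paraBoundary₂),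
    intervalIntegral.integral_add
      (edge_integrable hg (γ := fun s : ℝ => p + s * u + v) (by fun_prop) fun s => mem_paraBoundary₃)
      (edge_integrable hh (γ := fun s : ℝ => p + s * u + v) (by fun_prop) fun s => mem_paraBoundary₃),
    intervalIntegral.integral_add
      (edge_integrable hg (γ := fun s : ℝ => p + s * v) (by fun_prop) fun s => mem_paraBoundary₄)
      (edge_integrable hh (γ := fun s : ℝ => p + s * v) (by fun_prop) fun s => mem_paraBoundary₄)]
  ring

theorem paraIntegral_const_mul (a : ℂ) :
    paraIntegral (fun x => a * g x) p u v = a * paraIntegral g p u v := by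
  simp only [paraIntegral, intervalIntegral.integral_const_mul]
  ring

theorem paraIntegral_eq_zero_of_differentiableAt
    (hd : ∀ s ∈ Icc (0 : ℝ) 1, ∀ t ∈ Icc (0 : ℝ) 1, DifferentiableAt ℂ g (p + s * u + t * v)) :
    paraIntegral g p u v = 0 := by
  have := integral_parallelogram_eq_zero zero_le_one zero_le_one hd
  simpa [paraIntegral] using this

theorem integral_edge_of_hasDerivAt {G : ℂ → ℂ} {w d : ℂ}
    (hG : ∀ s ∈ uIcc (0 : ℝ) 1, HasDerivAt G (g (w + s * d)) (w + s * d))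
    (hg : IntervalIntegrable (fun s : ℝ => g (w + s * d)) volume 0 1) :
    d * ∫ s in (0 : ℝ)..1, g (w + s * d) = G (w + d) - G w := by
  rw [← intervalIntegral.integral_const_mul]
  have := intervalIntegral.integral_eq_sub_of_hasDerivAt (a := (0 : ℝ)) (b := 1)
    (f := fun s : ℝ => G (w + s * d)) (f' := fun s : ℝ => d * g (w + s * d)) (fun s hs => by
      have h1 : HasDerivAt (fun s : ℝ => w + s * d) d s := by
        simpa using ((ofRealCLM.hasDerivAt (x := s)).mul_const d).const_add w
      have := (hG s hs).comp s h1
      rwa [mul_comm] at this) (hg.const_mul d)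
  simpa using this

theorem paraIntegral_eq_zero_of_hasDerivAt {G : ℂ → ℂ}
    (hG : ∀ x ∈ paraBoundary p u v, HasDerivAt G (g x) x)
    (hg : ContinuousOn g (paraBoundary p u v)) : paraIntegral g p u v = 0 := by
  unfold paraIntegral
  have e3 : ∀ s : ℝ, p + s * u + v = p + v + s * u := fun s => by ring
  simp only [e3]
  rw [integral_edge_of_hasDerivAt (fun s hs => hG _ (mem_paraBoundary₁ hs))
      (edge_integrable hg (γ := fun s : ℝ => p + s * u) (by fun_prop) fun s => mem_paraBoundary₁),
    integral_edge_of_hasDerivAt (fun s hs => hG _ (mem_paraBoundary₂ hs))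
      (edge_integrable hg (γ := fun s : ℝ => p + u + s * v) (by fun_prop) fun s => mem_paraBoundary₂),
    integral_edge_of_hasDerivAt (fun s hs => hG _ (e3 s ▸ mem_paraBoundary₃ hs))
      (edge_integrable hg (γ := fun s : ℝ => p + v + s * u) (by fun_prop)
        fun s hs => e3 s ▸ mem_paraBoundary₃ hs),
    integral_edge_of_hasDerivAt (fun s hs => hG _ (mem_paraBoundary₄ hs))
      (edge_integrable hg (γ := fun s : ℝ => p + s * v) (by fun_prop) fun s => mem_paraBoundary₄)]
  rw [add_right_comm p v u]
  ring

/-- Seen from the origin, the edge divided by its start w is the segment from 1 to 1 + d/w. As d/w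
is not real, the segment avoids the cut of the principal logarithm, which is therefore a primitive
along it. -/
theorem integral_edge_inv {w d : ℂ} (hw : w ≠ 0) (h : (d / w).im ≠ 0) :
    d * ∫ s in (0 : ℝ)..1, (w + s * d)⁻¹ = Complex.log (1 + d / w) := by
  have hslit : ∀ s : ℝ, 1 + s * (d / w) ∈ slitPlane := fun s => by
    rcases eq_or_ne s 0 with rfl | hs
    · simp
    · refine Or.inr ?_
      simpa using ⟨hs, h⟩
  have hne : ∀ s : ℝ, w + s * d ≠ 0 := fun s hs => by
    have : 1 + s * (d / w) = 0 := by
      rw [show 1 + s * (d / w) = (w + s * d) / w by field_simp, hs, zero_div]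
    exact slitPlane_ne_zero (hslit s) this
  have hc : Continuous fun s : ℝ => (w + s * d)⁻¹ := Continuous.inv₀ (by fun_prop) hne
  have := integral_edge_of_hasDerivAt (g := fun x => x⁻¹) (G := fun x => Complex.log (x / w))
    (w := w) (d := d) (fun s _ => by
      have h1 : HasDerivAt (fun x : ℂ => x / w) (1 / w) (w + s * d) := by
        simpa using (hasDerivAt_id (w + s * d)).div_const w
      have h2 : (w + s * d) / w = 1 + s * (d / w) := by field_simp
      have h3 := h1.clog (by rw [h2]; exact hslit s)
      convert h3 using 1
      have := hne s
      field_simp) (hc.intervalIntegrable 0 1)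
  rw [this, div_self hw, log_one, sub_zero, add_div, div_self hw]

theorem one_add_ne_zero_of_im {z : ℂ} (h : z.im ≠ 0) : 1 + z ≠ 0 := fun h' => by
  apply h
  have := congrArg Complex.im h'
  simpa using this

/-- The four edges give four principal logarithms of quotients of consecutive corners. The combined
exponential is 1, so their signed sum is 2πi times an integer. Every edge, taken with its
orientation, turns by an angle in [0,π] and at least one angle is positive and one less than π, so
the total lies strictly between 0 and 4π and the integer is 1. -/
theorem paraIntegral_inv {α β : ℝ} (hα : α ∈ Ioo (0 : ℝ) 1) (hβ : β ∈ Ioo (0 : ℝ) 1)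
    (huv : 0 < (v / u).im) :
    paraIntegral (fun x => (x - (p + α * u + β * v))⁻¹) p u v = 2 * Real.pi * I := by
  have hu : u ≠ 0 := by
    rintro rfl
    simp at huv
  have e1 : ∀ s : ℝ, p + s * u - (p + α * u + β * v) = (-α * u - β * v) + s * u := fun s => by ring
  have e2 : ∀ s : ℝ, p + u + s * v - (p + α * u + β * v) = ((1 - α) * u - β * v) + s * v :=
    fun s => by ring
  have e3 : ∀ s : ℝ, p + s * u + v - (p + α * u + β * v) = (-α * u + (1 - β) * v) + s * u :=
    fun s => by ring
  have e4 : ∀ s : ℝ, p + s * v - (p + α * u + β * v) = (-α * u - β * v) + s * v := fun s => by ring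
  set ρ := v / u with hρ
  have hv : v = ρ * u := by rw [hρ]; field_simp
  have him : ∀ z : ℂ, (z⁻¹).im = -z.im / normSq z := fun z => inv_im z
  have imne : ∀ z : ℂ, z.im ≠ 0 → z ≠ 0 := fun z hz h0 => hz (by simp [h0])
  -- After division by u only the ratio ρ = v/u matters. Its positive imaginary part places the
  -- corners below or above the pole and so determines the signs of all four angles.
  have d1 : (-α - β * ρ : ℂ).im < 0 := by simpa using mul_pos hβ.1 huv
  have d2 : (1 - α - β * ρ : ℂ).im < 0 := by simpa using mul_pos hβ.1 huv
  have d3 : 0 < (-α + (1 - β) * ρ : ℂ).im := by simpa using mul_pos (sub_pos.mpr hβ.2) huv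
  have n1 := imne _ d1.ne
  have n2 := imne _ d2.ne
  have n3 := imne _ d3.ne'
  have w1 : (-α * u - β * v : ℂ) = (-α - β * ρ) * u := by rw [hv]; ring
  have w2 : ((1 - α) * u - β * v : ℂ) = (1 - α - β * ρ) * u := by rw [hv]; ring
  have w3 : (-α * u + (1 - β) * v : ℂ) = (-α + (1 - β) * ρ) * u := by rw [hv]; ring
  have q1 : u / (-α * u - β * v) = (-α - β * ρ)⁻¹ := by rw [w1]; field_simp
  have q2 : v / ((1 - α) * u - β * v) = ρ / (1 - α - β * ρ) := by rw [w2, hv]; field_simp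
  have q3 : u / (-α * u + (1 - β) * v) = (-α + (1 - β) * ρ)⁻¹ := by rw [w3]; field_simp
  have q4 : v / (-α * u - β * v) = ρ / (-α - β * ρ) := by rw [w1, hv]; field_simp
  have i1 : 0 < (u / (-α * u - β * v)).im := by
    rw [q1, him]
    exact div_pos (neg_pos.mpr d1) (normSq_pos.mpr n1)
  have i2 : 0 < (v / ((1 - α) * u - β * v)).im := by
    rw [q2, div_im, ← sub_div]
    refine div_pos ?_ (normSq_pos.mpr n2)
    simp
    nlinarith [mul_pos (sub_pos.mpr hα.2) huv]
  have i3 : (u / (-α * u + (1 - β) * v)).im < 0 := by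
    rw [q3, him]
    exact div_neg_of_neg_of_pos (neg_neg_iff_pos.mpr d3) (normSq_pos.mpr n3)
  have i4 : (v / (-α * u - β * v)).im < 0 := by
    rw [q4, div_im, ← sub_div]
    refine div_neg_of_neg_of_pos ?_ (normSq_pos.mpr n1)
    simp
    nlinarith [mul_pos hα.1 huv]
  have z1 : (-α * u - β * v : ℂ) ≠ 0 := by rw [w1]; exact mul_ne_zero n1 hu
  have z2 : ((1 - α) * u - β * v : ℂ) ≠ 0 := by rw [w2]; exact mul_ne_zero n2 hu
  have z3 : (-α * u + (1 - β) * v : ℂ) ≠ 0 := by rw [w3]; exact mul_ne_zero n3 hu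
  unfold paraIntegral
  simp only [e1, e2, e3, e4]
  rw [integral_edge_inv z1 i1.ne', integral_edge_inv z2 i2.ne', integral_edge_inv z3 i3.ne,
    integral_edge_inv z1 i4.ne]
  have a1 : 0 < (Complex.log (1 + u / (-α * u - β * v))).im ∧
      (Complex.log (1 + u / (-α * u - β * v))).im ≤ Real.pi := by
    rw [log_im]
    refine ⟨lt_of_le_of_ne (arg_nonneg_iff.mpr (by simpa using i1.le)) fun h0 => ?_, arg_le_pi _⟩
    have := (arg_eq_zero_iff.mp h0.symm).2
    simp only [add_im, one_im, zero_add] at this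
    exact i1.ne' this
  have a2 : 0 ≤ (Complex.log (1 + v / ((1 - α) * u - β * v))).im ∧
      (Complex.log (1 + v / ((1 - α) * u - β * v))).im ≤ Real.pi := by
    rw [log_im]
    exact ⟨arg_nonneg_iff.mpr (by simpa using i2.le), arg_le_pi _⟩
  have a3 : -Real.pi < (Complex.log (1 + u / (-α * u + (1 - β) * v))).im ∧
      (Complex.log (1 + u / (-α * u + (1 - β) * v))).im < 0 := by
    rw [log_im]
    exact ⟨neg_pi_lt_arg _, arg_neg_iff.mpr (by simpa using i3)⟩
  have a4 : -Real.pi < (Complex.log (1 + v / (-α * u - β * v))).im ∧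
      (Complex.log (1 + v / (-α * u - β * v))).im < 0 := by
    rw [log_im]
    exact ⟨neg_pi_lt_arg _, arg_neg_iff.mpr (by simpa using i4)⟩
  set L := Complex.log (1 + u / (-α * u - β * v)) + Complex.log (1 + v / ((1 - α) * u - β * v)) -
    Complex.log (1 + u / (-α * u + (1 - β) * v)) - Complex.log (1 + v / (-α * u - β * v)) with hL
  have hexp : exp L = 1 := by
    rw [hL, exp_sub, exp_sub, exp_add, exp_log (one_add_ne_zero_of_im i1.ne'),
      exp_log (one_add_ne_zero_of_im i2.ne'), exp_log (one_add_ne_zero_of_im i3.ne),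
      exp_log (one_add_ne_zero_of_im i4.ne)]
    have m3 := one_add_ne_zero_of_im i3.ne
    have m4 := one_add_ne_zero_of_im i4.ne
    have key : ∀ w : ℂ, w ≠ 0 → w + u ≠ 0 → w + v ≠ 0 →
        (1 + u / w) * (1 + v / (w + u)) = (1 + u / (w + v)) * (1 + v / w) := fun w h1 h2 h3 => by
      field_simp
      ring
    have y2 : ((1 - α) * u - β * v : ℂ) = (-α * u - β * v) + u := by ring
    have y3 : (-α * u + (1 - β) * v : ℂ) = (-α * u - β * v) + v := by ring
    rw [div_div, div_eq_one_iff_eq (mul_ne_zero m3 m4), y2, y3]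
    exact key _ z1 (y2 ▸ z2) (y3 ▸ z3)
  obtain ⟨n, hn⟩ := exp_eq_one_iff.mp hexp
  have hnim : L.im = n * (2 * Real.pi) := by rw [hn]; simp
  have hpi := Real.pi_pos
  have hpos : 0 < L.im := by
    rw [hL]
    simp only [sub_im, add_im]
    linarith [a1.1, a2.1, a3.2, a4.2]
  have hlt : L.im < 2 * (2 * Real.pi) := by
    rw [hL]
    simp only [sub_im, add_im]
    linarith [a1.2, a2.2, a3.1, a4.1]
  rw [hnim] at hpos hlt
  have hn1 : n = 1 := by
    have h1 : (0 : ℝ) < n := by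
      by_contra! h0
      nlinarith
    have h2 : (n : ℝ) < 2 := lt_of_mul_lt_mul_right hlt (by positivity)
    have h1' : (0 : ℤ) < n := by exact_mod_cast h1
    have h2' : n < (2 : ℤ) := by exact_mod_cast h2
    omega
  rw [hn, hn1]
  simp

/-- Powers of order at least 2 have a single-valued primitive on the boundary. -/
theorem paraIntegral_inv_pow (n : ℕ) (hc : c ∉ paraBoundary p u v) :
    paraIntegral (fun x => ((x - c) ^ (n + 2))⁻¹) p u v = 0 := by
  have hne : ∀ x ∈ paraBoundary p u v, x - c ≠ 0 := fun x hx h0 => hc (sub_eq_zero.mp h0 ▸ hx)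
  refine paraIntegral_eq_zero_of_hasDerivAt
    (G := fun x => -((n + 1 : ℂ))⁻¹ * ((x - c) ^ (n + 1))⁻¹) (fun x hx => ?_) ?_
  · have h0 := hne x hx
    have h1 : HasDerivAt (fun x => (x - c) ^ (n + 1)) ((n + 1 : ℕ) * (x - c) ^ n) x := by
      simpa using ((hasDerivAt_id x).sub_const c).fun_pow (n + 1)
    have h2 := (h1.fun_inv (pow_ne_zero _ h0)).const_mul (-((n + 1 : ℂ))⁻¹)
    have h3 : (n + 1 : ℂ) ≠ 0 := Nat.cast_add_one_ne_zero n
    have h4 : -(n + 1 : ℂ)⁻¹ * (-((n + 1 : ℕ) * (x - c) ^ n) / ((x - c) ^ (n + 1)) ^ 2) =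
        ((x - c) ^ (n + 2))⁻¹ := by
      push_cast
      field_simp
      ring
    rwa [h4] at h2
  · have h1 : ContinuousOn (fun x => (x - c) ^ (n + 2)) (paraBoundary p u v) := by fun_prop
    exact h1.inv₀ fun x hx => pow_ne_zero _ (hne x hx)

theorem not_mem_paraBoundary {α β : ℝ} (hα : α ∈ Ioo (0 : ℝ) 1) (hβ : β ∈ Ioo (0 : ℝ) 1)
    (huv : 0 < (v / u).im) : p + α * u + β * v ∉ paraBoundary p u v := by
  have hu : u ≠ 0 := by
    rintro rfl
    simp at huv
  rintro ⟨s, hs, t, ht, hst, h⟩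
  have h1 : ((α - s : ℝ) : ℂ) + (β - t : ℝ) * (v / u) = 0 := by
    push_cast
    field_simp
    linear_combination h
  have h2 : β - t = 0 := by
    have := congrArg Complex.im h1
    simpa [huv.ne'] using this
  have h3 : α - s = 0 := by
    rw [h2] at h1
    simpa [← ofReal_sub] using h1
  have := hα.1
  have := hα.2
  have := hβ.1
  have := hβ.2
  rcases hst with h | h | h | h <;> linarith

/-- The residue theorem for a single pole of order `n + 1` inside a parallelogram. -/
theorem paraIntegral_div_pow {α β : ℝ} (hα : α ∈ Ioo (0 : ℝ) 1) (hβ : β ∈ Ioo (0 : ℝ) 1)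
    (huv : 0 < (v / u).im) (hc : c = p + α * u + β * v) (n : ℕ) {H : ℂ → ℂ}
    {P : FormalMultilinearSeries ℂ ℂ ℂ} (hP : HasFPowerSeriesAt H P c)
    {U : Set ℂ} (hU : IsOpen U) (hH : DifferentiableOn ℂ H U)
    (hsub : ∀ s ∈ Icc (0 : ℝ) 1, ∀ t ∈ Icc (0 : ℝ) 1, p + s * u + t * v ∈ U) :
    paraIntegral (fun x => H x / (x - c) ^ (n + 1)) p u v = 2 * Real.pi * I * P.coeff n := by
  have hcU : c ∈ U := by
    rw [hc]
    exact hsub α ⟨hα.1.le, hα.2.le⟩ β ⟨hβ.1.le, hβ.2.le⟩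
  have hcb : c ∉ paraBoundary p u v := by
    rw [hc]
    exact not_mem_paraBoundary hα hβ huv
  have hbU : paraBoundary p u v ⊆ U := by
    rintro x ⟨s, hs, t, ht, -, rfl⟩
    exact hsub s hs t ht
  have hne : ∀ x ∈ paraBoundary p u v, x - c ≠ 0 := fun x hx h0 => hcb (sub_eq_zero.mp h0 ▸ hx)
  -- Write H(x) = H(c) + (x-c)·`dslope H c x`. The constant term gives 2πi·H(c) for a simple pole
  -- and 0 for a higher one. In the remaining term the order drops by one, while passing to `dslope`
  -- shifts the Taylor coefficients by one.
  induction n generalizing H P with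
  | zero =>
    have hd : DifferentiableOn ℂ (dslope H c) U :=
      (Complex.differentiableOn_dslope (hU.mem_nhds hcU)).mpr hH
    have h1 : paraIntegral (fun x => H x / (x - c) ^ (0 + 1)) p u v =
        paraIntegral (fun x => H c * (x - c)⁻¹ + dslope H c x) p u v :=
      paraIntegral_congr fun x hx => by
        have h0 := hne x hx
        simp only [zero_add, pow_one]
        rw [dslope_of_ne _ (sub_ne_zero.mp h0), slope_def_field]
        field_simp
        ring
    have k1 : ContinuousOn (fun x => x - c) (paraBoundary p u v) := by fun_prop
    have k2 : ContinuousOn (fun x => H c * (x - c)⁻¹) (paraBoundary p u v) :=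
      continuousOn_const.mul (k1.inv₀ hne)
    rw [h1, paraIntegral_add k2 (hd.continuousOn.mono hbU), paraIntegral_const_mul]
    have h2 : paraIntegral (fun x => (x - c)⁻¹) p u v = 2 * Real.pi * I := by
      rw [hc]
      exact paraIntegral_inv hα hβ huv
    rw [h2, paraIntegral_eq_zero_of_differentiableAt fun s hs t ht =>
      hd.differentiableAt (hU.mem_nhds (hsub s hs t ht)), add_zero, mul_comm]
    congr 1
    rw [← hP.coeff_zero (fun _ => 1)]
    rfl
  | succ n ih =>
    have hd : DifferentiableOn ℂ (dslope H c) U :=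
      (Complex.differentiableOn_dslope (hU.mem_nhds hcU)).mpr hH
    have h1 : paraIntegral (fun x => H x / (x - c) ^ (n + 1 + 1)) p u v =
        paraIntegral (fun x => H c * ((x - c) ^ (n + 2))⁻¹ + dslope H c x / (x - c) ^ (n + 1))
          p u v :=
      paraIntegral_congr fun x hx => by
        have h0 := hne x hx
        rw [dslope_of_ne _ (sub_ne_zero.mp h0), slope_def_field]
        field_simp
        ring
    have k1 : ∀ k : ℕ, ContinuousOn (fun x => (x - c) ^ k) (paraBoundary p u v) := fun k => by
      fun_prop
    have k2 : ContinuousOn (fun x => H c * ((x - c) ^ (n + 2))⁻¹) (paraBoundary p u v) :=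
      continuousOn_const.mul ((k1 _).inv₀ fun x hx => pow_ne_zero _ (hne x hx))
    have k3 : ContinuousOn (fun x => dslope H c x / (x - c) ^ (n + 1)) (paraBoundary p u v) :=
      (hd.continuousOn.mono hbU).div (k1 _) fun x hx => pow_ne_zero _ (hne x hx)
    rw [h1, paraIntegral_add k2 k3, paraIntegral_const_mul, paraIntegral_inv_pow n hcb,
      ih hP.has_fpower_series_dslope_fslope hd, FormalMultilinearSeries.coeff_fslope]
    ring

end Contour

end StateIntegral

namespace StateIntegral

/-! ### Rotation of the contour of the state integral -/

section Rotation

open Complex Filter Topology MeasureTheory Set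

variable {b : ℂ}

/-- The point with real coordinates `σ`, `τ` in the frame `ib`, `ib⁻¹` with origin `r c_b`. -/
noncomputable def latticePoint (b : ℂ) (r σ τ : ℝ) : ℂ := r * cb b + σ * (I * b) + τ * (I * b⁻¹)

/-- In the frame ib, ib⁻¹ the exponent is 2πi times a real number plus a real multiple of b², so the
modulus of the argument depends on the coordinate σ alone. In `two_pi_b_inv_mul` it depends on τ
alone. -/
theorem two_pi_b_mul (hb0 : b ≠ 0) (r σ τ : ℝ) :
    2 * Real.pi * b * (latticePoint b r σ τ + cb b) =
      2 * Real.pi * I * ((((r + 1) / 2 + τ : ℝ) : ℂ) + (((r + 1) / 2 + σ : ℝ) : ℂ) * b ^ 2) := by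
  rw [latticePoint, cb]
  push_cast
  field_simp
  ring

theorem two_pi_b_inv_mul (hb0 : b ≠ 0) (r σ τ : ℝ) :
    2 * Real.pi * b⁻¹ * (latticePoint b r σ τ - cb b) =
      2 * Real.pi * I * ((((r - 1) / 2 + σ : ℝ) : ℂ) + (((r - 1) / 2 + τ : ℝ) : ℂ) * (b ^ 2)⁻¹) := by
  rw [latticePoint, cb]
  push_cast
  field_simp
  ring

theorem norm_exp_two_pi_I (x y : ℝ) (z : ℂ) :
    ‖exp (2 * Real.pi * I * ((x : ℂ) + (y : ℂ) * z))‖ = Real.exp (-(2 * Real.pi * z.im) * y) := by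
  rw [norm_exp]
  congr 1
  simp
  ring

/-- A zero means that 2πi(α + βb⁻²) + k·(-2πib⁻²) lies in 2πiℤ with α, β real. Since 1 and b⁻² are
linearly independent over ℝ, both coordinates are determined. -/
theorem exists_of_faddeevDen_eq_zero (hb : 0 < (b ^ 2).im) {r σ τ : ℝ}
    (h : faddeevDen b (latticePoint b r σ τ) = 0) :
    ∃ (n : ℤ) (k : ℕ), (r - 1) / 2 + σ = n ∧ (r - 1) / 2 + τ = k := by
  have hb0 := ne_zero_of_im_sq_pos hb
  obtain ⟨k, hk⟩ := exists_of_qPochInf_eq_zero (norm_qDual_lt_one hb) h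
  rw [two_pi_b_inv_mul hb0, qDual, ← exp_nat_mul, ← exp_add, exp_eq_one_iff] at hk
  obtain ⟨n, hn⟩ := hk
  have hpi : (2 * Real.pi * I : ℂ) ≠ 0 := two_pi_I_ne_zero
  have h1 : ((((r - 1) / 2 + σ - n : ℝ) : ℂ) + (((r - 1) / 2 + τ - k : ℝ) : ℂ) * (b ^ 2)⁻¹) = 0 := by
    apply mul_left_cancel₀ hpi
    push_cast at hn ⊢
    linear_combination hn
  have him : ((b ^ 2)⁻¹).im ≠ 0 := by
    have := im_neg_inv_sq_pos hb
    rw [neg_im] at this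
    linarith
  have h2 : (r - 1) / 2 + τ - k = 0 := by
    have := congrArg Complex.im h1
    rw [add_im, ofReal_im, im_ofReal_mul, zero_add, zero_im] at this
    exact (mul_eq_zero.mp this).resolve_right him
  have h3 : (r - 1) / 2 + σ - n = 0 := by
    rw [h2] at h1
    rw [ofReal_zero, zero_mul, add_zero] at h1
    exact_mod_cast h1
  exact ⟨n, k, by linarith, by linarith⟩

theorem differentiable_faddeevNum (hb : 0 < (b ^ 2).im) : Differentiable ℂ (faddeevNum b) :=
  (differentiable_qPochInf (norm_qParam_lt_one hb)).comp
    (show Differentiable ℂ fun x => exp (2 * Real.pi * b * (x + cb b)) by fun_prop)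

theorem differentiable_faddeevDen (hb : 0 < (b ^ 2).im) : Differentiable ℂ (faddeevDen b) :=
  (differentiable_qPochInf (norm_qDual_lt_one hb)).comp
    (show Differentiable ℂ fun x => exp (2 * Real.pi * b⁻¹ * (x - cb b)) by fun_prop)

theorem integrand_differentiableAt (A B : ℕ) (hb : 0 < (b ^ 2).im) {x : ℂ}
    (h : faddeevDen b x ≠ 0) : DifferentiableAt ℂ (integrand A B b) x := by
  have h1 : DifferentiableAt ℂ (faddeev b) x :=
    (differentiable_faddeevNum hb x).div (differentiable_faddeevDen hb x) h
  unfold integrand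
  fun_prop

theorem norm_gauss (a : ℝ) (x : ℂ) :
    ‖exp (-(a * Real.pi * I * x ^ 2))‖ = Real.exp (2 * Real.pi * a * (x.re * x.im)) := by
  rw [norm_exp]
  congr 1
  simp [sq]
  ring

/-- Expand the product: ε(s + c₁t) gives the linear decay, c₂st is nonnegative, and c₂(c₁t² - rt) is
bounded below by completing the square, which is where r²/(4c₁) comes from. -/
theorem exists_gauss_bound {a ε c₁ c₂ : ℝ} (ha : 0 < a) (hε : 0 < ε) (h₁ : 0 < c₁) (h₂ : 0 < c₂)
    (r : ℝ) : ∃ C κ : ℝ, 0 < C ∧ 0 < κ ∧ ∀ s t : ℝ, 0 ≤ s → 0 ≤ t →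
      Real.exp (-(a * ((s + t * c₁ - r) * (ε + t * c₂)))) ≤ C * Real.exp (-κ * (s + t)) := by
  refine ⟨Real.exp (a * r * ε + a * c₂ * r ^ 2 / (4 * c₁)), a * ε * min 1 c₁, Real.exp_pos _,
    by positivity, fun s t hs ht => ?_⟩
  rw [← Real.exp_add, Real.exp_le_exp]
  have m1 : min 1 c₁ * s ≤ s := by nlinarith [min_le_left 1 c₁]
  have m2 : min 1 c₁ * t ≤ c₁ * t := by nlinarith [min_le_right 1 c₁]
  have m3 : 0 ≤ a * ε := by positivity
  have m4 : 0 ≤ c₁ * t ^ 2 - r * t + r ^ 2 / (4 * c₁) := by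
    have : c₁ * t ^ 2 - r * t + r ^ 2 / (4 * c₁) = c₁ * (t - r / (2 * c₁)) ^ 2 := by
      field_simp
      ring
    rw [this]
    positivity
  have m5 : 0 ≤ a * c₂ * (s * t) := by positivity
  have m6 := mul_nonneg (mul_nonneg ha.le h₂.le) m4
  have m7 := mul_le_mul_of_nonneg_left (add_le_add m1 m2) m3
  have m8 : a * c₂ * (r ^ 2 / (4 * c₁)) = a * c₂ * r ^ 2 / (4 * c₁) := by ring
  nlinarith

theorem cb_im_pos (hb : 0 < (b ^ 2).im) (hre : 0 < b.re) : 0 < (cb b).im := by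
  have hn : 0 < normSq b := normSq_pos.mpr (ne_zero_of_im_sq_pos hb)
  have : (cb b).im = (b.re + b.re / normSq b) / 2 := by
    simp [cb, inv_re]
    ring
  rw [this]
  positivity

/-- On the left sector, the integrand is holomorphic and decays exponentially. -/
theorem integrand_left_bound {A B : ℕ} (hA : 0 < A) (hb : 0 < (b ^ 2).im)
    (hre : 0 < b.re) {r : ℝ} (hr : r ∈ Ioo (0 : ℝ) 1) :
    ∃ C κ : ℝ, 0 < κ ∧ ∀ s t : ℝ, 0 ≤ s → 0 ≤ t →
      DifferentiableAt ℂ (integrand A B b) (r * cb b + s * (-1) + t * (I * b)) ∧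
      ‖integrand A B b (r * cb b + s * (-1) + t * (I * b))‖ ≤ C * Real.exp (-κ * (s + t)) := by
  have hb0 := ne_zero_of_im_sq_pos hb
  have him := im_pos_of_im_sq_pos hb hre
  have hcb := cb_im_pos hb hre
  have hq := norm_qParam_lt_one hb
  have hqt := norm_qDual_lt_one hb
  have hinv : 0 < (b⁻¹).re := by
    rw [inv_re]
    exact div_pos hre (normSq_pos.mpr hb0)
  set ρ₁ := ‖exp (2 * Real.pi * b * (latticePoint b r 0 0 + cb b))‖ with hρ₁
  set ρ₂ := ‖exp (2 * Real.pi * b⁻¹ * (latticePoint b r 0 0 - cb b))‖ with hρ₂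
  have hρ₁' : ρ₁ < 1 := by
    rw [hρ₁, two_pi_b_mul hb0, norm_exp_two_pi_I, Real.exp_lt_one_iff]
    have := mul_pos (mul_pos Real.two_pi_pos hb) (show 0 < (r + 1) / 2 + 0 by linarith [hr.1])
    linarith
  have hρ₂' : ρ₂ < 1 := by
    rw [hρ₂, two_pi_b_inv_mul hb0, norm_exp_two_pi_I, Real.exp_lt_one_iff]
    have h1 := im_neg_inv_sq_pos hb
    rw [neg_im] at h1
    have := mul_pos (mul_pos Real.two_pi_pos h1) (show 0 < (1 - r) / 2 by linarith [hr.2])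
    nlinarith
  -- Moving by -1 or by ib does not increase the modulus of either argument: the first shrinks since
  -- Re b, Im b² > 0, and in the second ib⁻¹·b = i is a pure phase. Both products stay in the discs
  -- fixed at the corner p.
  have hZ : ∀ s t : ℝ, 0 ≤ s → 0 ≤ t →
      ‖exp (2 * Real.pi * b * ((r * cb b + s * (-1) + t * (I * b)) + cb b))‖ ≤ ρ₁ :=
    fun s t hs ht => by
      rw [hρ₁, norm_exp, norm_exp, Real.exp_le_exp]
      have : 2 * Real.pi * b * ((r * cb b + s * (-1) + t * (I * b)) + cb b) =
          2 * Real.pi * b * (latticePoint b r 0 0 + cb b) +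
            (((2 * Real.pi * s : ℝ) : ℂ) * (-b) + ((2 * Real.pi * t : ℝ) : ℂ) * (I * b ^ 2)) := by
        rw [latticePoint]
        push_cast
        ring
      rw [this, add_re, add_re, re_ofReal_mul, re_ofReal_mul, I_mul_re, neg_re]
      have h1 : 0 ≤ 2 * Real.pi * s * b.re := by positivity
      have h2 : 0 ≤ 2 * Real.pi * t * (b ^ 2).im := by positivity
      linarith
  have hY : ∀ s t : ℝ, 0 ≤ s → 0 ≤ t →
      ‖exp (2 * Real.pi * b⁻¹ * ((r * cb b + s * (-1) + t * (I * b)) - cb b))‖ ≤ ρ₂ :=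
    fun s t hs ht => by
      rw [hρ₂, norm_exp, norm_exp, Real.exp_le_exp]
      have : 2 * Real.pi * b⁻¹ * ((r * cb b + s * (-1) + t * (I * b)) - cb b) =
          2 * Real.pi * b⁻¹ * (latticePoint b r 0 0 - cb b) +
            (((2 * Real.pi * s : ℝ) : ℂ) * (-b⁻¹) + ((2 * Real.pi * t : ℝ) : ℂ) * I) := by
        rw [latticePoint]
        push_cast
        field_simp
        ring
      rw [this, add_re, add_re, re_ofReal_mul, re_ofReal_mul, I_re, neg_re]
      have h1 : 0 ≤ 2 * Real.pi * s * (b⁻¹).re := by positivity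
      linarith
  obtain ⟨c₁, C₁, hc₁, hC₁, H₁⟩ := exists_qPochInf_bounds hq hρ₁'
  obtain ⟨c₂, C₂, hc₂, hC₂, H₂⟩ := exists_qPochInf_bounds hqt hρ₂'
  have hAr : (0 : ℝ) < A := by exact_mod_cast hA
  obtain ⟨C, κ, hC, hκ, H⟩ := exists_gauss_bound (a := 2 * Real.pi * A) (by positivity)
    (ε := r * (cb b).im) (mul_pos hr.1 hcb) him hre (r * (cb b).re)
  refine ⟨(C₁ / c₂) ^ B * C, κ, hκ, fun s t hs ht => ⟨?_, ?_⟩⟩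
  · refine integrand_differentiableAt A B hb ?_
    exact norm_pos_iff.mp (hc₂.trans_le (H₂ _ (hY s t hs ht)).1)
  · rw [integrand, norm_mul, norm_pow, faddeev_eq_div, norm_div]
    have hg := norm_gauss A (r * cb b + s * (-1) + t * (I * b))
    rw [ofReal_natCast] at hg
    have hx : (r * cb b + s * (-1) + t * (I * b)).re = -(s + t * b.im - r * (cb b).re) := by
      simp
      ring
    have hy : (r * cb b + s * (-1) + t * (I * b)).im = r * (cb b).im + t * b.re := by simp
    rw [hg, hx, hy, mul_assoc (_ ^ B) C]
    refine mul_le_mul ?_ (le_trans (le_of_eq (by ring_nf)) (H s t hs ht)) (Real.exp_pos _).le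
      (by positivity)
    gcongr
    · exact (H₁ _ (hZ s t hs ht)).2
    · exact (H₂ _ (hY s t hs ht)).1

/-- The integrand on the right sector, written by means of the inversion relation. -/
noncomputable def integrandRight (A B : ℕ) (b K x : ℂ) : ℂ :=
  (K * faddeevDen b (-x) / faddeevNum b (-x)) ^ B *
    exp (-(((A : ℝ) - B : ℝ) * Real.pi * I * x ^ 2))

theorem integrand_eq_integrandRight {A B : ℕ} {K x : ℂ} (hx : faddeevNum b x * faddeevNum b (-x) =
      K * exp (Real.pi * I * x ^ 2) * (faddeevDen b x * faddeevDen b (-x)))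
    (h1 : faddeevDen b x ≠ 0) (h2 : faddeevNum b (-x) ≠ 0) :
    integrand A B b x = integrandRight A B b K x := by
  have h3 : faddeev b x = K * faddeevDen b (-x) / faddeevNum b (-x) * exp (Real.pi * I * x ^ 2) := by
    rw [faddeev_eq_div]
    generalize exp (Real.pi * I * x ^ 2) = E at hx ⊢
    field_simp
    linear_combination hx
  rw [integrand, integrandRight, h3, mul_pow, ← exp_nat_mul, mul_assoc, ← exp_add]
  congr 2
  push_cast
  ring

/-- On the right sector, the continued integrand is holomorphic and decays exponentially. -/
theorem integrandRight_bound {A B : ℕ} (hAB : A < B) (hb : 0 < (b ^ 2).im)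
    (hre : 0 < b.re) {r : ℝ} (hr : r ∈ Ioo (0 : ℝ) 1) (K : ℂ) :
    ∃ C κ : ℝ, 0 < κ ∧ ∀ s t : ℝ, 0 ≤ s → 0 ≤ t →
      faddeevNum b (-(r * cb b + s * 1 + t * (I * b⁻¹))) ≠ 0 ∧
      DifferentiableAt ℂ (integrandRight A B b K) (r * cb b + s * 1 + t * (I * b⁻¹)) ∧
      ‖integrandRight A B b K (r * cb b + s * 1 + t * (I * b⁻¹))‖ ≤
        C * Real.exp (-κ * (s + t)) := by
  have hb0 := ne_zero_of_im_sq_pos hb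
  have him := im_pos_of_im_sq_pos hb hre
  have hcb := cb_im_pos hb hre
  have hq := norm_qParam_lt_one hb
  have hqt := norm_qDual_lt_one hb
  have hn : 0 < normSq b := normSq_pos.mpr hb0
  have hinv : 0 < (b⁻¹).re := by
    rw [inv_re]
    exact div_pos hre hn
  have hinv' : 0 < -(b⁻¹).im := by
    rw [inv_im, neg_div, neg_neg]
    exact div_pos him hn
  have hinv2 := im_neg_inv_sq_pos hb
  rw [neg_im] at hinv2
  set ρ₁ := ‖exp (2 * Real.pi * b * (latticePoint b (-r) 0 0 + cb b))‖ with hρ₁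
  set ρ₂ := ‖exp (2 * Real.pi * b⁻¹ * (latticePoint b (-r) 0 0 - cb b))‖ with hρ₂
  have hρ₁' : ρ₁ < 1 := by
    rw [hρ₁, two_pi_b_mul hb0, norm_exp_two_pi_I, Real.exp_lt_one_iff]
    have := mul_pos (mul_pos Real.two_pi_pos hb) (show 0 < (-r + 1) / 2 + 0 by linarith [hr.2])
    linarith
  have hρ₂' : ρ₂ < 1 := by
    rw [hρ₂, two_pi_b_inv_mul hb0, norm_exp_two_pi_I, Real.exp_lt_one_iff]
    have := mul_pos (mul_pos Real.two_pi_pos hinv2) (show 0 < (1 + r) / 2 by linarith [hr.1])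
    nlinarith
  -- The same monotonicity for -x, now in the directions 1 and ib⁻¹. At x itself the denominator has
  -- zeros on this side; the inversion relation is what removes them from view.
  have hZ : ∀ s t : ℝ, 0 ≤ s → 0 ≤ t →
      ‖exp (2 * Real.pi * b * (-(r * cb b + s * 1 + t * (I * b⁻¹)) + cb b))‖ ≤ ρ₁ :=
    fun s t hs ht => by
      rw [hρ₁, norm_exp, norm_exp, Real.exp_le_exp]
      have : 2 * Real.pi * b * (-(r * cb b + s * 1 + t * (I * b⁻¹)) + cb b) =
          2 * Real.pi * b * (latticePoint b (-r) 0 0 + cb b) +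
            (((2 * Real.pi * s : ℝ) : ℂ) * (-b) + ((2 * Real.pi * t : ℝ) : ℂ) * (-I)) := by
        rw [latticePoint]
        push_cast
        field_simp
        ring
      rw [this, add_re, add_re, re_ofReal_mul, re_ofReal_mul, neg_re, neg_re, I_re]
      have h1 : 0 ≤ 2 * Real.pi * s * b.re := by positivity
      linarith
  have hY : ∀ s t : ℝ, 0 ≤ s → 0 ≤ t →
      ‖exp (2 * Real.pi * b⁻¹ * (-(r * cb b + s * 1 + t * (I * b⁻¹)) - cb b))‖ ≤ ρ₂ :=
    fun s t hs ht => by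
      rw [hρ₂, norm_exp, norm_exp, Real.exp_le_exp]
      have : 2 * Real.pi * b⁻¹ * (-(r * cb b + s * 1 + t * (I * b⁻¹)) - cb b) =
          2 * Real.pi * b⁻¹ * (latticePoint b (-r) 0 0 - cb b) +
            (((2 * Real.pi * s : ℝ) : ℂ) * (-b⁻¹) +
              ((2 * Real.pi * t : ℝ) : ℂ) * (-(I * (b ^ 2)⁻¹))) := by
        rw [latticePoint]
        push_cast
        field_simp
        ring
      rw [this, add_re, add_re, re_ofReal_mul, re_ofReal_mul, neg_re, neg_re, I_mul_re, neg_neg]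
      have h1 : 0 ≤ 2 * Real.pi * s * (b⁻¹).re := by positivity
      have h2 : 0 ≤ 2 * Real.pi * t * (-((b ^ 2)⁻¹).im) := by positivity
      linarith
  obtain ⟨c₁, C₁, hc₁, hC₁, H₁⟩ := exists_qPochInf_bounds hq hρ₁'
  obtain ⟨c₂, C₂, hc₂, hC₂, H₂⟩ := exists_qPochInf_bounds hqt hρ₂'
  have hAr : (0 : ℝ) < B - A := sub_pos.mpr (by exact_mod_cast hAB)
  obtain ⟨C, κ, hC, hκ, H⟩ := exists_gauss_bound (a := 2 * Real.pi * (B - A)) (by positivity)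
    (ε := r * (cb b).im) (mul_pos hr.1 hcb) hinv' hinv (-(r * (cb b).re))
  refine ⟨(‖K‖ * C₂ / c₁) ^ B * C, κ, hκ, fun s t hs ht => ?_⟩
  have hne : faddeevNum b (-(r * cb b + s * 1 + t * (I * b⁻¹))) ≠ 0 :=
    norm_pos_iff.mp (hc₁.trans_le (H₁ _ (hZ s t hs ht)).1)
  refine ⟨hne, ?_, ?_⟩
  · have d1 : Differentiable ℂ fun x => faddeevNum b (-x) :=
      (differentiable_faddeevNum hb).comp differentiable_neg
    have d2 : Differentiable ℂ fun x => faddeevDen b (-x) :=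
      (differentiable_faddeevDen hb).comp differentiable_neg
    unfold integrandRight
    refine DifferentiableAt.mul (DifferentiableAt.pow (DifferentiableAt.div
      ((d2 _).const_mul K) (d1 _) hne) B) (by fun_prop)
  · rw [integrandRight, norm_mul, norm_pow, norm_div, norm_mul]
    have hg := norm_gauss (A - B) (r * cb b + s * 1 + t * (I * b⁻¹))
    have hx : (r * cb b + s * 1 + t * (I * b⁻¹)).re = s + t * (-(b⁻¹).im) - (-(r * (cb b).re)) := by
      rw [add_re, add_re, re_ofReal_mul, re_ofReal_mul, re_ofReal_mul, I_mul_re, one_re]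
      ring
    have hy : (r * cb b + s * 1 + t * (I * b⁻¹)).im = r * (cb b).im + t * (b⁻¹).re := by
      rw [add_im, add_im, im_ofReal_mul, im_ofReal_mul, im_ofReal_mul, I_mul_im, one_im]
      ring
    rw [hg, hx, hy, mul_assoc (_ ^ B) C]
    refine mul_le_mul ?_ (le_trans (le_of_eq (by ring_nf)) (H s t hs ht)) (Real.exp_pos _).le
      (by positivity)
    gcongr
    · exact (H₂ _ (hY s t hs ht)).2
    · exact (H₁ _ (hZ s t hs ht)).1

/-- The horizontal direction in the frame ib, ib⁻¹, obtained from |b|²b⁻¹ = b - 2i·Im b. It locates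
the points of the horizontal ray where the denominator can vanish. -/
theorem one_eq_lattice (hb : 0 < (b ^ 2).im) (hre : 0 < b.re) :
    (1 : ℂ) = ((-(1 / (2 * b.im)) : ℝ) : ℂ) * (I * b) +
      ((normSq b / (2 * b.im) : ℝ) : ℂ) * (I * b⁻¹) := by
  have hb0 := ne_zero_of_im_sq_pos hb
  have him := (im_pos_of_im_sq_pos hb hre).ne'
  have h1 : ((normSq b : ℝ) : ℂ) * b⁻¹ = (starRingEnd ℂ) b := by
    rw [normSq_eq_conj_mul_self]
    field_simp
  have h2 : (starRingEnd ℂ) b = b - 2 * b.im * I := by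
    apply Complex.ext <;> simp
    ring
  have h3 : (b.im : ℂ) ≠ 0 := by exact_mod_cast him
  have h4 : ((normSq b / (2 * b.im) : ℝ) : ℂ) * (I * b⁻¹) =
      I * (((normSq b : ℝ) : ℂ) * b⁻¹) / (2 * b.im) := by
    push_cast
    ring
  rw [h4, h1, h2]
  push_cast
  field_simp
  linear_combination 2 * (b.im : ℂ) * I_sq

/-- Rotation of the contour onto the two rays in the directions `ib` and `ib⁻¹`. -/
theorem stateIntegral_eq_rays {A B : ℕ} (hA : 0 < A) (hAB : A < B) (hb : 0 < (b ^ 2).im)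
    (hre : 0 < b.re) {r : ℝ} (hr : r ∈ Ioo (0 : ℝ) 1) :
    Integrable (fun t : ℝ => integrand A B b (t + (r * (cb b).im : ℝ) * I)) ∧
    IntegrableOn (fun t : ℝ => integrand A B b (r * cb b + t * (I * b))) (Ioi 0) ∧
    IntegrableOn (fun t : ℝ => integrand A B b (r * cb b + t * (I * b⁻¹))) (Ioi 0) ∧
    stateIntegral A B b (r * (cb b).im) =
      I * b⁻¹ * (∫ t in Ioi (0 : ℝ), integrand A B b (r * cb b + t * (I * b⁻¹))) -
        I * b * ∫ t in Ioi (0 : ℝ), integrand A B b (r * cb b + t * (I * b)) := by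
  obtain ⟨K, -, hinv⟩ := exists_inversion hb
  obtain ⟨C₁, κ₁, hκ₁, HL⟩ := integrand_left_bound (B := B) hA hb hre hr
  obtain ⟨C₂, κ₂, hκ₂, HR⟩ := integrandRight_bound hAB hb hre hr K
  have rotL := integral_ray_rotate hκ₁ (fun s t hs ht => (HL s t hs ht).1)
    fun s t hs ht => (HL s t hs ht).2
  have rotR := integral_ray_rotate hκ₂ (fun s t hs ht => (HR s t hs ht).2.1)
    fun s t hs ht => (HR s t hs ht).2.2
  have iL1 := integrableOn_ray (g := integrand A B b) (p := r * cb b) (u := -1) hκ₁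
    (fun s hs => by simpa using (HL s 0 hs le_rfl).1)
    fun s hs => by simpa using (HL s 0 hs le_rfl).2
  have iL2 := integrableOn_ray (g := integrand A B b) (p := r * cb b) (u := I * b) hκ₁
    (fun s hs => by simpa using (HL 0 s le_rfl hs).1)
    fun s hs => by simpa using (HL 0 s le_rfl hs).2
  have iR1 := integrableOn_ray (g := integrandRight A B b K) (p := r * cb b) (u := 1) hκ₂
    (fun s hs => by simpa using (HR s 0 hs le_rfl).2.1)
    fun s hs => by simpa using (HR s 0 hs le_rfl).2.2
  have iR2 := integrableOn_ray (g := integrandRight A B b K) (p := r * cb b) (u := I * b⁻¹) hκ₂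
    (fun s hs => by simpa using (HR 0 s le_rfl hs).2.1)
    fun s hs => by simpa using (HR 0 s le_rfl hs).2.2
  -- On the ray in direction ib⁻¹ a zero of the denominator would force (r-1)/2 to be an integer,
  -- but it lies strictly between -1 and 0.
  have eR2 : EqOn (fun t : ℝ => integrandRight A B b K (r * cb b + t * (I * b⁻¹)))
      (fun t : ℝ => integrand A B b (r * cb b + t * (I * b⁻¹))) (Ioi 0) := fun t ht => by
    refine (integrand_eq_integrandRight (hinv _) (fun h0 => ?_) ?_).symm
    · have hp : (r * cb b + t * (I * b⁻¹) : ℂ) = latticePoint b r 0 t := by simp [latticePoint]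
      rw [hp] at h0
      obtain ⟨n, k, hn, -⟩ := exists_of_faddeevDen_eq_zero hb h0
      have h1 : (-1 : ℝ) < n := by linarith [hr.1]
      have h2 : (n : ℝ) < 0 := by linarith [hr.2]
      have h1' : (-1 : ℤ) < n := by exact_mod_cast h1
      have h2' : n < (0 : ℤ) := by exact_mod_cast h2
      omega
    · simpa using (HR 0 t le_rfl (le_of_lt ht)).1
  -- On the horizontal ray the denominator may vanish; the singularity is then removable, but the
  -- quotient in the definition takes the default value 0. Such points are among countably many
  -- parameters t, so the two integrands agree almost everywhere.
  have eR1 : (fun t : ℝ => integrandRight A B b K (r * cb b + t * 1)) =ᵐ[volume.restrict (Ioi 0)]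
      (fun t : ℝ => integrand A B b (r * cb b + t * 1)) := by
    have hnull : ∀ᵐ t : ℝ, t ∉ Set.range fun n : ℤ => 2 * b.im * ((r - 1) / 2 - n) :=
      measure_eq_zero_iff_ae_notMem.mp ((countable_range _).measure_zero _)
    filter_upwards [ae_restrict_of_ae hnull, ae_restrict_mem measurableSet_Ioi] with t ht ht0
    refine (integrand_eq_integrandRight (hinv _) (fun h0 => ht ?_) ?_).symm
    · have hp : (r * cb b + t * 1 : ℂ) =
          latticePoint b r (-(t / (2 * b.im))) (t * (normSq b / (2 * b.im))) := by
        nth_rewrite 1 [one_eq_lattice hb hre]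
        rw [latticePoint]
        push_cast
        ring
      rw [hp] at h0
      obtain ⟨n, k, hn, -⟩ := exists_of_faddeevDen_eq_zero hb h0
      refine ⟨n, ?_⟩
      have := (im_pos_of_im_sq_pos hb hre).ne'
      simp only
      rw [← hn]
      field_simp
      ring
    · simpa using (HR t 0 (le_of_lt ht0) le_rfl).1
  have iR1' := (integrable_congr eR1).mp iR1
  have iR2' := iR2.congr_fun eR2 measurableSet_Ioi
  rw [setIntegral_congr_fun measurableSet_Ioi eR2, integral_congr_ae eR1] at rotR
  set G : ℝ → ℂ := fun t => integrand A B b (r * cb b + t * 1) with hG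
  have iLneg : IntegrableOn G (Iic 0) := by
    have h1 : IntegrableOn (fun t : ℝ => G (-t)) (Ici (-0)) := by
      rw [neg_zero, integrableOn_Ici_iff_integrableOn_Ioi]
      refine iL1.congr_fun (fun t _ => ?_) measurableSet_Ioi
      simp [hG]
    simpa using h1.comp_neg_Iic
  have hGint : Integrable G := by
    rw [← integrableOn_univ, ← Iic_union_Ioi (a := (0 : ℝ))]
    exact iLneg.union iR1'
  -- The point r c_b has height ε but a real part of its own; a translation of the line absorbs it.
  have hshift : ∀ t : ℝ, integrand A B b (t + (r * (cb b).im : ℝ) * I) =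
      G (t + -(r * (cb b).re)) := fun t => by
    simp only [hG]
    congr 1
    apply Complex.ext <;> simp
  have hsplit : ∫ t, G t = (∫ t in Ioi (0 : ℝ), integrand A B b (r * cb b + t * (-1))) +
      ∫ t in Ioi (0 : ℝ), G t := by
    rw [← intervalIntegral.integral_Iic_add_Ioi iLneg iR1']
    congr 1
    have := integral_comp_neg_Ioi 0 G
    rw [neg_zero] at this
    rw [← this]
    simp [hG]
  refine ⟨?_, iL2, iR2', ?_⟩
  · simp only [hshift]
    exact hGint.comp_add_right _
  · rw [stateIntegral]
    simp only [hshift]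
    rw [integral_add_right_eq_self G, hsplit]
    linear_combination rotR - rotL

end Rotation

end StateIntegral

namespace StateIntegral

/-! ### Translation of the integrand by the period lattice -/

section Translation

open Complex Filter Topology MeasureTheory Set

variable {b : ℂ}

/-- Adding ib multiplies the argument by q, and adding ib⁻¹ multiplies it by e^{2πi} = 1. For the
denominator the roles are exchanged, with factor q̃⁻¹. -/
theorem faddeevNum_shift (hb : 0 < (b ^ 2).im) (x : ℂ) (m n : ℕ) :
    faddeevNum b x = (∏ k ∈ Finset.range m, (1 - exp (2 * Real.pi * b * (x + cb b)) * qParam b ^ k)) *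
      faddeevNum b (x + m * (I * b) + n * (I * b⁻¹)) := by
  have hb0 := ne_zero_of_im_sq_pos hb
  have h : exp (2 * Real.pi * b * (x + m * (I * b) + n * (I * b⁻¹) + cb b)) =
      exp (2 * Real.pi * b * (x + cb b)) * qParam b ^ m := by
    rw [qParam, ← exp_nat_mul, ← exp_add, exp_eq_exp_iff_exists_int]
    refine ⟨n, ?_⟩
    push_cast
    field_simp
    ring
  rw [faddeevNum, faddeevNum, h]
  exact qPochInf_eq_prod_mul _ (norm_qParam_lt_one hb) m

theorem faddeevDen_shift (hb : 0 < (b ^ 2).im) (x : ℂ) (m n : ℕ) :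
    faddeevDen b (x + m * (I * b) + n * (I * b⁻¹)) =
      (∏ k ∈ Finset.range n,
        (1 - exp (2 * Real.pi * b⁻¹ * (x - cb b)) * (qDual b ^ (k + 1))⁻¹)) * faddeevDen b x := by
  have hb0 := ne_zero_of_im_sq_pos hb
  have hq0 := qDual_ne_zero b
  have h : exp (2 * Real.pi * b⁻¹ * (x + m * (I * b) + n * (I * b⁻¹) - cb b)) =
      exp (2 * Real.pi * b⁻¹ * (x - cb b)) * (qDual b ^ n)⁻¹ := by
    rw [qDual, ← exp_nat_mul, ← exp_neg, ← exp_add, exp_eq_exp_iff_exists_int]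
    refine ⟨m, ?_⟩
    push_cast
    field_simp
    ring
  rw [faddeevDen, faddeevDen, h, qPochInf_eq_prod_mul _ (norm_qDual_lt_one hb) n]
  congr 1
  · rw [← Finset.prod_range_reflect]
    refine Finset.prod_congr rfl fun k hk => ?_
    have hk' := Finset.mem_range.mp hk
    have : qDual b ^ n = qDual b ^ (n - 1 - k) * qDual b ^ (k + 1) := by
      rw [← pow_add]
      congr 1
      omega
    rw [this]
    field_simp
  · congr 1
    field_simp

theorem integrand_shift (A B : ℕ) (hb : 0 < (b ^ 2).im) (x : ℂ) (m n : ℕ)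
    (hZ : ∏ k ∈ Finset.range m, (1 - exp (2 * Real.pi * b * (x + cb b)) * qParam b ^ k) ≠ 0) :
    integrand A B b (x + m * (I * b) + n * (I * b⁻¹)) = integrand A B b x *
      exp (-(A * Real.pi * I * ((x + m * (I * b) + n * (I * b⁻¹)) ^ 2 - x ^ 2))) /
      ((∏ k ∈ Finset.range m, (1 - exp (2 * Real.pi * b * (x + cb b)) * qParam b ^ k)) *
        ∏ k ∈ Finset.range n,
          (1 - exp (2 * Real.pi * b⁻¹ * (x - cb b)) * (qDual b ^ (k + 1))⁻¹)) ^ B := by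
  have h1 := faddeevNum_shift hb x m n
  have h2 : exp (-(A * Real.pi * I * (x + m * (I * b) + n * (I * b⁻¹)) ^ 2)) =
      exp (-(A * Real.pi * I * x ^ 2)) *
        exp (-(A * Real.pi * I * ((x + m * (I * b) + n * (I * b⁻¹)) ^ 2 - x ^ 2))) := by
    rw [← exp_add]
    ring_nf
  rw [integrand, integrand, faddeev_eq_div, faddeev_eq_div, faddeevDen_shift hb, h2]
  -- Only the product over m is cancelled, so only it must be nonzero. The product over n is carried
  -- by `mul_inv`, which also holds when it vanishes.
  have h3 : faddeevNum b (x + m * (I * b) + n * (I * b⁻¹)) = faddeevNum b x /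
      ∏ k ∈ Finset.range m, (1 - exp (2 * Real.pi * b * (x + cb b)) * qParam b ^ k) := by
    rw [h1, mul_div_cancel_left₀ _ hZ]
  rw [h3, div_div, ← mul_assoc, mul_div_assoc, mul_pow, ← div_div, ← div_div]
  simp only [mul_pow, div_eq_mul_inv, mul_inv]
  ring

/-- The factors are large since |q̃⁻¹| > 1. Extracting the dominant term leaves a product in
positive powers of q that is bounded below. -/
theorem prod_one_sub_mul_inv {y q : ℂ} (hy : y ≠ 0) (hq : q ≠ 0) (n : ℕ) :
    ∏ k ∈ Finset.range n, (1 - y * (q ^ (k + 1))⁻¹) =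
      (∏ k ∈ Finset.range n, (-(y * (q ^ (k + 1))⁻¹))) *
        ∏ k ∈ Finset.range n, (1 - (y⁻¹ * q) * q ^ k) := by
  rw [← Finset.prod_mul_distrib]
  refine Finset.prod_congr rfl fun k _ => ?_
  field_simp
  ring

theorem prod_neg_mul_inv_exp (y z : ℂ) (n : ℕ) :
    ∏ k ∈ Finset.range n, (-(exp y * (exp (-z) ^ (k + 1))⁻¹)) =
      (-1) ^ n * exp (n * y + z * (n * (n + 1) / 2)) := by
  induction n with
  | zero => simp
  | succ n ih =>
    rw [Finset.prod_range_succ, ih, ← exp_nat_mul, ← exp_neg, ← exp_add, pow_succ]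
    have : exp ((n + 1 : ℕ) * y + z * ((n + 1 : ℕ) * ((n + 1 : ℕ) + 1) / 2)) =
        exp (n * y + z * (n * (n + 1) / 2)) * exp (y + -((n + 1 : ℕ) * -z)) := by
      rw [← exp_add]
      congr 1
      push_cast
      ring
    rw [this]
    ring

/-- Geometric decay of the translates of the integrand. -/
theorem exists_integrand_shift_bound {A B : ℕ} (hA : 0 < A) (hAB : A < B) (hb : 0 < (b ^ 2).im)
    {r : ℝ} (hr : 0 < r) : ∃ C κ : ℝ, 0 < κ ∧ 0 < C ∧ ∀ σ τ : ℝ, 0 ≤ σ → 0 ≤ τ → ∀ m n : ℕ,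
      ‖integrand A B b (latticePoint b r σ τ + m * (I * b) + n * (I * b⁻¹))‖ ≤
        ‖integrand A B b (latticePoint b r σ τ)‖ * (C * Real.exp (-κ * (m + n))) := by
  have hb0 := ne_zero_of_im_sq_pos hb
  have hq := norm_qParam_lt_one hb
  have hqt := norm_qDual_lt_one hb
  set ℓ : ℝ := 2 * Real.pi * (b ^ 2).im with hℓ
  set ℓ' : ℝ := 2 * Real.pi * (-(b ^ 2)⁻¹).im with hℓ'
  have hℓ0 : 0 < ℓ := mul_pos Real.two_pi_pos hb
  have hℓ'0 : 0 < ℓ' := mul_pos Real.two_pi_pos (im_neg_inv_sq_pos hb)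
  obtain ⟨c₁, hc₁, H₁⟩ := exists_prod_lower_bound hq (ρ := Real.exp (-(ℓ / 2))) (by
    rw [Real.exp_lt_one_iff]; linarith)
  obtain ⟨c₂, hc₂, H₂⟩ := exists_prod_lower_bound hqt (ρ := Real.exp (-(ℓ' / 2))) (by
    rw [Real.exp_lt_one_iff]; linarith)
  have hA' : (0 : ℝ) < A := by exact_mod_cast hA
  have hBA' : (0 : ℝ) < B - A := sub_pos.mpr (by exact_mod_cast hAB)
  -- In m the Gaussian decays like e^{-Aℓm(σ+r/2+m/2)}. In n it grows with A, but the monomials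
  -- extracted from the denominator enter to the power B, leaving e^{-(B-A)ℓ'n(τ+r/2+n/2)}. Keeping
  -- only the terms with r/2 gives κ.
  refine ⟨((c₁ * c₂) ^ B)⁻¹, min (A * ℓ * r / 2) ((B - A) * ℓ' * r / 2), by positivity,
    by positivity, fun σ τ hσ hτ m n => ?_⟩
  set x := latticePoint b r σ τ with hx
  have hZn : ‖exp (2 * Real.pi * b * (x + cb b))‖ = Real.exp (-ℓ * ((r + 1) / 2 + σ)) := by
    rw [hx, two_pi_b_mul hb0, norm_exp_two_pi_I]
  have hYn : ‖exp (2 * Real.pi * b⁻¹ * (x - cb b))‖ = Real.exp (ℓ' * ((r - 1) / 2 + τ)) := by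
    rw [hx, two_pi_b_inv_mul hb0, norm_exp_two_pi_I, hℓ', neg_im]
    ring_nf
  have hqn : ‖qDual b‖ = Real.exp (-ℓ') := by
    have := norm_exp_two_pi_I 0 1 (-(b ^ 2)⁻¹)
    rw [qDual_eq]
    simpa [hℓ'] using this
  have hZl := H₁ _ (show ‖exp (2 * Real.pi * b * (x + cb b))‖ ≤ Real.exp (-(ℓ / 2)) by
    rw [hZn, Real.exp_le_exp]
    nlinarith) m
  have hY0 : exp (2 * Real.pi * b⁻¹ * (x - cb b)) ≠ 0 := exp_ne_zero _
  have hYl := H₂ _ (show ‖(exp (2 * Real.pi * b⁻¹ * (x - cb b)))⁻¹ * qDual b‖ ≤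
      Real.exp (-(ℓ' / 2)) by
    rw [norm_mul, norm_inv, hYn, hqn, ← Real.exp_neg, ← Real.exp_add, Real.exp_le_exp]
    nlinarith) n
  rw [integrand_shift A B hb x m n (norm_pos_iff.mp (hc₁.trans_le hZl)),
    prod_one_sub_mul_inv hY0 (qDual_ne_zero b)]
  have hP : ∏ k ∈ Finset.range n,
      (-(exp (2 * Real.pi * b⁻¹ * (x - cb b)) * (qDual b ^ (k + 1))⁻¹)) =
      (-1) ^ n * exp (n * (2 * Real.pi * b⁻¹ * (x - cb b)) +
        2 * Real.pi * I * (b ^ 2)⁻¹ * (n * (n + 1) / 2)) := by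
    rw [← prod_neg_mul_inv_exp]
    rfl
  rw [hP, norm_div, norm_mul, mul_div_assoc]
  refine mul_le_mul_of_nonneg_left ?_ (norm_nonneg _)
  rw [norm_pow, norm_mul, norm_mul, norm_mul, norm_pow, norm_neg, norm_one, one_pow, one_mul]
  set P₁ := ‖∏ k ∈ Finset.range m, (1 - exp (2 * Real.pi * b * (x + cb b)) * qParam b ^ k)‖
  set P₂ := ‖∏ k ∈ Finset.range n,
    (1 - (exp (2 * Real.pi * b⁻¹ * (x - cb b)))⁻¹ * qDual b * qDual b ^ k)‖
  have hE₁ : ‖exp (-(A * Real.pi * I * ((x + m * (I * b) + n * (I * b⁻¹)) ^ 2 - x ^ 2)))‖ =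
      Real.exp (A * (-ℓ * (m * (σ + r / 2 + m / 2)) + ℓ' * (n * (τ + r / 2 + n / 2)))) := by
    have e : -(A * Real.pi * I * ((x + m * (I * b) + n * (I * b⁻¹)) ^ 2 - x ^ 2)) =
        ((A * (2 * Real.pi) * (m * (σ + r / 2 + m / 2)) : ℝ) : ℂ) * (I * b ^ 2) +
        ((A * (2 * Real.pi) * (n * (τ + r / 2 + n / 2)) : ℝ) : ℂ) * (I * (b ^ 2)⁻¹) +
        ((A * (2 * Real.pi) * (n * (σ + r / 2) + m * (τ + r / 2) + m * n) : ℝ) : ℂ) * I := by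
      rw [hx, latticePoint, cb]
      push_cast
      field_simp
      ring_nf
      simp only [I_sq]
      ring
    rw [norm_exp, e, add_re, add_re, re_ofReal_mul, re_ofReal_mul, re_ofReal_mul, I_mul_re,
      I_mul_re, I_re, hℓ, hℓ', neg_im]
    congr 1
    ring
  have hE₂ : ‖exp (n * (2 * Real.pi * b⁻¹ * (x - cb b)) +
      2 * Real.pi * I * (b ^ 2)⁻¹ * (n * (n + 1) / 2))‖ =
      Real.exp (ℓ' * (n * (τ + r / 2 + n / 2))) := by
    have e : n * (2 * Real.pi * b⁻¹ * (x - cb b)) +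
        2 * Real.pi * I * (b ^ 2)⁻¹ * (n * (n + 1) / 2) =
        ((2 * Real.pi * (n * (τ + r / 2 + n / 2)) : ℝ) : ℂ) * (I * (b ^ 2)⁻¹) +
        ((2 * Real.pi * (n * ((r - 1) / 2 + σ)) : ℝ) : ℂ) * I := by
      rw [hx, two_pi_b_inv_mul hb0]
      push_cast
      ring
    rw [norm_exp, e, add_re, re_ofReal_mul, re_ofReal_mul, I_mul_re, I_re, hℓ', neg_im]
    congr 1
    ring
  rw [hE₁, hE₂, mul_pow, mul_pow, ← Real.exp_nat_mul]
  have hden : (c₁ * c₂) ^ B * Real.exp (B * (ℓ' * (n * (τ + r / 2 + n / 2)))) ≤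
      P₁ ^ B * (Real.exp (B * (ℓ' * (n * (τ + r / 2 + n / 2)))) * P₂ ^ B) := by
    rw [mul_pow]
    have h1 : c₁ ^ B ≤ P₁ ^ B := by gcongr
    have h2 : c₂ ^ B ≤ P₂ ^ B := by gcongr
    have h3 := mul_le_mul h1 h2 (by positivity) (by positivity)
    nlinarith [mul_le_mul_of_nonneg_right h3
      (Real.exp_pos (B * (ℓ' * (n * (τ + r / 2 + n / 2))))).le]
  refine (div_le_div_of_nonneg_left (Real.exp_pos _).le (by positivity) hden).trans ?_
  rw [mul_comm ((c₁ * c₂) ^ B), ← div_div, ← Real.exp_sub, div_eq_mul_inv, mul_comm]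
  refine mul_le_mul_of_nonneg_left (Real.exp_le_exp.mpr ?_) (by positivity)
  have hm : (0 : ℝ) ≤ m := Nat.cast_nonneg m
  have hn : (0 : ℝ) ≤ n := Nat.cast_nonneg n
  have k1 := mul_le_mul_of_nonneg_right (min_le_left (A * ℓ * r / 2) ((B - A) * ℓ' * r / 2)) hm
  have k2 := mul_le_mul_of_nonneg_right (min_le_right (A * ℓ * r / 2) ((B - A) * ℓ' * r / 2)) hn
  have k3 : 0 ≤ A * ℓ * (m * (σ + m / 2)) := by positivity
  have k4 : 0 ≤ (B - A) * ℓ' * (n * (τ + n / 2)) := by positivity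
  nlinarith

end Translation

/-! ### The state integral as a sum of contour integrals -/

section Telescoping

open Complex Filter Topology MeasureTheory Set

variable {b : ℂ}

/-- Telescoping in the first index: only row 0 survives. -/
theorem hasSum_sub_shift {a : ℕ × ℕ → ℂ} (ha : Summable a) :
    HasSum (fun p : ℕ × ℕ => a p - a (p.1 + 1, p.2)) (∑' n, a (0, n)) := by
  have hs : Summable fun p : ℕ × ℕ => a (p.1 + 1, p.2) :=
    ha.comp_injective (i := fun p : ℕ × ℕ => (p.1 + 1, p.2)) fun p q h => by
      simpa [Prod.ext_iff] using h
  have h := ha.hasSum.sub hs.hasSum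
  have e : ∑' p, a p - ∑' p : ℕ × ℕ, a (p.1 + 1, p.2) = ∑' n, a (0, n) := by
    rw [ha.tsum_prod, hs.tsum_prod, ha.prod.tsum_eq_zero_add]
    ring
  rwa [e] at h

theorem tsum_integral_unit {F : ℝ → ℂ} (hF : IntegrableOn F (Ioi 0))
    (hs : Summable fun n : ℕ => ∫ t in (0 : ℝ)..1, F (t + n)) :
    ∑' n : ℕ, ∫ t in (0 : ℝ)..1, F (t + n) = ∫ t in Ioi (0 : ℝ), F t := by
  have h1 := intervalIntegral_tendsto_integral_Ioi 0 hF
    (tendsto_natCast_atTop_atTop (R := ℝ))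
  refine tendsto_nhds_unique hs.hasSum.tendsto_sum_nat (h1.congr fun n => ?_)
  have h2 := intervalIntegral.sum_integral_adjacent_intervals (f := F) (μ := volume)
    (a := fun k : ℕ => (k : ℝ)) (n := n) fun k _ => by
      rw [intervalIntegrable_iff_integrableOn_Ioc_of_le (by simp)]
      exact hF.mono_set fun t ht => (Nat.cast_nonneg k).trans_lt ht.1
  rw [Nat.cast_zero] at h2
  rw [← h2]
  refine Finset.sum_congr rfl fun k _ => ?_
  rw [intervalIntegral.integral_comp_add_right]
  simp [add_comm]

theorem summable_exp_neg {κ : ℝ} (hκ : 0 < κ) :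
    Summable fun p : ℕ × ℕ => Real.exp (-κ * (p.1 + p.2)) := by
  have h1 : Summable fun n : ℕ => Real.exp (-κ) ^ n :=
    summable_geometric_of_lt_one (Real.exp_pos _).le (by rw [Real.exp_lt_one_iff]; linarith)
  refine (h1.mul_of_nonneg h1 (fun _ => by positivity) fun _ => by positivity).congr fun p => ?_
  rw [← Real.exp_nat_mul, ← Real.exp_nat_mul, ← Real.exp_add]
  ring_nf

/-- The integral of the translate of the integrand over the boundary of the fundamental
parallelogram. -/
noncomputable def cellIntegral (A B : ℕ) (b : ℂ) (r : ℝ) (m n : ℕ) : ℂ :=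
  paraIntegral (fun x => integrand A B b (x + m * (I * b) + n * (I * b⁻¹))) (r * cb b) (I * b⁻¹)
    (I * b)

theorem hasSum_cellIntegral {A B : ℕ} (hA : 0 < A) (hAB : A < B) (hb : 0 < (b ^ 2).im)
    (hre : 0 < b.re) {r : ℝ} (hr : r ∈ Ioo (0 : ℝ) 1) :
    HasSum (fun p : ℕ × ℕ => cellIntegral A B b r p.1 p.2)
      (stateIntegral A B b (r * (cb b).im)) := by
  obtain ⟨-, iu, iv, hrays⟩ := stateIntegral_eq_rays hA hAB hb hre hr
  obtain ⟨C, κ, hκ, hC, hbound⟩ := exists_integrand_shift_bound hA hAB hb hr.1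
  have hcont : ∀ σ τ : ℝ, (σ = 0 ∨ τ = 0) →
      ContinuousAt (integrand A B b) (latticePoint b r σ τ) := fun σ τ h => by
    refine (integrand_differentiableAt A B hb fun h0 => ?_).continuousAt
    obtain ⟨n, k, h1, h2⟩ := exists_of_faddeevDen_eq_zero hb h0
    have hn : ∀ n : ℤ, (r - 1) / 2 ≠ n := fun n h => by
      have h3 : (-1 : ℝ) < n := by linarith [hr.1]
      have h4 : (n : ℝ) < 0 := by linarith [hr.2]
      have h3' : (-1 : ℤ) < n := by exact_mod_cast h3
      have h4' : n < (0 : ℤ) := by exact_mod_cast h4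
      omega
    rcases h with rfl | rfl
    · exact hn n (by simpa using h1)
    · exact hn k (by simpa using h2)
  set a : ℕ × ℕ → ℂ := fun p => I * b⁻¹ * ∫ t in (0 : ℝ)..1,
    integrand A B b (latticePoint b r 0 t + p.1 * (I * b) + p.2 * (I * b⁻¹)) with ha
  set c : ℕ × ℕ → ℂ := fun p => I * b * ∫ t in (0 : ℝ)..1,
    integrand A B b (latticePoint b r t 0 + p.1 * (I * b) + p.2 * (I * b⁻¹)) with hc
  have hsum : ∀ (w : ℂ) (γ : ℝ → ℝ × ℝ), Continuous γ →
      (∀ t ∈ Icc (0 : ℝ) 1, 0 ≤ (γ t).1 ∧ 0 ≤ (γ t).2 ∧ ((γ t).1 = 0 ∨ (γ t).2 = 0)) →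
      Summable fun p : ℕ × ℕ => w * ∫ t in (0 : ℝ)..1, integrand A B b
        (latticePoint b r (γ t).1 (γ t).2 + p.1 * (I * b) + p.2 * (I * b⁻¹)) := by
    intro w γ hγ hγ'
    have hcγ : ContinuousOn (fun t => integrand A B b (latticePoint b r (γ t).1 (γ t).2))
        (Icc 0 1) := fun t ht => by
      have h1 : Continuous fun t => latticePoint b r (γ t).1 (γ t).2 := by
        unfold latticePoint
        fun_prop
      exact (ContinuousAt.comp (f := fun t => latticePoint b r (γ t).1 (γ t).2)
        (hcont _ _ (hγ' t ht).2.2) h1.continuousAt).continuousWithinAt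
    obtain ⟨M, hM⟩ := isCompact_Icc.exists_bound_of_continuousOn hcγ
    refine Summable.mul_left w (Summable.of_norm_bounded
      ((summable_exp_neg hκ).mul_left (M * C)) fun p => ?_)
    have h2 := intervalIntegral.norm_integral_le_of_norm_le_const (a := (0 : ℝ)) (b := 1)
      (f := fun t => integrand A B b
        (latticePoint b r (γ t).1 (γ t).2 + p.1 * (I * b) + p.2 * (I * b⁻¹)))
      (C := M * C * Real.exp (-κ * (p.1 + p.2))) fun t ht => by
        rw [uIoc_of_le zero_le_one] at ht
        have ht' : t ∈ Icc (0 : ℝ) 1 := ⟨ht.1.le, ht.2⟩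
        refine (hbound _ _ (hγ' t ht').1 (hγ' t ht').2.1 p.1 p.2).trans ?_
        rw [mul_assoc]
        have := hM t ht'
        gcongr
    simpa using h2
  have sa : Summable a := hsum (I * b⁻¹) (fun t => (0, t)) (by fun_prop)
    fun t ht => ⟨le_rfl, ht.1, Or.inl rfl⟩
  have sc : Summable c := hsum (I * b) (fun t => (t, 0)) (by fun_prop)
    fun t ht => ⟨ht.1, le_rfl, Or.inr rfl⟩
  -- The edges parallel to ib⁻¹ telescope in m and those parallel to ib telescope in n. What remains
  -- are the edges along the two rays.
  have h1 := hasSum_sub_shift sa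
  have sc' : Summable fun p : ℕ × ℕ => c p.swap := sc.prod_symm
  have h2 := hasSum_sub_shift sc'
  rw [← (Equiv.prodComm ℕ ℕ).hasSum_iff] at h2
  have h3 := h1.sub h2
  have ea : ∑' n, a (0, n) = I * b⁻¹ *
      ∫ t in Ioi (0 : ℝ), integrand A B b (r * cb b + t * (I * b⁻¹)) := by
    have e : ∀ n : ℕ, a (0, n) = I * b⁻¹ * ∫ t in (0 : ℝ)..1,
        integrand A B b (r * cb b + ((t + n : ℝ) : ℂ) * (I * b⁻¹)) := fun n => by
      simp only [ha, latticePoint]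
      congr 1
      refine intervalIntegral.integral_congr fun t _ => ?_
      congr 1
      push_cast
      ring
    have hs0 : Summable fun n : ℕ => ∫ t in (0 : ℝ)..1,
        integrand A B b (r * cb b + ((t + n : ℝ) : ℂ) * (I * b⁻¹)) := by
      have hne : I * b⁻¹ ≠ 0 := mul_ne_zero I_ne_zero (inv_ne_zero (ne_zero_of_im_sq_pos hb))
      have := sa.prod_factor 0
      rw [← summable_mul_left_iff hne]
      exact this.congr e
    simp_rw [e]
    rw [tsum_mul_left, tsum_integral_unit iv hs0]
  have ec : ∑' n, c (n, 0) = I * b *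
      ∫ t in Ioi (0 : ℝ), integrand A B b (r * cb b + t * (I * b)) := by
    have e : ∀ n : ℕ, c (n, 0) = I * b * ∫ t in (0 : ℝ)..1,
        integrand A B b (r * cb b + ((t + n : ℝ) : ℂ) * (I * b)) := fun n => by
      simp only [hc, latticePoint]
      congr 1
      refine intervalIntegral.integral_congr fun t _ => ?_
      congr 1
      push_cast
      ring
    have hs0 : Summable fun n : ℕ => ∫ t in (0 : ℝ)..1,
        integrand A B b (r * cb b + ((t + n : ℝ) : ℂ) * (I * b)) := by
      have hne : I * b ≠ 0 := mul_ne_zero I_ne_zero (ne_zero_of_im_sq_pos hb)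
      have := sc'.prod_factor 0
      rw [← summable_mul_left_iff hne]
      exact this.congr e
    simp_rw [e]
    rw [tsum_mul_left, tsum_integral_unit iu hs0]
  simp only [Prod.swap_prod_mk] at h3
  rw [ea, ec, ← hrays] at h3
  refine h3.congr_fun fun p => ?_
  simp only [cellIntegral, paraIntegral, Function.comp_apply, Equiv.prodComm_apply, Prod.fst_swap,
    Prod.snd_swap, ha, hc, latticePoint]
  push_cast
  have t1 : ∀ t : ℝ, r * cb b + I * b⁻¹ + t * (I * b) + p.1 * (I * b) + p.2 * (I * b⁻¹) =
      r * cb b + t * (I * b) + p.1 * (I * b) + (p.2 + 1) * (I * b⁻¹) := fun t => by ring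
  have t2 : ∀ t : ℝ, r * cb b + t * (I * b⁻¹) + I * b + p.1 * (I * b) + p.2 * (I * b⁻¹) =
      r * cb b + t * (I * b⁻¹) + (p.1 + 1) * (I * b) + p.2 * (I * b⁻¹) := fun t => by ring
  simp only [t1, t2, zero_mul, add_zero]
  ring

end Telescoping

end StateIntegral

namespace StateIntegral

/-! ### Taylor series at the origin -/

section Taylor

open Complex Filter Topology

open scoped PowerSeries

/-- `F` is analytic at `0` with Taylor series `S`. -/
def IsTaylor (F : ℂ → ℂ) (S : ℂ⟦X⟧) : Prop :=
  AnalyticAt ℂ F 0 ∧ ∀ n, PowerSeries.coeff n S = iteratedDeriv n F 0 / n.factorial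

variable {F G : ℂ → ℂ} {S T : ℂ⟦X⟧}

theorem IsTaylor.unique (h : IsTaylor F S) (h' : IsTaylor F T) : S = T := by
  ext n
  rw [h.2, h'.2]

theorem AnalyticAt.isTaylor (h : AnalyticAt ℂ F 0) :
    IsTaylor F (PowerSeries.mk fun n => iteratedDeriv n F 0 / n.factorial) :=
  ⟨h, fun n => by rw [PowerSeries.coeff_mk]⟩

theorem IsTaylor.congr (h : IsTaylor F S) (e : F =ᶠ[𝓝 0] G) : IsTaylor G S :=
  ⟨h.1.congr e, fun n => by rw [h.2, e.iteratedDeriv_eq]⟩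

theorem IsTaylor.hasFPowerSeriesAt (h : IsTaylor F S) :
    HasFPowerSeriesAt F (FormalMultilinearSeries.ofScalars ℂ fun n => PowerSeries.coeff n S) 0 := by
  have := h.1.hasFPowerSeriesAt
  simp only [h.2]
  exact this

theorem isTaylor_of_hasSum (h : ∀ᶠ w in 𝓝 (0 : ℂ), HasSum (fun n => PowerSeries.coeff n S * w ^ n)
    (F w)) : IsTaylor F S := by
  have h1 : HasFPowerSeriesAt F
      (FormalMultilinearSeries.ofScalars ℂ fun n => PowerSeries.coeff n S) 0 := by
    rw [hasFPowerSeriesAt_iff]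
    filter_upwards [h] with w hw
    simpa [FormalMultilinearSeries.coeff_ofScalars, mul_comm] using hw
  refine ⟨h1.analyticAt, fun n => ?_⟩
  have h2 := h1.eq_formalMultilinearSeries h1.analyticAt.hasFPowerSeriesAt
  have h3 := congrArg (fun p => FormalMultilinearSeries.coeff p n) h2
  simpa [FormalMultilinearSeries.coeff_ofScalars] using h3

theorem isTaylor_const (c : ℂ) : IsTaylor (fun _ => c) (PowerSeries.C c) := by
  refine ⟨analyticAt_const, fun n => ?_⟩
  rw [PowerSeries.coeff_C, iteratedDeriv_const]
  split_ifs with h <;> simp [h]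

theorem isTaylor_id : IsTaylor (fun w => w) PowerSeries.X := by
  apply isTaylor_of_hasSum
  refine Eventually.of_forall fun w => ?_
  convert hasSum_ite_eq 1 w using 2 with n
  rw [PowerSeries.coeff_X]
  split_ifs with h <;> simp [h]

theorem IsTaylor.add (h : IsTaylor F S) (h' : IsTaylor G T) :
    IsTaylor (fun w => F w + G w) (S + T) := by
  refine ⟨h.1.add h'.1, fun n => ?_⟩
  rw [map_add, h.2, h'.2, iteratedDeriv_fun_add h.1.contDiffAt h'.1.contDiffAt, add_div]

theorem IsTaylor.mul (h : IsTaylor F S) (h' : IsTaylor G T) :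
    IsTaylor (fun w => F w * G w) (S * T) := by
  refine ⟨h.1.mul h'.1, fun n => ?_⟩
  rw [PowerSeries.coeff_mul, iteratedDeriv_fun_mul h.1.contDiffAt h'.1.contDiffAt, Finset.sum_div,
    Finset.Nat.sum_antidiagonal_eq_sum_range_succ_mk]
  refine Finset.sum_congr rfl fun i hi => ?_
  have hi' : i ≤ n := by simpa [Nat.lt_succ_iff] using hi
  rw [h.2, h'.2, Nat.cast_choose ℂ hi']
  have := Nat.cast_ne_zero (R := ℂ).mpr n.factorial_ne_zero
  have := Nat.cast_ne_zero (R := ℂ).mpr i.factorial_ne_zero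
  have := Nat.cast_ne_zero (R := ℂ).mpr (n - i).factorial_ne_zero
  field_simp

theorem IsTaylor.neg (h : IsTaylor F S) : IsTaylor (fun w => -F w) (-S) := by
  simpa using (isTaylor_const (-1)).mul h

theorem IsTaylor.sub (h : IsTaylor F S) (h' : IsTaylor G T) :
    IsTaylor (fun w => F w - G w) (S - T) := by
  simpa [sub_eq_add_neg] using h.add h'.neg

theorem IsTaylor.pow (h : IsTaylor F S) (n : ℕ) : IsTaylor (fun w => F w ^ n) (S ^ n) := by
  induction n with
  | zero => simpa using isTaylor_const 1
  | succ n ih => simpa [pow_succ] using ih.mul h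

theorem IsTaylor.constantCoeff (h : IsTaylor F S) : PowerSeries.constantCoeff S = F 0 := by
  rw [← PowerSeries.coeff_zero_eq_constantCoeff_apply, h.2]
  simp

theorem IsTaylor.rescale (h : IsTaylor F S) (c : ℂ) :
    IsTaylor (fun w => F (c * w)) (PowerSeries.rescale c S) := by
  refine ⟨?_, fun n => ?_⟩
  · have : AnalyticAt ℂ F (c * 0) := by simpa using h.1
    exact this.comp (f := fun w => c * w) (by fun_prop)
  have h1 := hasFPowerSeriesAt_iff.mp h.hasFPowerSeriesAt
  have ht : Tendsto (fun w : ℂ => c * w) (𝓝 0) (𝓝 0) := by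
    have : ContinuousAt (fun w : ℂ => c * w) 0 := by fun_prop
    simpa [ContinuousAt] using this
  refine (isTaylor_of_hasSum ?_).2 n
  filter_upwards [ht.eventually h1] with w hw
  rw [zero_add] at hw
  refine hw.congr_fun fun n => ?_
  rw [PowerSeries.coeff_rescale, FormalMultilinearSeries.coeff_ofScalars, smul_eq_mul]
  ring

theorem IsTaylor.inv (h : IsTaylor F S) (h0 : F 0 ≠ 0) (hT : S * T = 1) :
    IsTaylor (fun w => (F w)⁻¹) T := by
  have h1 : AnalyticAt ℂ (fun w => (F w)⁻¹) 0 := h.1.fun_inv h0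
  have h2 := AnalyticAt.isTaylor h1
  set U := PowerSeries.mk fun n => iteratedDeriv n (fun w => (F w)⁻¹) 0 / n.factorial
  have h3 : IsTaylor (fun _ => (1 : ℂ)) (S * U) := by
    refine (h.mul h2).congr ?_
    filter_upwards [h.1.continuousAt.eventually_ne h0] with w hw
    exact mul_inv_cancel₀ hw
  have h4 : S * U = 1 := by
    rw [h3.unique (isTaylor_const 1), map_one]
  have : T = U := by
    calc T = T * (S * U) := by rw [h4, mul_one]
      _ = (S * T) * U := by ring
      _ = U := by rw [hT, one_mul]
  rw [this]
  exact h2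

theorem IsTaylor.deriv (h : IsTaylor F S) :
    IsTaylor (deriv F) (PowerSeries.derivative ℂ S) := by
  refine ⟨h.1.deriv, fun n => ?_⟩
  rw [PowerSeries.coeff_derivative, h.2, ← iteratedDeriv_succ', Nat.factorial_succ]
  have := Nat.cast_ne_zero (R := ℂ).mpr n.factorial_ne_zero
  have : (n : ℂ) + 1 ≠ 0 := Nat.cast_add_one_ne_zero n
  push_cast
  field_simp

/-- The recursion (n+1)u_{n+1} = ∑ w_i u_j with i + j = n determines a formal solution from its
constant term. This identifies analytic exponentials with formal ones. -/
theorem eq_of_derivative_eq_mul {U V W : ℂ⟦X⟧}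
    (h0 : PowerSeries.constantCoeff U = PowerSeries.constantCoeff V)
    (hU : PowerSeries.derivative ℂ U = W * U) (hV : PowerSeries.derivative ℂ V = W * V) :
    U = V := by
  ext n
  induction n using Nat.strong_induction_on with
  | _ n ih =>
    cases n with
    | zero => simpa using h0
    | succ n =>
      have h1 := congrArg (PowerSeries.coeff n) hU
      have h2 := congrArg (PowerSeries.coeff n) hV
      rw [PowerSeries.coeff_derivative, PowerSeries.coeff_mul] at h1 h2
      have h3 : (n : ℂ) + 1 ≠ 0 := Nat.cast_add_one_ne_zero n
      apply mul_right_cancel₀ h3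
      rw [h1, h2]
      refine Finset.sum_congr rfl fun p hp => ?_
      rw [ih p.2]
      have := Finset.HasAntidiagonal.mem_antidiagonal.mp hp
      omega

theorem constantCoeff_exp_subst {R : Type*} [CommRing R] [Algebra ℚ R] {V : R⟦X⟧}
    (hV : PowerSeries.constantCoeff V = 0) :
    PowerSeries.constantCoeff ((PowerSeries.exp R).subst V) = 1 := by
  have hs : PowerSeries.HasSubst V := PowerSeries.HasSubst.of_constantCoeff_zero' hV
  have h1 := PowerSeries.constantCoeff_subst_eq_zero (a := V) hV (PowerSeries.exp R - 1)
    (by simp)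
  rw [PowerSeries.subst_sub hs] at h1
  have h2 : (1 : R⟦X⟧).subst V = (1 : R⟦X⟧) := by
    rw [← PowerSeries.coe_substAlgHom hs, map_one]
  rw [h2] at h1
  change PowerSeries.constantCoeff ((PowerSeries.exp R).subst V - 1) = 0 at h1
  rw [map_sub, map_one, sub_eq_zero] at h1
  exact h1

theorem derivative_exp_subst {R : Type*} [CommRing R] [Algebra ℚ R] {V : R⟦X⟧}
    (hV : PowerSeries.constantCoeff V = 0) :
    PowerSeries.derivative R ((PowerSeries.exp R).subst V) =
      PowerSeries.derivative R V * (PowerSeries.exp R).subst V := by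
  rw [PowerSeries.derivative_subst (PowerSeries.HasSubst.of_constantCoeff_zero' hV),
    PowerSeries.derivative_exp, mul_comm]

/-- The Taylor series of e^F and the formal substitution both solve U' = S'U with constant term 1.
-/
theorem IsTaylor.exp (h : IsTaylor F S) (h0 : PowerSeries.constantCoeff S = 0) :
    IsTaylor (fun w => Complex.exp (F w)) ((PowerSeries.exp ℂ).subst S) := by
  have h1 : AnalyticAt ℂ (fun w => Complex.exp (F w)) 0 := h.1.cexp
  have h2 := AnalyticAt.isTaylor h1
  set U := PowerSeries.mk fun n => iteratedDeriv n (fun w => Complex.exp (F w)) 0 / n.factorial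
  have h3 : U = (PowerSeries.exp ℂ).subst S := by
    apply eq_of_derivative_eq_mul (W := PowerSeries.derivative ℂ S)
    · rw [h2.constantCoeff, constantCoeff_exp_subst h0, ← h.constantCoeff, h0, Complex.exp_zero]
    · refine h2.deriv.unique ((h.deriv.mul h2).congr ?_)
      filter_upwards [h.1.eventually_analyticAt] with w hw
      rw [deriv_cexp hw.differentiableAt, mul_comm]
    · exact derivative_exp_subst h0
  rw [← h3]
  exact h2

theorem isTaylor_exp : IsTaylor Complex.exp (PowerSeries.exp ℂ) := by
  refine ⟨by fun_prop, fun n => ?_⟩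
  rw [PowerSeries.coeff_exp]
  simp [iteratedDeriv_eq_iterate]

/-- Expand every exponential and exchange the sums; the hypothesis is absolute convergence of the
double series for |w| ≤ r. -/
theorem isTaylor_tsum_exp {c : ℕ → ℂ} {r : ℝ} (hr : 0 < r)
    (hc : Summable fun s : ℕ => ‖c s‖ * Real.exp ((s + 1 : ℕ) * r)) :
    IsTaylor (fun w => ∑' s, c s * exp ((s + 1 : ℕ) * w))
      (PowerSeries.mk fun n => (∑' s : ℕ, ((s + 1 : ℕ) : ℂ) ^ n * c s) / n.factorial) := by
  apply isTaylor_of_hasSum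
  have hmem : Metric.ball (0 : ℂ) r ∈ 𝓝 (0 : ℂ) := Metric.ball_mem_nhds 0 hr
  filter_upwards [hmem] with w hw
  have hw' : ‖w‖ ≤ r := by simpa using (mem_ball_zero_iff.mp hw).le
  set f : ℕ × ℕ → ℂ := fun p => c p.1 * (((p.1 + 1 : ℕ) * w) ^ p.2 / p.2.factorial) with hf
  have hin : ∀ s : ℕ, HasSum (fun n => f (s, n)) (c s * exp ((s + 1 : ℕ) * w)) := fun s => by
    have := NormedSpace.expSeries_div_hasSum_exp (((s + 1 : ℕ) : ℂ) * w)
    rw [← Complex.exp_eq_exp_ℂ] at this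
    exact this.mul_left (c s)
  have hin' : ∀ s : ℕ, HasSum (fun n => ‖f (s, n)‖) (‖c s‖ * Real.exp ((s + 1 : ℕ) * ‖w‖)) :=
    fun s => by
    have := NormedSpace.expSeries_div_hasSum_exp (((s + 1 : ℕ) : ℝ) * ‖w‖)
    rw [← Real.exp_eq_exp_ℝ] at this
    refine (this.mul_left ‖c s‖).congr_fun fun n => ?_
    simp only [hf, norm_mul, norm_div, norm_pow, Complex.norm_natCast]
  have hsum : Summable f := by
    apply Summable.of_norm
    rw [summable_prod_of_nonneg (fun _ => norm_nonneg _)]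
    refine ⟨fun s => (hin' s).summable, ?_⟩
    simp only [fun s => (hin' s).tsum_eq]
    refine Summable.of_nonneg_of_le (fun s => by positivity) (fun s => ?_) hc
    gcongr
  have h1 : HasSum f (∑' s, c s * exp ((s + 1 : ℕ) * w)) := by
    have := hsum.hasSum.prod_fiberwise hin
    rw [this.tsum_eq]
    exact hsum.hasSum
  have h2 : HasSum (f ∘ Prod.swap) (∑' s, c s * exp ((s + 1 : ℕ) * w)) :=
    (Equiv.prodComm ℕ ℕ).hasSum_iff.mpr h1
  have h3 := h2.summable.prod_factor
  have h4 := h2.prod_fiberwise (fun n => (h3 n).hasSum)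
  convert h4 using 2 with n
  rw [PowerSeries.coeff_mk, ← tsum_div_const, ← tsum_mul_right]
  refine tsum_congr fun s => ?_
  simp only [hf, Function.comp, Prod.swap]
  rw [mul_pow]
  ring

end Taylor

end StateIntegral

namespace StateIntegral

/-! ### Eigenvalues of the generating series `φ` and `φ̃` -/

section GeneratingSeries

open Complex Filter Topology

open scoped PowerSeries

variable {q : ℂ}

/-- The eigenvalue of `∑_{l ≥ 1} δ_l w^l / l!` on `x^m`. -/
noncomputable def deltaSeries (q : ℂ) (m : ℕ) : ℂ⟦X⟧ :=
  PowerSeries.mk fun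
    | 0 => 0
    | l + 1 => ((l + 1).factorial : ℂ)⁻¹ * deltaEigen q l m

theorem constantCoeff_deltaSeries (q : ℂ) (m : ℕ) :
    PowerSeries.constantCoeff (deltaSeries q m) = 0 := by
  rw [← PowerSeries.coeff_zero_eq_constantCoeff_apply, deltaSeries, PowerSeries.coeff_mk]

theorem eis_eq_deltaEigen (q : ℂ) (l : ℕ) : eis q l = deltaEigen q l 0 := by
  simp [eis, deltaEigen]

theorem norm_pow_succ_lt_one (hq : ‖q‖ < 1) (m : ℕ) : ‖q ^ (m + 1)‖ < 1 := by
  rw [norm_pow]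
  exact pow_lt_one₀ (norm_nonneg _) hq (by omega)

theorem norm_mul_exp_lt_one (hq : ‖q‖ < 1) (m : ℕ) :
    ∀ᶠ w in 𝓝 (0 : ℂ), ‖q ^ (m + 1) * exp w‖ < 1 := by
  have : ContinuousAt (fun w : ℂ => ‖q ^ (m + 1) * exp w‖) 0 := by fun_prop
  refine this.eventually_lt_const ?_
  simpa using norm_pow_succ_lt_one hq m

theorem qPochInf_mul_qPoch (hq : ‖q‖ < 1) (m : ℕ) :
    qPochInf (q ^ (m + 1)) q * qPoch q m = qPochInf q q := by
  rw [qPochInf_eq_prod_mul q hq m, qPoch_eq_prod, pow_succ', mul_comm]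

/-- The eigenvalue of `φ(w)` on `x^m`. -/
noncomputable def phiFun (q : ℂ) (m : ℕ) (w : ℂ) : ℂ :=
  qPochInf (q ^ (m + 1) * exp w) q * qPoch q m / qPochInf q q

/-- The logarithm of (q^{m+1}e^w;q)_∞ / (q^{m+1};q)_∞ is -∑ q^{s(m+1)}(e^{sw} - 1)/(s(1-q^s)). The
coefficient of w^l/l! cancels one s in the denominator and leaves the eigenvalue of δ_l; the -1
removes the constant term. -/
theorem exists_isTaylor_deltaSeries (hq : ‖q‖ < 1) (m : ℕ) :
    ∃ L : ℂ → ℂ, IsTaylor L (deltaSeries q m) ∧ ∀ᶠ w in 𝓝 0, exp (-L w) = phiFun q m w := by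
  set c : ℕ → ℂ := fun s => (q ^ (m + 1)) ^ (s + 1) / ((s + 1 : ℕ) * (1 - q ^ (s + 1))) with hc
  -- A radius r on which ∑ (|q|e^r)^s still converges.
  obtain ⟨r, hr, hr1⟩ : ∃ r : ℝ, 0 < r ∧ ‖q‖ * Real.exp r < 1 := by
    have h1 : ContinuousAt (fun r : ℝ => ‖q‖ * Real.exp r) 0 := by fun_prop
    have h2 := h1.eventually_lt_const (u := 1) (by simpa using hq)
    obtain ⟨r, h3, h4⟩ := (h2.filter_mono nhdsWithin_le_nhds |>.and
      (self_mem_nhdsWithin : Set.Ioi (0 : ℝ) ∈ 𝓝[>] 0)).exists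
    exact ⟨r, h4, h3⟩
  have hq1 : 0 < 1 - ‖q‖ := by linarith
  have hsum : Summable fun s : ℕ => ‖c s‖ * Real.exp ((s + 1 : ℕ) * r) := by
    have hg : Summable fun s : ℕ => (1 - ‖q‖)⁻¹ * (‖q‖ * Real.exp r) ^ (s + 1) :=
      ((summable_nat_add_iff 1).mpr
        (summable_geometric_of_lt_one (by positivity) hr1)).mul_left _
    refine Summable.of_nonneg_of_le (fun s => by positivity) (fun s => ?_) hg
    rw [mul_pow, ← Real.exp_nat_mul, ← mul_assoc]
    gcongr
    simp only [hc, norm_div, norm_mul, norm_pow, Complex.norm_natCast]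
    rw [div_eq_mul_inv, mul_comm]
    have h1 := one_sub_norm_le hq (Nat.succ_ne_zero s)
    have h2 : (1 : ℝ) ≤ ((s + 1 : ℕ) : ℝ) := by exact_mod_cast Nat.succ_pos s
    gcongr
    · calc 1 - ‖q‖ ≤ 1 * ‖1 - q ^ (s + 1)‖ := by rw [one_mul]; exact h1
        _ ≤ _ := by gcongr
    · exact pow_le_of_le_one (norm_nonneg _) hq.le (by omega)
  have h1 := isTaylor_tsum_exp hr hsum
  have h2 : IsTaylor (fun w => (∑' s, c s * exp ((s + 1 : ℕ) * w)) - ∑' s, c s)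
      (deltaSeries q m) := by
    have h3 := h1.sub (isTaylor_const (∑' s, c s))
    convert h3 using 1
    ext l
    rw [map_sub, PowerSeries.coeff_mk, deltaSeries, PowerSeries.coeff_mk, PowerSeries.coeff_C]
    cases l with
    | zero => simp
    | succ l =>
      simp only [Nat.succ_ne_zero, if_false, sub_zero]
      rw [deltaEigen, inv_mul_eq_div]
      congr 1
      refine tsum_congr fun s => ?_
      have h4 : ((s + 1 : ℕ) : ℂ) ≠ 0 := by exact_mod_cast Nat.succ_ne_zero s
      have h5 := one_sub_pow_ne_zero hq (Nat.succ_ne_zero s)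
      simp only [hc, Nat.succ_eq_add_one] at h5 ⊢
      field_simp
      ring
  refine ⟨_, h2, ?_⟩
  filter_upwards [norm_mul_exp_lt_one hq m] with w hw
  have h7 := qPochInf_eq_exp hq hw
  have h8 := qPochInf_eq_exp hq (norm_pow_succ_lt_one hq m)
  have h9 := qPochInf_mul_qPoch hq m
  have h10 : qPochInf (q ^ (m + 1)) q ≠ 0 :=
    qPochInf_ne_zero_of_norm_lt hq (norm_pow_succ_lt_one hq m)
  rw [phiFun, ← h9, mul_div_mul_right _ _ (qPoch_ne_zero hq m), h7, h8, ← exp_sub]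
  congr 1
  rw [neg_sub, neg_sub_neg]
  congr 1
  refine tsum_congr fun s => ?_
  rw [mul_pow, ← exp_nat_mul]
  simp only [hc]
  ring

theorem isTaylor_phiFun (hq : ‖q‖ < 1) (m : ℕ) :
    IsTaylor (phiFun q m) ((PowerSeries.exp ℂ).subst (-deltaSeries q m)) := by
  obtain ⟨L, h1, h2⟩ := exists_isTaylor_deltaSeries hq m
  exact (h1.neg.exp (by rw [map_neg, constantCoeff_deltaSeries, neg_zero])).congr h2

/-- The eigenvalue of `φ̃(w)` on `x̃^n`. -/
noncomputable def phiTildeFun (q : ℂ) (n : ℕ) (w : ℂ) : ℂ :=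
  exp (-(n * w)) * qPochInf q q * qPoch q n /
    (qPochInf (q * exp w) q * ∏ k ∈ Finset.range n, (1 - q * exp (-w) * q ^ k))

theorem constantCoeff_rescale (c : ℂ) (S : ℂ⟦X⟧) :
    PowerSeries.constantCoeff (PowerSeries.rescale c S) = PowerSeries.constantCoeff S := by
  rw [← PowerSeries.coeff_zero_eq_constantCoeff_apply, PowerSeries.coeff_rescale]
  simp

/-- Twice the even part of the series with n = 0 is its sum with its reflection, so the middle
factor is 1/(φ₀(w)φ₀(-w)). Multiplied by φ_n(-w), the infinite product at -w cancels up to its first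
n factors, since (qe^{-w})_∞ = ∏_{k<n}(1 - q^{k+1}e^{-w})·(q^{n+1}e^{-w})_∞. -/
theorem isTaylor_phiTildeFun (hq : ‖q‖ < 1) (n : ℕ) :
    IsTaylor (phiTildeFun q n)
      ((PowerSeries.exp ℂ).subst (-(PowerSeries.C (n : ℂ) * PowerSeries.X)) *
      (PowerSeries.exp ℂ).subst (deltaSeries q 0 + PowerSeries.rescale (-1) (deltaSeries q 0)) *
      (PowerSeries.exp ℂ).subst (-PowerSeries.rescale (-1) (deltaSeries q n))) := by
  obtain ⟨L, hL, hL'⟩ := exists_isTaylor_deltaSeries hq 0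
  obtain ⟨K, hK, hK'⟩ := exists_isTaylor_deltaSeries hq n
  have h1 := ((isTaylor_const (n : ℂ)).mul isTaylor_id).neg.exp (by simp)
  have h2 := (hL.add (hL.rescale (-1))).exp
    (by simp [constantCoeff_rescale, constantCoeff_deltaSeries])
  have h3 := (hK.rescale (-1)).neg.exp (by simp [constantCoeff_rescale, constantCoeff_deltaSeries])
  refine ((h1.mul h2).mul h3).congr ?_
  have ht : Tendsto (fun w : ℂ => -1 * w) (𝓝 0) (𝓝 0) := by
    have : ContinuousAt (fun w : ℂ => -1 * w) 0 := by fun_prop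
    simpa [ContinuousAt] using this
  filter_upwards [hL', ht.eventually hL', ht.eventually hK', norm_mul_exp_lt_one hq 0,
    ht.eventually (norm_mul_exp_lt_one hq 0), ht.eventually (norm_mul_exp_lt_one hq n)]
    with w e1 e2 e3 n1 n2 n3
  rw [e3, exp_add, ← neg_neg (L w), ← neg_neg (L (-1 * w)), exp_neg (-L w), exp_neg (-L (-1 * w)),
    e1, e2, phiTildeFun, phiFun, phiFun, phiFun]
  rw [zero_add, pow_one] at n1 n2
  have f1 := qPochInf_ne_zero_of_norm_lt hq n1
  have f2 := qPochInf_ne_zero_of_norm_lt hq n2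
  have f3 := qPochInf_ne_zero_of_norm_lt hq n3
  have f4 : qPochInf q q ≠ 0 := qPochInf_ne_zero_of_norm_lt hq hq
  have h4 := qPochInf_eq_prod_mul (q * exp (-1 * w)) hq n
  rw [show q * exp (-1 * w) * q ^ n = q ^ (n + 1) * exp (-1 * w) by ring] at h4
  have h5 : qPoch q 0 = 1 := by simp [qPoch]
  rw [h5, zero_add, pow_one]
  rw [neg_one_mul] at *
  rw [h4] at f2 ⊢
  have f5 := left_ne_zero_of_mul f2
  clear h4 f2
  generalize qPochInf (q ^ (n + 1) * exp (-w)) q = y at *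
  field_simp

/-! ### Evaluation of operator polynomials at eigenvalues -/

/-- The eigenvalue on `x^m x̃^n` of a polynomial in `δ, δ_l, δ̃, δ̃_l`. -/
noncomputable def evalEigen (q qt : ℂ) (m n : ℕ) : OpPoly →ₐ[ℂ] ℂ :=
  MvPolynomial.aeval fun g => op2Eigen q qt g m n

theorem map_exp_subst {R R' : Type*} [CommRing R] [CommRing R'] [Algebra ℚ R] [Algebra ℚ R']
    (h : R →+* R') {a : R⟦X⟧} (ha : PowerSeries.constantCoeff a = 0) :
    PowerSeries.map h ((PowerSeries.exp R).subst a) =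
      (PowerSeries.exp R').subst (PowerSeries.map h a) := by
  have := PowerSeries.map_subst (PowerSeries.HasSubst.of_constantCoeff_zero' ha) (h := h)
    (PowerSeries.exp R)
  rw [PowerSeries.map_exp] at this
  exact this

theorem map_rescale {R R' : Type*} [CommRing R] [CommRing R'] (h : R →+* R') (c : R) (S : R⟦X⟧) :
    PowerSeries.map h (PowerSeries.rescale c S) =
      PowerSeries.rescale (h c) (PowerSeries.map h S) := by
  ext n
  simp [PowerSeries.coeff_rescale]

theorem map_evalEigen_phi (q qt : ℂ) (m n : ℕ) :
    PowerSeries.map (evalEigen q qt m n : OpPoly →+* ℂ) phi =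
      (PowerSeries.exp ℂ).subst (-deltaSeries q m) := by
  rw [phi, expSeries, map_exp_subst _ (by
    rw [map_neg, ← PowerSeries.coeff_zero_eq_constantCoeff_apply, PowerSeries.coeff_mk, neg_zero]),
    map_neg]
  congr 2
  ext l
  rw [PowerSeries.coeff_map, deltaSeries, PowerSeries.coeff_mk, PowerSeries.coeff_mk]
  cases l with
  | zero => simp
  | succ l => simp [evalEigen, dD, op2Eigen, opEigen]

theorem map_evalEigen_phiTilde (q qt : ℂ) (m n : ℕ) :
    PowerSeries.map (evalEigen q qt m n : OpPoly →+* ℂ) (phiTilde qt) =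
      (PowerSeries.exp ℂ).subst (-(PowerSeries.C (n : ℂ) * PowerSeries.X)) *
      (PowerSeries.exp ℂ).subst
        (deltaSeries qt 0 + PowerSeries.rescale (-1) (deltaSeries qt 0)) *
      (PowerSeries.exp ℂ).subst (-PowerSeries.rescale (-1) (deltaSeries qt n)) := by
  rw [phiTilde, expSeries, expSeries, expSeries, map_mul, map_mul, map_exp_subst _ (by simp),
    map_exp_subst _ (by
      rw [← PowerSeries.coeff_zero_eq_constantCoeff_apply, cst, PowerSeries.coeff_C_mul,
        PowerSeries.coeff_mk, mul_zero]),
    map_exp_subst _ (by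
      rw [map_neg, ← PowerSeries.coeff_zero_eq_constantCoeff_apply, PowerSeries.coeff_mk,
        neg_zero])]
  refine congrArg₂ _ (congrArg₂ _ ?_ (congrArg (fun S => PowerSeries.subst S _) ?_))
    (congrArg (fun S => PowerSeries.subst S _) ?_)
  · simp [evalEigen, dtT, op2Eigen, opEigen]
  · ext l
    rw [PowerSeries.coeff_map, cst, PowerSeries.coeff_C_mul, PowerSeries.coeff_mk, map_add,
      PowerSeries.coeff_rescale, deltaSeries, PowerSeries.coeff_mk]
    cases l with
    | zero => simp
    | succ l =>
      simp only [evalEigen]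
      by_cases h : Even (l + 1)
      · simp [h, eis_eq_deltaEigen, h.neg_one_pow, two_mul]
      · simp [h, (Nat.not_even_iff_odd.mp h).neg_one_pow]
  · rw [map_neg]
    congr 1
    ext l
    rw [PowerSeries.coeff_map, PowerSeries.coeff_mk,
        PowerSeries.coeff_rescale, deltaSeries, PowerSeries.coeff_mk]
    cases l with
    | zero => simp
    | succ l =>
      simp [evalEigen, dtD, op2Eigen, opEigen]
      ring

theorem map_evalEigen_gaussFactor (A : ℕ) (b q qt : ℂ) (m n : ℕ) :
    PowerSeries.map (evalEigen q qt m n : OpPoly →+* ℂ) (gaussFactor A b) =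
      (PowerSeries.exp ℂ).subst (PowerSeries.C (A / (4 * Real.pi * I)) * PowerSeries.X ^ 2 +
        PowerSeries.C (A : ℂ) * PowerSeries.X *
          PowerSeries.C (b * (m + 1 / 2) + b⁻¹ * (n + 1 / 2))) := by
  rw [gaussFactor, expSeries, map_exp_subst _ (by simp)]
  congr 1
  simp [evalEigen, cst, dT, dtT, op2Eigen, opEigen]

theorem isTaylor_gaussFactor (A : ℕ) (b q qt : ℂ) (m n : ℕ) :
    IsTaylor (fun w => exp (A / (4 * Real.pi * I) * w ^ 2 +
        A * w * (b * (m + 1 / 2) + b⁻¹ * (n + 1 / 2))))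
      (PowerSeries.map (evalEigen q qt m n : OpPoly →+* ℂ) (gaussFactor A b)) := by
  rw [map_evalEigen_gaussFactor]
  exact (((isTaylor_const _).mul (isTaylor_id.pow 2)).add
    (((isTaylor_const _).mul isTaylor_id).mul (isTaylor_const _))).exp (by simp)

end GeneratingSeries

end StateIntegral

namespace StateIntegral

/-! ### The operator polynomial as a coefficient of a power series -/

section Residue

open Complex Filter Topology

open scoped PowerSeries

/-- The series `b (1 - e^{b⁻¹ w}) / w`. -/
noncomputable def poleSeries (b : ℂ) : ℂ⟦X⟧ :=
  PowerSeries.mk fun n => -(b * (b⁻¹ ^ (n + 1) / (n + 1).factorial))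

theorem constantCoeff_poleSeries {b : ℂ} (hb : b ≠ 0) :
    PowerSeries.constantCoeff (poleSeries b) = ((-1 : ℂˣ) : ℂ) := by
  rw [← PowerSeries.coeff_zero_eq_constantCoeff_apply, poleSeries, PowerSeries.coeff_mk]
  simp [hb]

theorem X_mul_poleSeries (b : ℂ) : PowerSeries.X * poleSeries b =
    PowerSeries.C b * (1 - PowerSeries.rescale b⁻¹ (PowerSeries.exp ℂ)) := by
  ext n
  rw [PowerSeries.coeff_C_mul, map_sub, PowerSeries.coeff_rescale, PowerSeries.coeff_exp]
  cases n with
  | zero => simp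
  | succ n =>
    rw [PowerSeries.coeff_succ_X_mul, poleSeries, PowerSeries.coeff_mk, PowerSeries.coeff_one]
    simp only [Nat.succ_ne_zero, if_false, zero_sub]
    simp
    left
    ring

/-- The inverse of `poleSeries`. -/
noncomputable def poleInv (b : ℂ) : ℂ⟦X⟧ := PowerSeries.invOfUnit (poleSeries b) (-1)

theorem poleSeries_mul_poleInv {b : ℂ} (hb : b ≠ 0) : poleSeries b * poleInv b = 1 :=
  PowerSeries.mul_invOfUnit _ _ (constantCoeff_poleSeries hb)

theorem poleFactor_eq {b : ℂ} (hb : b ≠ 0) :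
    poleFactor b = HahnSeries.single (-1) 1 * ((poleInv b : ℂ⟦X⟧) : LaurentSeries ℂ) := by
  rw [poleFactor, ← X_mul_poleSeries]
  apply inv_eq_of_mul_eq_one_right
  rw [PowerSeries.coe_mul, PowerSeries.coe_X]
  have h1 := congrArg (fun S : ℂ⟦X⟧ => (S : LaurentSeries ℂ)) (poleSeries_mul_poleInv hb)
  simp only [PowerSeries.coe_mul, PowerSeries.coe_one] at h1
  calc _ = (HahnSeries.single (1 : ℤ) (1 : ℂ) * HahnSeries.single (-1) 1) *
      (((poleSeries b : ℂ⟦X⟧) : LaurentSeries ℂ) * ((poleInv b : ℂ⟦X⟧) : LaurentSeries ℂ)) := by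
        ring
    _ = 1 := by
      rw [h1, HahnSeries.single_mul_single]
      simp

theorem map_single_mul_coe {R R' : Type*} [CommRing R] [CommRing R'] (h : R →+* R') (S : R⟦X⟧) :
    HahnSeries.map (HahnSeries.single (-1 : ℤ) (1 : R) * (S : LaurentSeries R)) h =
      HahnSeries.single (-1) 1 * ((PowerSeries.map h S : R'⟦X⟧) : LaurentSeries R') := by
  ext k
  rw [HahnSeries.map_coeff, HahnSeries.coeff_single_mul, HahnSeries.coeff_single_mul, one_mul,
    one_mul, PowerSeries.coeff_coe, PowerSeries.coeff_coe]
  split_ifs <;> simp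

theorem coe_mul_single_mul_coe_pow {R : Type*} [CommRing R] (S T U : R⟦X⟧) (B : ℕ) :
    (S : LaurentSeries R) * ((T : LaurentSeries R) *
      (HahnSeries.single (-1 : ℤ) (1 : R) * (U : LaurentSeries R))) ^ B =
      HahnSeries.single (-(B : ℤ)) (1 : R) * ((S * (T * U) ^ B : R⟦X⟧) : LaurentSeries R) := by
  rw [PowerSeries.coe_mul, PowerSeries.coe_pow, PowerSeries.coe_mul, mul_left_comm (T : LaurentSeries R),
    mul_pow, HahnSeries.single_pow, one_pow, mul_left_comm]
  simp

/-- The pole factor is w⁻¹ times an invertible power series, so its B-th power contributes w^{-B}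
and the residue becomes the coefficient of index B-1, a natural number because B > 0. -/
theorem PAB_eq_coeff {A B : ℕ} (hB : 0 < B) {b : ℂ} (hb : b ≠ 0) :
    PAB A B b = PowerSeries.coeff (B - 1) (gaussFactor A b *
      (PowerSeries.rescale (MvPolynomial.C b) phi *
        PowerSeries.rescale (MvPolynomial.C b⁻¹) (phiTilde (qDual b)) *
          PowerSeries.map (MvPolynomial.C : ℂ →+* OpPoly) (poleInv b)) ^ B) := by
  rw [PAB, residueAt, poleFactor_eq hb, map_single_mul_coe, coe_mul_single_mul_coe_pow,
    HahnSeries.coeff_single_mul, one_mul, PowerSeries.coeff_coe, if_neg (by omega)]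
  congr 2
  omega

/-! ### The action on monomials -/

theorem coeff_act2 (q qt : ℂ) (p : OpPoly) (G : DSeries) (m n : ℕ) :
    PowerSeries.coeff n (PowerSeries.coeff m (act2 q qt p G)) =
      evalEigen q qt m n p * PowerSeries.coeff n (PowerSeries.coeff m G) := by
  induction p using MvPolynomial.induction_on generalizing G with
  | C a =>
    rw [← MvPolynomial.algebraMap_eq, AlgHom.commutes, AlgHom.commutes]
    simp
  | add p r hp hr => simp [hp, hr, add_mul]
  | mul_X p i hp =>
    rw [map_mul, Module.End.mul_apply, hp, act2, polyEval_X, coeff_genOp2, map_mul, mul_assoc]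
    simp [evalEigen]

/-- The eigenvalue on `x^m` of a polynomial in `δ, δ_l`. -/
noncomputable def evalEigenOne (q : ℂ) (m : ℕ) : MvPolynomial Gen ℂ →ₐ[ℂ] ℂ :=
  MvPolynomial.aeval fun g => opEigen q g m

theorem coeff_act (q : ℂ) (p : MvPolynomial Gen ℂ) (G : ℂ⟦X⟧) (m : ℕ) :
    PowerSeries.coeff m (act q p G) = evalEigenOne q m p * PowerSeries.coeff m G := by
  induction p using MvPolynomial.induction_on generalizing G with
  | C a =>
    rw [← MvPolynomial.algebraMap_eq, AlgHom.commutes, AlgHom.commutes]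
    simp
  | add p r hp hr => simp [hp, hr, add_mul]
  | mul_X p i hp =>
    rw [map_mul, Module.End.mul_apply, hp, act, polyEval_X, coeff_genOp, map_mul, mul_assoc]
    simp [evalEigenOne]

theorem coeff_prodSeries (F G : ℂ⟦X⟧) (m n : ℕ) :
    PowerSeries.coeff n (PowerSeries.coeff m (prodSeries F G)) =
      PowerSeries.coeff m F * PowerSeries.coeff n G := by
  rw [prodSeries, PowerSeries.coeff_mul_C, PowerSeries.coeff_map, PowerSeries.coeff_C_mul]

theorem evalEigen_rename_mul (q qt : ℂ) (m n : ℕ) (u v : MvPolynomial Gen ℂ) :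
    evalEigen q qt m n (MvPolynomial.rename Sum.inl u * MvPolynomial.rename Sum.inr v) =
      evalEigenOne q m u * evalEigenOne qt n v := by
  rw [map_mul, evalEigen, MvPolynomial.aeval_rename, MvPolynomial.aeval_rename]
  rfl

/-! ### The coefficient ring -/

/-- Power series with coefficients in a subalgebra. -/
def seriesSubring {R : Type*} [CommRing R] [Algebra ℚ R] (K : Subalgebra ℚ R) : Subring R⟦X⟧ where
  carrier := {S | ∀ n, PowerSeries.coeff n S ∈ K}
  zero_mem' n := by simp
  one_mem' n := by
    rw [PowerSeries.coeff_one]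
    split_ifs
    exacts [one_mem _, zero_mem _]
  add_mem' h h' n := by
    rw [map_add]
    exact add_mem (h n) (h' n)
  neg_mem' h n := by
    rw [map_neg]
    exact neg_mem (h n)
  mul_mem' h h' n := by
    rw [PowerSeries.coeff_mul]
    exact sum_mem fun p _ => mul_mem (h _) (h' _)

theorem mem_seriesSubring {R : Type*} [CommRing R] [Algebra ℚ R] {K : Subalgebra ℚ R} {S : R⟦X⟧} :
    S ∈ seriesSubring K ↔ ∀ n, PowerSeries.coeff n S ∈ K := Iff.rfl

theorem C_mem_seriesSubring {R : Type*} [CommRing R] [Algebra ℚ R] {K : Subalgebra ℚ R} {c : R}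
    (hc : c ∈ K) : PowerSeries.C c ∈ seriesSubring K := fun n => by
  rw [PowerSeries.coeff_C]
  split_ifs
  exacts [hc, zero_mem _]

theorem X_mem_seriesSubring {R : Type*} [CommRing R] [Algebra ℚ R] {K : Subalgebra ℚ R} :
    (PowerSeries.X : R⟦X⟧) ∈ seriesSubring K := fun n => by
  rw [PowerSeries.coeff_X]
  split_ifs
  exacts [one_mem _, zero_mem _]

theorem rescale_mem_seriesSubring {R : Type*} [CommRing R] [Algebra ℚ R] {K : Subalgebra ℚ R}
    {c : R} (hc : c ∈ K) {S : R⟦X⟧} (hS : S ∈ seriesSubring K) :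
    PowerSeries.rescale c S ∈ seriesSubring K := fun n => by
  rw [PowerSeries.coeff_rescale]
  exact mul_mem (pow_mem hc _) (hS n)

/-- The differential equation of the exponential expresses (n+1)c_{n+1} through earlier
coefficients, and in a ℚ-subalgebra n+1 can be divided out. -/
theorem exp_subst_mem_seriesSubring {R : Type*} [CommRing R] [Algebra ℚ R] {K : Subalgebra ℚ R}
    {S : R⟦X⟧} (hS : S ∈ seriesSubring K) (h0 : PowerSeries.constantCoeff S = 0) :
    (PowerSeries.exp R).subst S ∈ seriesSubring K := fun n => by
  induction n using Nat.strong_induction_on with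
  | _ n ih =>
    cases n with
    | zero =>
      rw [PowerSeries.coeff_zero_eq_constantCoeff_apply, constantCoeff_exp_subst h0]
      exact one_mem _
    | succ n =>
      have h1 := congrArg (PowerSeries.coeff n) (derivative_exp_subst h0)
      rw [PowerSeries.coeff_derivative, PowerSeries.coeff_mul] at h1
      have h2 : ((n : ℚ) + 1) • PowerSeries.coeff (n + 1) ((PowerSeries.exp R).subst S) ∈ K := by
        have h3 : ((n : ℚ) + 1) • PowerSeries.coeff (n + 1) ((PowerSeries.exp R).subst S) =
            PowerSeries.coeff (n + 1) ((PowerSeries.exp R).subst S) * ((n : R) + 1) := by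
          rw [Algebra.smul_def, mul_comm]
          simp
        rw [h3, h1]
        refine sum_mem fun p hp => mul_mem ?_ (ih _ ?_)
        · rw [PowerSeries.coeff_derivative]
          exact mul_mem (hS _) (add_mem (natCast_mem K _) (one_mem _))
        · have := Finset.HasAntidiagonal.mem_antidiagonal.mp hp
          omega
      have h4 : (n : ℚ) + 1 ≠ 0 := by positivity
      have h5 := K.smul_mem h2 ((n : ℚ) + 1)⁻¹
      rwa [smul_smul, inv_mul_cancel₀ h4, one_smul] at h5

/-- Polynomials with coefficients in `coeffRing b`. -/
def polySubalgebra (σ : Type) (b : ℂ) : Subalgebra ℚ (MvPolynomial σ ℂ) where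
  carrier := {p | HasCoeffs b p}
  zero_mem' d := by simp
  one_mem' d := by
    classical
    rw [MvPolynomial.coeff_one]
    split_ifs
    exacts [one_mem _, zero_mem _]
  add_mem' h h' d := by
    rw [MvPolynomial.coeff_add]
    exact add_mem (h d) (h' d)
  mul_mem' h h' d := by
    classical
    rw [MvPolynomial.coeff_mul]
    exact sum_mem fun p _ => mul_mem (h _) (h' _)
  algebraMap_mem' r d := by
    classical
    rw [IsScalarTower.algebraMap_apply ℚ ℂ, MvPolynomial.algebraMap_eq, MvPolynomial.coeff_C]
    split_ifs
    exacts [(coeffRing b).algebraMap_mem r, zero_mem _]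

variable {σ : Type} {b : ℂ}

theorem C_mem_polySubalgebra {z : ℂ} (hz : z ∈ coeffRing b) :
    MvPolynomial.C z ∈ polySubalgebra σ b := fun d => by
  classical
  rw [MvPolynomial.coeff_C]
  split_ifs
  exacts [hz, zero_mem _]

theorem X_mem_polySubalgebra (i : σ) : MvPolynomial.X i ∈ polySubalgebra σ b := fun d => by
  classical
  rw [MvPolynomial.coeff_X]
  split_ifs
  exacts [one_mem _, zero_mem _]

theorem self_mem_coeffRing (b : ℂ) : b ∈ coeffRing b := Algebra.subset_adjoin (by simp)

theorem inv_mem_coeffRing (b : ℂ) : b⁻¹ ∈ coeffRing b := Algebra.subset_adjoin (by simp)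

theorem two_pi_I_inv_mem_coeffRing (b : ℂ) : (2 * Real.pi * I)⁻¹ ∈ coeffRing b :=
  Algebra.subset_adjoin (by simp)

theorem eis_mem_coeffRing (b : ℂ) {l : ℕ} (hl : Even (l + 1)) :
    eis (qDual b) l ∈ coeffRing b := by
  obtain ⟨j, rfl⟩ : ∃ j, l = 2 * j + 1 := by
    obtain ⟨k, hk⟩ := hl
    exact ⟨k - 1, by omega⟩
  exact Algebra.subset_adjoin (Or.inr ⟨j, rfl⟩)

theorem ratCast_mem_coeffRing (b : ℂ) (r : ℚ) : (r : ℂ) ∈ coeffRing b :=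
  (coeffRing b).algebraMap_mem r

theorem factorial_inv_mem_coeffRing (b : ℂ) (n : ℕ) : ((n.factorial : ℂ))⁻¹ ∈ coeffRing b := by
  simpa using ratCast_mem_coeffRing b (n.factorial : ℚ)⁻¹

theorem phi_mem : phi ∈ seriesSubring (polySubalgebra (Gen ⊕ Gen) b) := by
  refine exp_subst_mem_seriesSubring (neg_mem fun n => ?_) (by
    rw [map_neg, ← PowerSeries.coeff_zero_eq_constantCoeff_apply, PowerSeries.coeff_mk, neg_zero])
  rw [PowerSeries.coeff_mk]
  cases n with
  | zero => exact zero_mem _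
  | succ n =>
    exact mul_mem (C_mem_polySubalgebra (factorial_inv_mem_coeffRing b _))
      (X_mem_polySubalgebra _)

theorem phiTilde_mem : phiTilde (qDual b) ∈ seriesSubring (polySubalgebra (Gen ⊕ Gen) b) := by
  refine mul_mem (mul_mem ?_ ?_) ?_
  · exact exp_subst_mem_seriesSubring
      (neg_mem (mul_mem (C_mem_seriesSubring (X_mem_polySubalgebra _)) X_mem_seriesSubring))
      (by simp)
  · refine exp_subst_mem_seriesSubring (mul_mem (C_mem_seriesSubring (C_mem_polySubalgebra
      (by exact ofNat_mem (coeffRing b) 2))) fun n => ?_) (by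
      rw [← PowerSeries.coeff_zero_eq_constantCoeff_apply, cst, PowerSeries.coeff_C_mul,
        PowerSeries.coeff_mk, mul_zero])
    rw [PowerSeries.coeff_mk]
    cases n with
    | zero => exact zero_mem _
    | succ n =>
      dsimp only
      split_ifs with h
      · exact C_mem_polySubalgebra (mul_mem (factorial_inv_mem_coeffRing b _)
          (eis_mem_coeffRing b h))
      · exact zero_mem _
  · refine exp_subst_mem_seriesSubring (neg_mem fun n => ?_) (by
      rw [map_neg, ← PowerSeries.coeff_zero_eq_constantCoeff_apply, PowerSeries.coeff_mk,
        neg_zero])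
    rw [PowerSeries.coeff_mk]
    cases n with
    | zero => exact zero_mem _
    | succ n =>
      exact mul_mem (C_mem_polySubalgebra (mul_mem (factorial_inv_mem_coeffRing b _)
        (pow_mem (neg_mem (one_mem _)) _))) (X_mem_polySubalgebra _)

theorem gaussFactor_mem (A : ℕ) :
    gaussFactor A b ∈ seriesSubring (polySubalgebra (Gen ⊕ Gen) b) := by
  have hA : (A : ℂ) ∈ coeffRing b := natCast_mem _ _
  have hhalf : (1 / 2 : ℂ) ∈ coeffRing b := by simpa using ratCast_mem_coeffRing b (1 / 2)
  refine exp_subst_mem_seriesSubring (add_mem (mul_mem (C_mem_seriesSubring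
    (C_mem_polySubalgebra ?_)) (pow_mem X_mem_seriesSubring _)) (mul_mem (mul_mem
    (C_mem_seriesSubring (C_mem_polySubalgebra hA)) X_mem_seriesSubring)
    (C_mem_seriesSubring (add_mem
      (mul_mem (C_mem_polySubalgebra (self_mem_coeffRing b))
        (add_mem (X_mem_polySubalgebra _) (C_mem_polySubalgebra hhalf)))
      (mul_mem (C_mem_polySubalgebra (inv_mem_coeffRing b))
        (add_mem (X_mem_polySubalgebra _) (C_mem_polySubalgebra hhalf))))))) (by simp)
  have h : (A / (4 * Real.pi * I) : ℂ) = A * (1 / 2) * (2 * Real.pi * I)⁻¹ := by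
    field_simp
    norm_num
  rw [h]
  exact mul_mem (mul_mem hA hhalf) (two_pi_I_inv_mem_coeffRing b)

/-- The constant term of `poleSeries` is -1, so inverting it introduces no denominators beyond those
of the exponential series. -/
theorem poleInv_mem : poleInv b ∈ seriesSubring (coeffRing b) := fun n => by
  induction n using Nat.strong_induction_on with
  | _ n ih =>
    rw [poleInv, PowerSeries.coeff_invOfUnit]
    split_ifs with h
    · simp only [inv_neg, inv_one, Units.val_neg, Units.val_one]
      exact neg_mem (one_mem _)
    · simp only [inv_neg, inv_one, Units.val_neg, Units.val_one, neg_neg, one_mul]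
      refine sum_mem fun p _ => ?_
      split_ifs with h'
      · refine mul_mem ?_ (ih _ h')
        rw [poleSeries, PowerSeries.coeff_mk, div_eq_mul_inv]
        exact neg_mem (mul_mem (self_mem_coeffRing b) (mul_mem (pow_mem (inv_mem_coeffRing b) _)
          (factorial_inv_mem_coeffRing b _)))
      · exact zero_mem _

theorem hasCoeffs_PAB {A B : ℕ} (hB : 0 < B) (hb : b ≠ 0) : HasCoeffs b (PAB A B b) := by
  rw [PAB_eq_coeff hB hb]
  have h : PowerSeries.map (MvPolynomial.C : ℂ →+* OpPoly) (poleInv b) ∈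
      seriesSubring (polySubalgebra (Gen ⊕ Gen) b) := fun n => by
    rw [PowerSeries.coeff_map]
    exact C_mem_polySubalgebra (poleInv_mem n)
  exact mem_seriesSubring.mp (mul_mem (gaussFactor_mem A) (pow_mem (mul_mem (mul_mem
    (rescale_mem_seriesSubring (C_mem_polySubalgebra (self_mem_coeffRing b)) phi_mem)
    (rescale_mem_seriesSubring (C_mem_polySubalgebra (inv_mem_coeffRing b)) phiTilde_mem)) h) B)) _

/-! ### Decompositions -/

/-- One summand per monomial: its left variables, with the coefficient, go to the first factor and
its right variables to the second. -/
theorem exists_isDecomposition {p : OpPoly} (hp : HasCoeffs b p) :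
    ∃ (N : ℕ) (u v : Fin N → MvPolynomial Gen ℂ),
      (∀ k, HasCoeffs b (u k) ∧ HasCoeffs b (v k)) ∧ IsDecomposition p u v := by
  classical
  let e := p.support.equivFin.symm
  let l : (Gen ⊕ Gen →₀ ℕ) → (Gen →₀ ℕ) := fun d => (Finsupp.sumFinsuppEquivProdFinsupp d).1
  let r : (Gen ⊕ Gen →₀ ℕ) → (Gen →₀ ℕ) := fun d => (Finsupp.sumFinsuppEquivProdFinsupp d).2
  refine ⟨_, fun k => MvPolynomial.monomial (l (e k)) (p.coeff (e k)),
    fun k => MvPolynomial.monomial (r (e k)) 1, fun k => ⟨fun d => ?_, fun d => ?_⟩, ?_⟩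
  · rw [MvPolynomial.coeff_monomial]
    split_ifs
    exacts [hp _, zero_mem _]
  · rw [MvPolynomial.coeff_monomial]
    split_ifs
    exacts [one_mem _, zero_mem _]
  · rw [IsDecomposition]
    conv_lhs => rw [p.as_sum]
    rw [← Finset.sum_coe_sort, ← e.sum_comp]
    refine Finset.sum_congr rfl fun k _ => ?_
    rw [MvPolynomial.rename_monomial, MvPolynomial.rename_monomial, MvPolynomial.monomial_mul,
      mul_one]
    refine congrArg (fun d => MvPolynomial.monomial d (p.coeff (e k))) (Finsupp.ext fun g => ?_)
    cases g with
    | inl g =>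
      rw [Finsupp.add_apply, Finsupp.mapDomain_apply Sum.inl_injective,
        Finsupp.mapDomain_of_notMem_range _ _ (by simp), add_zero]
      rfl
    | inr g =>
      rw [Finsupp.add_apply, Finsupp.mapDomain_apply Sum.inr_injective,
        Finsupp.mapDomain_of_notMem_range _ _ (by simp), zero_add]
      rfl

end Residue

end StateIntegral

namespace StateIntegral

/-! ### The residue in one cell -/

section CellResidue

open Complex Filter Topology Set

open scoped PowerSeries

variable {b : ℂ}

/-- The function `b (1 - e^{b⁻¹ w}) / w`. -/
noncomputable def poleFun (b : ℂ) : ℂ → ℂ := dslope (fun w => b * (1 - exp (b⁻¹ * w))) 0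

theorem mul_poleFun (b w : ℂ) : w * poleFun b w = b * (1 - exp (b⁻¹ * w)) := by
  have := sub_smul_dslope (fun w => b * (1 - exp (b⁻¹ * w))) 0 w
  simpa [poleFun] using this

theorem poleFun_zero (hb : b ≠ 0) : poleFun b 0 = -1 := by
  rw [poleFun, dslope_same]
  have h1 : HasDerivAt (fun w => b * (1 - exp (b⁻¹ * w))) (b * -(exp (b⁻¹ * 0) * (b⁻¹ * 1))) 0 :=
    ((((hasDerivAt_id (0 : ℂ)).const_mul b⁻¹).cexp).const_sub 1).const_mul b
  rw [h1.deriv]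
  simp [hb]

theorem differentiable_poleFun (b : ℂ) : Differentiable ℂ (poleFun b) := by
  rw [← differentiableOn_univ, poleFun, differentiableOn_dslope univ_mem]
  fun_prop

theorem isTaylor_poleFun (b : ℂ) : IsTaylor (poleFun b) (poleSeries b) := by
  have h1 : AnalyticAt ℂ (poleFun b) 0 := (differentiable_poleFun b).analyticAt 0
  have h2 := AnalyticAt.isTaylor h1
  set U := PowerSeries.mk fun n => iteratedDeriv n (poleFun b) 0 / n.factorial
  have h3 := isTaylor_id.mul h2
  have h4 : IsTaylor (fun w => b * (1 - exp (b⁻¹ * w)))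
      (PowerSeries.C b * (1 - PowerSeries.rescale b⁻¹ (PowerSeries.exp ℂ))) := by
    simpa using (isTaylor_const b).mul ((isTaylor_const 1).sub (isTaylor_exp.rescale b⁻¹))
  simp only [mul_poleFun] at h3
  have h5 := h3.unique h4
  rw [← X_mul_poleSeries] at h5
  have h6 : U = poleSeries b := mul_left_cancel₀ PowerSeries.X_ne_zero h5
  rw [← h6]
  exact h2

/-- The integrand near a pole in the cell `(m, n)`, with the pole removed. -/
noncomputable def residueFun (A B : ℕ) (b : ℂ) (m n : ℕ) (w : ℂ) : ℂ :=
  exp (A / (4 * Real.pi * I) * w ^ 2 + A * w * (b * (m + 1 / 2) + b⁻¹ * (n + 1 / 2))) *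
    (phiFun (qParam b) m (b * w) * phiTildeFun (qDual b) n (b⁻¹ * w) * (poleFun b w)⁻¹) ^ B

/-- Evaluation at the eigenvalues is a ring homomorphism, so it commutes with taking coefficients
and turns each factor of the operator series into the Taylor series of the corresponding analytic
factor. -/
theorem exists_isTaylor_residueFun {A B : ℕ} (hB : 0 < B) (hb : 0 < (b ^ 2).im) (m n : ℕ) :
    ∃ S : ℂ⟦X⟧, IsTaylor (residueFun A B b m n) S ∧
      PowerSeries.coeff (B - 1) S = evalEigen (qParam b) (qDual b) m n (PAB A B b) := by
  have hb0 := ne_zero_of_im_sq_pos hb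
  have h1 := isTaylor_gaussFactor A b (qParam b) (qDual b) m n
  have h2 := (isTaylor_phiFun (norm_qParam_lt_one hb) m).rescale b
  have h3 := (isTaylor_phiTildeFun (norm_qDual_lt_one hb) n).rescale b⁻¹
  have h4 := (isTaylor_poleFun b).inv (by rw [poleFun_zero hb0]; simp)
    (poleSeries_mul_poleInv hb0)
  refine ⟨_, h1.mul (((h2.mul h3).mul h4).pow B), ?_⟩
  rw [PAB_eq_coeff hB hb0]
  change _ = (evalEigen (qParam b) (qDual b) m n : OpPoly →+* ℂ) _
  rw [← PowerSeries.coeff_map]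
  congr 1
  have e1 : PowerSeries.map (evalEigen (qParam b) (qDual b) m n : OpPoly →+* ℂ)
      (PowerSeries.map (MvPolynomial.C : ℂ →+* OpPoly) (poleInv b)) = poleInv b := by
    ext k
    simp [evalEigen]
  have e2 (z : ℂ) : (evalEigen (qParam b) (qDual b) m n : OpPoly →+* ℂ) (MvPolynomial.C z) = z := by
    simp [evalEigen]
  symm
  rw [map_mul, map_pow, map_mul, map_mul, map_rescale, map_rescale, map_evalEigen_phi,
    map_evalEigen_phiTilde, e1, e2, e2]

theorem faddeevNum_cell (hb : 0 < (b ^ 2).im) (w : ℂ) (m n : ℕ) :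
    faddeevNum b (cb b + w / (2 * Real.pi) + m * (I * b) + n * (I * b⁻¹)) =
      phiFun (qParam b) m (b * w) * (qPochInf (qParam b) (qParam b) / qPoch (qParam b) m) := by
  have hb0 := ne_zero_of_im_sq_pos hb
  have hq := norm_qParam_lt_one hb
  have h1 := qPoch_ne_zero hq m
  have h2 : qPochInf (qParam b) (qParam b) ≠ 0 := qPochInf_ne_zero_of_norm_lt hq hq
  have hpi : (Real.pi : ℂ) ≠ 0 := by exact_mod_cast Real.pi_ne_zero
  have h : exp (2 * Real.pi * b *
      (cb b + w / (2 * Real.pi) + m * (I * b) + n * (I * b⁻¹) + cb b)) =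
      qParam b ^ (m + 1) * exp (b * w) := by
    rw [qParam, ← exp_nat_mul, ← exp_add, exp_eq_exp_iff_exists_int]
    -- The extra 1, like the extra power of q, comes from 2πb·2c_b = 2πi(b² + 1).
    refine ⟨n + 1, ?_⟩
    rw [cb]
    push_cast
    field_simp
    ring
  rw [faddeevNum, h, phiFun]
  generalize qPochInf (qParam b ^ (m + 1) * exp (b * w)) (qParam b) = y
  field_simp

/-- The first factor 1 - e^{w/b} of the infinite product is the source of the pole. The n factors
gained by translation give, after extraction of their leading terms, the exponential e^{-nw/b} and
the finite product of φ̃ together with q̃^{n(n+1)/2}. -/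
theorem faddeevDen_cell (hb : 0 < (b ^ 2).im) (w : ℂ) (m n : ℕ) :
    (faddeevDen b (cb b + w / (2 * Real.pi) + m * (I * b) + n * (I * b⁻¹)))⁻¹ =
      phiTildeFun (qDual b) n (b⁻¹ * w) / (1 - exp (b⁻¹ * w)) *
        ((-1) ^ n * exp (-(2 * Real.pi * I * (b ^ 2)⁻¹ * (n * (n + 1) / 2))) /
          (qPochInf (qDual b) (qDual b) * qPoch (qDual b) n)) := by
  have hb0 := ne_zero_of_im_sq_pos hb
  have hq := norm_qDual_lt_one hb
  have h1 := qPoch_ne_zero hq n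
  have h2 : qPochInf (qDual b) (qDual b) ≠ 0 := qPochInf_ne_zero_of_norm_lt hq hq
  have hpi : (Real.pi : ℂ) ≠ 0 := by exact_mod_cast Real.pi_ne_zero
  have h : exp (2 * Real.pi * b⁻¹ * (cb b + w / (2 * Real.pi) - cb b)) = exp (b⁻¹ * w) := by
    congr 1
    field_simp
    ring
  have h3 : (-1 : ℂ) ^ n * (-1) ^ n = 1 := by rw [← mul_pow]; simp
  have h4 := prod_neg_mul_inv_exp (b⁻¹ * w) (2 * Real.pi * I * (b ^ 2)⁻¹) n
  rw [← qDual] at h4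
  rw [faddeevDen_shift hb, faddeevDen, h, qPochInf_eq_one_sub_mul _ hq,
    prod_one_sub_mul_inv (exp_ne_zero _) (qDual_ne_zero b), h4, phiTildeFun, exp_add,
    ← exp_neg (b⁻¹ * w), exp_neg (n * (b⁻¹ * w)),
    exp_neg (2 * Real.pi * I * (b ^ 2)⁻¹ * (n * (n + 1) / 2)), mul_comm (exp (-(b⁻¹ * w))),
    mul_comm (exp (b⁻¹ * w)) (qDual b)]
  generalize exp (2 * Real.pi * I * (b ^ 2)⁻¹ * (n * (n + 1) / 2)) = e1
  generalize exp (n * (b⁻¹ * w)) = e2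
  generalize qPochInf (qDual b * exp (b⁻¹ * w)) (qDual b) = e3
  generalize (∏ k ∈ Finset.range n, (1 - qDual b * exp (-(b⁻¹ * w)) * qDual b ^ k)) = e4
  generalize 1 - exp (b⁻¹ * w) = e5
  have h5 : ((-1 : ℂ) ^ n)⁻¹ = (-1) ^ n := inv_eq_of_mul_eq_one_left h3
  simp only [div_eq_mul_inv, mul_inv, h5]
  calc _ = (-1) ^ n * e1⁻¹ * e2⁻¹ * e3⁻¹ * e4⁻¹ * e5⁻¹ := by ring
    _ = (-1) ^ n * e1⁻¹ * e2⁻¹ * e3⁻¹ * e4⁻¹ * e5⁻¹ *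
      (qPochInf (qDual b) (qDual b) * (qPochInf (qDual b) (qDual b))⁻¹) *
      (qPoch (qDual b) n * (qPoch (qDual b) n)⁻¹) := by
        rw [mul_inv_cancel₀ h1, mul_inv_cancel₀ h2, mul_one, mul_one]
    _ = _ := by ring

theorem gauss_cell (hb0 : b ≠ 0) (A : ℕ) (w : ℂ) (m n : ℕ) :
    exp (-(A * Real.pi * I * (cb b + w / (2 * Real.pi) + m * (I * b) + n * (I * b⁻¹)) ^ 2)) =
      exp (A / (4 * Real.pi * I) * w ^ 2 + A * w * (b * (m + 1 / 2) + b⁻¹ * (n + 1 / 2))) *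
        ((-1) ^ (A * m) * qParam b ^ (A * (m * (m + 1) / 2)) *
        ((-1) ^ (A * n) * exp (A * (2 * Real.pi * I * (b ^ 2)⁻¹ * (n * (n + 1) / 2)))) *
        exp (A * Real.pi * I * (b ^ 2 + (b ^ 2)⁻¹) / 4 + A * Real.pi * I / 2)) := by
  have hpi : (Real.pi : ℂ) ≠ 0 := by exact_mod_cast Real.pi_ne_zero
  have hm : ((A * (m * (m + 1) / 2) : ℕ) : ℂ) = A * (m * (m + 1) / 2) := by
    rw [Nat.cast_mul, Nat.cast_div (Nat.even_mul_succ_self m).two_dvd (by norm_num)]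
    push_cast
    ring
  rw [← exp_pi_mul_I, ← exp_nat_mul, ← exp_nat_mul, qParam, ← exp_nat_mul, hm, ← exp_add,
    ← exp_add, ← exp_add, ← exp_add, ← exp_add, exp_eq_exp_iff_exists_int]
  -- The cross term 2mn·(ib)(ib⁻¹) = -2mn in the square contributes e^{2πiAmn} = 1, so the Gaussian
  -- separates in m and n.
  refine ⟨A * m * n, ?_⟩
  rw [cb]
  push_cast
  have hI : I⁻¹ = -I := inv_I
  have hbb : b * b⁻¹ = 1 := mul_inv_cancel₀ hb0
  have h1 : (A / (4 * Real.pi * I) : ℂ) = -(A * I / (4 * Real.pi)) := by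
    rw [div_eq_mul_inv, mul_inv, hI]
    field_simp
  rw [h1]
  field_simp
  ring_nf
  simp only [I_sq, I_pow_three]
  ring

/-- The factor i on the left is 2πi from the residue theorem times dx/dw = 1/(2π). It accounts for
the shift A + 1 in the phase of the prefactor. -/
theorem integrand_cell {A B : ℕ} (hAB : A < B) (hb : 0 < (b ^ 2).im) (hre : 0 < b.re) (w : ℂ)
    (m n : ℕ) :
    integrand A B b (cb b + w / (2 * Real.pi) + m * (I * b) + n * (I * b⁻¹)) * I =
      prefactor A B b * (PowerSeries.coeff m (FSeries A B (qParam b)) *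
        PowerSeries.coeff n (FSeries (B - A) B (qDual b))) *
      (exp (A / (4 * Real.pi * I) * w ^ 2 + A * w * (b * (m + 1 / 2) + b⁻¹ * (n + 1 / 2))) *
      (phiFun (qParam b) m (b * w) * phiTildeFun (qDual b) n (b⁻¹ * w) /
        (b * (1 - exp (b⁻¹ * w)))) ^ B) := by
  have hb0 := ne_zero_of_im_sq_pos hb
  have hq := norm_qDual_lt_one hb
  have h2 : qPochInf (qDual b) (qDual b) ≠ 0 := qPochInf_ne_zero_of_norm_lt hq hq
  have h3 := qPochInf_ratio hb hre
  have h4 : faddeev b (cb b + w / (2 * Real.pi) + m * (I * b) + n * (I * b⁻¹)) =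
      (exp (Real.pi * I / 4) * exp (1 / 24 * (2 * Real.pi * I * (-(b ^ 2)⁻¹ - b ^ 2)))) *
      ((-1) ^ n * exp (-(2 * Real.pi * I * (b ^ 2)⁻¹ * (n * (n + 1) / 2))) /
        (qPoch (qParam b) m * qPoch (qDual b) n)) *
      (phiFun (qParam b) m (b * w) * phiTildeFun (qDual b) n (b⁻¹ * w) /
        (b * (1 - exp (b⁻¹ * w)))) := by
    rw [faddeev_eq_div, div_eq_mul_inv, faddeevNum_cell hb, faddeevDen_cell hb]
    have h5 : qPochInf (qParam b) (qParam b) =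
        b⁻¹ * (qPochInf (qDual b) (qDual b) * (exp (Real.pi * I / 4) *
          exp (1 / 24 * (2 * Real.pi * I * (-(b ^ 2)⁻¹ - b ^ 2))))) := by
      rw [← h3, inv_mul_cancel_left₀ hb0]
    rw [h5]
    generalize exp (Real.pi * I / 4) * exp (1 / 24 * (2 * Real.pi * I * (-(b ^ 2)⁻¹ - b ^ 2))) = κ
    generalize exp (-(2 * Real.pi * I * (b ^ 2)⁻¹ * (n * (n + 1) / 2))) = f
    simp only [div_eq_mul_inv, mul_inv]
    generalize (1 - exp (b⁻¹ * w))⁻¹ = e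
    linear_combination (κ * (-1) ^ n * f * (qPoch (qParam b) m)⁻¹ * (qPoch (qDual b) n)⁻¹ *
      phiFun (qParam b) m (b * w) * phiTildeFun (qDual b) n (b⁻¹ * w) * b⁻¹ * e) *
      mul_inv_cancel₀ h2
  -- The denominator contributes q̃^{n(n+1)/2} to the power B and the Gaussian removes A of these;
  -- this is why F_{B-A,B} appears on the dual side.
  have h6 : qDual b ^ ((B - A) * (n * (n + 1) / 2)) =
      exp (-(2 * Real.pi * I * (b ^ 2)⁻¹ * (n * (n + 1) / 2))) ^ B *
        exp (A * (2 * Real.pi * I * (b ^ 2)⁻¹ * (n * (n + 1) / 2))) := by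
    have hn : (((B - A) * (n * (n + 1) / 2) : ℕ) : ℂ) = (B - A) * (n * (n + 1) / 2) := by
      rw [Nat.cast_mul, Nat.cast_div (Nat.even_mul_succ_self n).two_dvd (by norm_num),
        Nat.cast_sub hAB.le]
      push_cast
      ring
    rw [qDual, ← exp_nat_mul, ← exp_nat_mul, hn, ← exp_add]
    congr 1
    ring
  have h7 : (-1 : ℂ) ^ ((B - A) * n) = ((-1) ^ n) ^ B * (-1) ^ (A * n) := by
    have h8 : (-1 : ℂ) ^ (A * n) * (-1) ^ (A * n) = 1 := by rw [← mul_pow]; simp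
    have h9 : ((-1 : ℂ) ^ n) ^ B = (-1) ^ ((B - A) * n) * (-1) ^ (A * n) := by
      rw [← pow_mul, ← pow_add, ← add_mul, Nat.sub_add_cancel hAB.le, mul_comm]
    rw [h9, mul_assoc, h8, mul_one]
  have h10 : prefactor A B b = (exp (Real.pi * I / 4) *
      exp (1 / 24 * (2 * Real.pi * I * (-(b ^ 2)⁻¹ - b ^ 2)))) ^ B *
      exp (A * Real.pi * I * (b ^ 2 + (b ^ 2)⁻¹) / 4 + A * Real.pi * I / 2) * I := by
    rw [prefactor]
    have h11 {x y : ℂ} (h : x = y + Real.pi / 2 * I) : exp x = exp y * I := by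
      rw [h, exp_add, exp_pi_div_two_mul_I]
    rw [← exp_add, ← exp_add, ← exp_nat_mul, ← exp_add]
    exact h11 (by ring)
  rw [integrand, h4, gauss_cell hb0, FSeries, FSeries, PowerSeries.coeff_mk, PowerSeries.coeff_mk,
    h6, h7, h10]
  simp only [mul_pow, div_pow]
  ring

theorem integrand_cell_eq_div {A B : ℕ} (hB : 0 < B) (hAB : A < B) (hb : 0 < (b ^ 2).im)
    (hre : 0 < b.re) (x : ℂ) (m n : ℕ) :
    integrand A B b (x + m * (I * b) + n * (I * b⁻¹)) =
      (prefactor A B b * (PowerSeries.coeff m (FSeries A B (qParam b)) *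
        PowerSeries.coeff n (FSeries (B - A) B (qDual b))) * I⁻¹ * ((2 * (Real.pi : ℂ)) ^ B)⁻¹) *
      (residueFun A B b m n (2 * Real.pi * (x - cb b)) / (x - cb b) ^ (B - 1 + 1)) := by
  have hpi : (Real.pi : ℂ) ≠ 0 := by exact_mod_cast Real.pi_ne_zero
  have h1 := integrand_cell hAB hb hre (2 * Real.pi * (x - cb b)) m n
  rw [mul_div_cancel_left₀ _ (by simp : (2 * Real.pi : ℂ) ≠ 0), add_sub_cancel,
    ← mul_poleFun] at h1
  rw [← mul_inv_cancel_right₀ I_ne_zero (integrand A B b _), h1, residueFun, Nat.sub_add_cancel hB]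
  simp only [div_eq_mul_inv, mul_inv, mul_pow, inv_pow]
  ring

theorem differentiable_phiFun {q : ℂ} (hq : ‖q‖ < 1) (m : ℕ) : Differentiable ℂ (phiFun q m) := by
  have h := differentiable_qPochInf hq
  unfold phiFun
  fun_prop

/-- The denominator of the regular part of the integrand. -/
noncomputable def residueDen (b : ℂ) (n : ℕ) (w : ℂ) : ℂ :=
  qPochInf (qDual b * exp (b⁻¹ * w)) (qDual b) *
    (∏ k ∈ Finset.range n, (1 - qDual b * exp (-(b⁻¹ * w)) * qDual b ^ k)) * poleFun b w

theorem differentiable_residueDen (hb : 0 < (b ^ 2).im) (n : ℕ) :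
    Differentiable ℂ (residueDen b n) := by
  have h := differentiable_qPochInf (norm_qDual_lt_one hb)
  have h' := differentiable_poleFun b
  unfold residueDen
  fun_prop

theorem differentiableAt_residueFun (A B : ℕ) (hb : 0 < (b ^ 2).im) (m n : ℕ) {w : ℂ}
    (hw : residueDen b n w ≠ 0) : DifferentiableAt ℂ (residueFun A B b m n) w := by
  have h1 := differentiable_qPochInf (norm_qDual_lt_one hb)
  have h2 := differentiable_poleFun b
  have h3 := differentiable_phiFun (norm_qParam_lt_one hb) m
  have hw1 := left_ne_zero_of_mul hw
  have hw2 := right_ne_zero_of_mul hw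
  have h4 : DifferentiableAt ℂ (fun w => phiTildeFun (qDual b) n (b⁻¹ * w)) w := by
    unfold phiTildeFun
    exact DifferentiableAt.fun_div (by fun_prop) (by fun_prop) hw1
  have h5 : DifferentiableAt ℂ (fun w => (poleFun b w)⁻¹) w := (h2 w).fun_inv hw2
  unfold residueFun
  fun_prop

theorem cell_sub_cb (r s t : ℝ) :
    (r : ℂ) * cb b + s * (I * b⁻¹) + t * (I * b) = latticePoint b r t s := by
  rw [latticePoint]
  ring

/-- On the closed cell both |q̃e^{w/b}| and |q̃e^{-w/b}| are less than 1, so the q-products do not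
vanish. A zero of `poleFun` would be a zero of the Faddeev denominator in the cell, which can only
be c_b; there w = 0 and `poleFun` equals -1. -/
theorem residueDen_ne_zero (hb : 0 < (b ^ 2).im) (n : ℕ) {r s t : ℝ} (hr : r ∈ Ioo (0 : ℝ) 1)
    (hs : s ∈ Icc (0 : ℝ) 1) (ht : t ∈ Icc (0 : ℝ) 1) :
    residueDen b n (2 * Real.pi * (latticePoint b r t s - cb b)) ≠ 0 := by
  have hb0 := ne_zero_of_im_sq_pos hb
  have hq := norm_qDual_lt_one hb
  obtain ⟨hr0, hr1⟩ := hr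
  obtain ⟨hs0, hs1⟩ := hs
  obtain ⟨ht0, ht1⟩ := ht
  have him := im_neg_inv_sq_pos hb
  rw [neg_im] at him
  have hpi := Real.pi_pos
  set w := 2 * Real.pi * (latticePoint b r t s - cb b) with hw
  have h1 : b⁻¹ * w = 2 * Real.pi * I *
      ((((r - 1) / 2 + t : ℝ) : ℂ) + (((r - 1) / 2 + s : ℝ) : ℂ) * (b ^ 2)⁻¹) := by
    rw [← two_pi_b_inv_mul hb0, hw]
    ring
  have h2 : qDual b * exp (b⁻¹ * w) = exp (2 * Real.pi * I *
      ((((r - 1) / 2 + t : ℝ) : ℂ) + (((r - 1) / 2 + s - 1 : ℝ) : ℂ) * (b ^ 2)⁻¹)) := by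
    rw [h1, qDual, ← exp_add]
    congr 1
    push_cast
    ring
  have h3 : qDual b * exp (-(b⁻¹ * w)) = exp (2 * Real.pi * I *
      ((-((r - 1) / 2 + t) : ℝ) + ((-((r - 1) / 2 + s) - 1 : ℝ) : ℂ) * (b ^ 2)⁻¹)) := by
    rw [h1, qDual, ← exp_add]
    congr 1
    push_cast
    ring
  have h4 : ‖qDual b * exp (b⁻¹ * w)‖ < 1 := by
    rw [h2, norm_exp_two_pi_I, Real.exp_lt_one_iff]
    nlinarith [mul_pos hpi him]
  have h5 : ‖qDual b * exp (-(b⁻¹ * w))‖ < 1 := by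
    rw [h3, norm_exp_two_pi_I, Real.exp_lt_one_iff]
    nlinarith [mul_pos hpi him]
  refine mul_ne_zero (mul_ne_zero (qPochInf_ne_zero_of_norm_lt hq h4) ?_) ?_
  · refine Finset.prod_ne_zero_iff.mpr fun k _ => ?_
    exact one_sub_mul_pow_ne_zero hq h5 k
  · intro h
    have h6 := mul_poleFun b w
    rw [h, mul_zero, eq_comm, mul_eq_zero, or_iff_right hb0] at h6
    have h7 : faddeevDen b (latticePoint b r t s) = 0 := by
      rw [faddeevDen, qPochInf_eq_one_sub_mul _ hq]
      have : 2 * Real.pi * b⁻¹ * (latticePoint b r t s - cb b) = b⁻¹ * w := by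
        rw [hw]
        ring
      rw [this, h6, zero_mul]
    obtain ⟨i, k, hi, hk⟩ := exists_of_faddeevDen_eq_zero hb h7
    have hk0 : k = 0 := by
      have : (k : ℝ) < 1 := by linarith
      exact_mod_cast Nat.lt_one_iff.mp (by exact_mod_cast this)
    have hi0 : i = 0 := by
      have e1 : (i : ℝ) < 1 := by linarith
      have e2 : (-1 : ℝ) < i := by linarith
      have e1' : i < 1 := by exact_mod_cast e1
      have e2' : -1 < i := by exact_mod_cast e2
      omega
    have hw0 : w = 0 := by
      have : b⁻¹ * w = 0 := by
        rw [h1, hi, hk, hi0, hk0]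
        simp
      simpa [hb0] using this
    rw [hw0, poleFun_zero hb0] at h
    norm_num at h

theorem cellIntegral_eq {A B : ℕ} (hAB : A < B) (hb : 0 < (b ^ 2).im)
    (hre : 0 < b.re) {r : ℝ} (hr : r ∈ Ioo (0 : ℝ) 1) (m n : ℕ) :
    cellIntegral A B b r m n = prefactor A B b *
      (evalEigen (qParam b) (qDual b) m n (PAB A B b) *
        (PowerSeries.coeff m (FSeries A B (qParam b)) *
          PowerSeries.coeff n (FSeries (B - A) B (qDual b)))) := by
  have hB : 0 < B := by omega
  have hb0 := ne_zero_of_im_sq_pos hb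
  have hpi : (2 * Real.pi : ℂ) ≠ 0 := by simp
  obtain ⟨S, hS, hS'⟩ := exists_isTaylor_residueFun (A := A) hB hb m n
  have h1 := (hS.rescale (2 * Real.pi)).hasFPowerSeriesAt.comp_sub (cb b)
  rw [zero_add] at h1
  -- c_b = r c_b + ((1-r)/2)(ib⁻¹ + ib), so the pole lies inside the cell. The ratio of the sides is
  -- b², whose positive imaginary part makes the boundary counterclockwise.
  have hmid : (1 - r) / 2 ∈ Ioo (0 : ℝ) 1 := ⟨by linarith [hr.2], by linarith [hr.1]⟩
  have h2 := paraIntegral_div_pow (p := r * cb b) (u := I * b⁻¹) (v := I * b) (c := cb b)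
    hmid hmid (by
      rw [mul_div_mul_left _ _ I_ne_zero, div_inv_eq_mul, ← sq]
      exact hb) (by
      rw [cb]
      push_cast
      ring) (B - 1) h1
    (U := {x | residueDen b n (2 * Real.pi * (x - cb b)) ≠ 0})
    (isOpen_ne_fun ((differentiable_residueDen hb n).continuous.comp (by fun_prop))
      continuous_const)
    (fun x hx => by
      have := differentiableAt_residueFun A B hb m n (w := 2 * Real.pi * (x - cb b)) hx
      exact (this.comp x (f := fun x => 2 * Real.pi * (x - cb b))
        (by fun_prop)).differentiableWithinAt)
    (fun s hs t ht => by
      rw [cell_sub_cb]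
      exact residueDen_ne_zero hb n hr hs ht)
  rw [cellIntegral, paraIntegral_congr (fun x _ => integrand_cell_eq_div hB hAB hb hre x m n),
    paraIntegral_const_mul, h2, FormalMultilinearSeries.coeff_ofScalars, PowerSeries.coeff_rescale,
    hS']
  -- Rescaling w = 2π(x - c_b) gives (2π)^{B-1}; together with 2πi it cancels i⁻¹(2π)^{-B}.
  obtain ⟨k, rfl⟩ : ∃ k, B = k + 1 := ⟨B - 1, by omega⟩
  rw [Nat.add_sub_cancel, pow_succ]
  have := I_ne_zero
  field_simp

end CellResidue

end StateIntegral

namespace StateIntegral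

/-! ### Convergence of the series -/

section Convergence

open Complex Filter Topology Set

open scoped PowerSeries

variable {q : ℂ}

theorem exists_norm_deltaEigen_le (hq : ‖q‖ < 1) (l : ℕ) : ∃ C : ℝ, ∀ m, ‖deltaEigen q l m‖ ≤ C := by
  have hq1 : 0 < 1 - ‖q‖ := by linarith
  have hs : Summable fun s : ℕ => ((s + 1 : ℕ) : ℝ) ^ l * ‖q‖ ^ (s + 1) * (1 - ‖q‖)⁻¹ :=
    ((summable_nat_add_iff (f := fun s : ℕ => (s : ℝ) ^ l * ‖q‖ ^ s) 1).mpr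
      (summable_pow_mul_geometric_of_norm_lt_one l (by simpa using hq))).mul_right _
  refine ⟨_, fun m => tsum_of_norm_bounded hs.hasSum fun s => ?_⟩
  have h1 := one_sub_norm_le hq (Nat.succ_ne_zero s)
  have h2 : ‖(q ^ (s + 1)) ^ m‖ ≤ 1 := by
    rw [norm_pow]
    exact pow_le_one₀ (norm_nonneg _) (norm_pow_succ_lt_one hq s).le
  rw [norm_mul, norm_div, norm_mul, norm_pow, norm_pow q, Complex.norm_natCast, div_eq_mul_inv]
  calc _ ≤ ((s + 1 : ℕ) : ℝ) ^ l * ‖q‖ ^ (s + 1) * (1 - ‖q‖)⁻¹ * 1 := by gcongr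
    _ = _ := mul_one _

/-- The eigenvalue of δ on x^m is m, and those of δ_l are bounded in m, so polynomials in them grow
at most polynomially. -/
theorem exists_norm_evalEigenOne_le (hq : ‖q‖ < 1) (p : MvPolynomial Gen ℂ) :
    ∃ (C : ℝ) (d : ℕ), ∀ m : ℕ, ‖evalEigenOne q m p‖ ≤ C * ((m : ℝ) + 1) ^ d := by
  induction p using MvPolynomial.induction_on with
  | C a => exact ⟨‖a‖, 0, fun m => by simp [evalEigenOne]⟩
  | add p r hp hr =>
    obtain ⟨C, d, h⟩ := hp
    obtain ⟨C', d', h'⟩ := hr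
    refine ⟨|C| + |C'|, d + d', fun m => ?_⟩
    have h1 : (1 : ℝ) ≤ (m : ℝ) + 1 := by linarith [Nat.cast_nonneg (α := ℝ) m]
    rw [map_add, add_mul]
    refine (norm_add_le _ _).trans (add_le_add ((h m).trans ?_) ((h' m).trans ?_))
    · gcongr
      · exact le_abs_self C
      · omega
    · gcongr
      · exact le_abs_self C'
      · omega
  | mul_X p g hp =>
    obtain ⟨C, d, h⟩ := hp
    have hC : 0 ≤ C := by
      have := (norm_nonneg _).trans (h 0)
      simpa using this
    obtain ⟨C', h'⟩ : ∃ C' : ℝ, ∀ m : ℕ, ‖opEigen q g m‖ ≤ C' * ((m : ℝ) + 1) := by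
      cases g with
      | theta =>
        refine ⟨1, fun m => ?_⟩
        rw [opEigen, Complex.norm_natCast]
        linarith
      | delta l =>
        obtain ⟨C', h'⟩ := exists_norm_deltaEigen_le hq l
        refine ⟨C', fun m => (h' m).trans ?_⟩
        have hC' : 0 ≤ C' := (norm_nonneg _).trans (h' 0)
        have := mul_nonneg hC' (Nat.cast_nonneg (α := ℝ) m)
        linarith
    refine ⟨C * C', d + 1, fun m => ?_⟩
    rw [map_mul, norm_mul, evalEigenOne, MvPolynomial.aeval_X]
    calc _ ≤ (C * ((m : ℝ) + 1) ^ d) * (C' * ((m : ℝ) + 1)) :=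
          mul_le_mul (h m) (h' m) (norm_nonneg _) (by positivity)
      _ = _ := by ring

theorem summable_norm_coeff_act {A B : ℕ} (hA : 0 < A) (hq : ‖q‖ < 1) (p : MvPolynomial Gen ℂ) :
    Summable fun m : ℕ => ‖PowerSeries.coeff m (act q p (FSeries A B q))‖ := by
  obtain ⟨C, d, h⟩ := exists_norm_evalEigenOne_le hq p
  obtain ⟨c, hc, hc'⟩ := exists_qPoch_lower_bound hq
  have hC : 0 ≤ C := by
    have := (norm_nonneg _).trans (h 0)
    simpa using this
  -- The bound below divides by ‖q‖; for q = 0 only the constant coefficient survives.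
  rcases eq_or_ne q 0 with rfl | hq0
  · refine summable_of_ne_finset_zero (s := {0}) fun m hm => ?_
    have hm' : 0 < m := Nat.pos_of_ne_zero (by simpa using hm)
    have h2 : 0 < m * (m + 1) / 2 := Nat.div_pos (by nlinarith) (by norm_num)
    rw [coeff_act, FSeries, PowerSeries.coeff_mk, zero_pow (by positivity)]
    simp
  have hqp : 0 < ‖q‖ := norm_pos_iff.mpr hq0
  have hs : Summable fun m : ℕ => (C * (c ^ B)⁻¹ * ‖q‖⁻¹) * (((m + 1 : ℕ) : ℝ) ^ d * ‖q‖ ^ (m + 1)) :=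
    ((summable_nat_add_iff (f := fun s : ℕ => (s : ℝ) ^ d * ‖q‖ ^ s) 1).mpr
      (summable_pow_mul_geometric_of_norm_lt_one d (by simpa using hq))).mul_left _
  refine Summable.of_nonneg_of_le (fun m => norm_nonneg _) (fun m => ?_) hs
  have h1 : m ≤ A * (m * (m + 1) / 2) := by
    have h2 : m ≤ m * (m + 1) / 2 := by
      rw [Nat.le_div_iff_mul_le (by norm_num)]
      rcases Nat.eq_zero_or_pos m with rfl | hm
      · simp
      · nlinarith
    nlinarith
  rw [coeff_act, FSeries, PowerSeries.coeff_mk, norm_mul, norm_div, norm_mul, norm_pow, norm_pow,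
    norm_pow, norm_neg, norm_one, one_pow, one_mul, div_eq_mul_inv]
  calc _ ≤ (C * ((m : ℝ) + 1) ^ d) * (‖q‖ ^ m * (c ^ B)⁻¹) := by
        refine mul_le_mul (h m) (mul_le_mul (pow_le_pow_of_le_one hqp.le hq.le h1) ?_
          (by positivity) (by positivity)) (by positivity) (by positivity)
        gcongr
        exact hc' m
    _ = _ := by
      rw [pow_succ]
      push_cast
      field_simp

theorem summable_coeff_act {A B : ℕ} (hA : 0 < A) (hq : ‖q‖ < 1) (p : MvPolynomial Gen ℂ) :
    Summable fun m : ℕ => PowerSeries.coeff m (act q p (FSeries A B q)) :=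
  (summable_norm_coeff_act hA hq p).of_norm

/-- A decomposition writes the eigenvalue on x^m x̃^n as ∑ u_k(m)v_k(n), so the double series is a
finite sum of products of absolutely convergent series. No condition on the coefficients of u_k and
v_k enters. -/
theorem hasSum_coeff_act2 {A A' B : ℕ} (hA : 0 < A) (hA' : 0 < A') {qt : ℂ} (hq : ‖q‖ < 1)
    (hqt : ‖qt‖ < 1) {p : OpPoly} {N : ℕ} {u v : Fin N → MvPolynomial Gen ℂ}
    (h : IsDecomposition p u v) :
    HasSum (fun x : ℕ × ℕ => PowerSeries.coeff x.2 (PowerSeries.coeff x.1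
      (act2 q qt p (prodSeries (FSeries A B q) (FSeries A' B qt)))))
      (∑ k, bracket (act q (u k) (FSeries A B q)) * bracket (act qt (v k) (FSeries A' B qt))) := by
  have h1 : ∀ x : ℕ × ℕ, PowerSeries.coeff x.2 (PowerSeries.coeff x.1
      (act2 q qt p (prodSeries (FSeries A B q) (FSeries A' B qt)))) =
      ∑ k, PowerSeries.coeff x.1 (act q (u k) (FSeries A B q)) *
        PowerSeries.coeff x.2 (act qt (v k) (FSeries A' B qt)) := fun x => by
    rw [coeff_act2, coeff_prodSeries, h, map_sum, Finset.sum_mul]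
    refine Finset.sum_congr rfl fun k _ => ?_
    rw [evalEigen_rename_mul, coeff_act, coeff_act]
    ring
  simp only [h1]
  refine hasSum_sum fun k _ => ?_
  have h2 := summable_norm_coeff_act (B := B) hA hq (u k)
  have h3 := summable_norm_coeff_act (B := B) hA' hqt (v k)
  rw [bracket, bracket, tsum_mul_tsum_of_summable_norm h2 h3]
  exact (summable_mul_of_summable_norm h2 h3).hasSum

theorem hasSum_stateIntegral {A B : ℕ} (hA : 0 < A) (hAB : A < B) {b : ℂ} (hb : 0 < (b ^ 2).im)
    (hre : 0 < b.re) {ε : ℝ} (hε : 0 < ε) (hε' : ε < (cb b).im) :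
    HasSum (fun x : ℕ × ℕ => prefactor A B b * PowerSeries.coeff x.2 (PowerSeries.coeff x.1
      (act2 (qParam b) (qDual b) (PAB A B b)
        (prodSeries (FSeries A B (qParam b)) (FSeries (B - A) B (qDual b))))))
      (stateIntegral A B b ε) := by
  have hc : 0 < (cb b).im := hε.trans hε'
  have hr : ε / (cb b).im ∈ Ioo (0 : ℝ) 1 := ⟨div_pos hε hc, (div_lt_one hc).mpr hε'⟩
  have h := hasSum_cellIntegral hA hAB hb hre hr
  rw [div_mul_cancel₀ _ hc.ne'] at h
  refine h.congr_fun fun x => ?_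
  rw [cellIntegral_eq hAB hb hre hr, coeff_act2, coeff_prodSeries]

end Convergence

end StateIntegral

theorem theorem1 (A B : ℕ) (hA : 0 < A) (hAB : A < B) (b : ℂ)
    (hb : 0 < (b ^ 2).im) (hre : 0 < b.re) :
    HasCoeffs b (PAB A B b) ∧
    (Summable fun p : ℕ × ℕ => PowerSeries.coeff p.2 (PowerSeries.coeff p.1
      (act2 (qParam b) (qDual b) (PAB A B b)
        (prodSeries (FSeries A B (qParam b)) (FSeries (B - A) B (qDual b)))))) ∧
    (∀ ε : ℝ, 0 < ε → ε < (cb b).im →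
      MeasureTheory.Integrable (fun t : ℝ => integrand A B b (t + ε * Complex.I)) ∧
      stateIntegral A B b ε = prefactor A B b *
        bracket2 (act2 (qParam b) (qDual b) (PAB A B b)
          (prodSeries (FSeries A B (qParam b)) (FSeries (B - A) B (qDual b))))) ∧
    (∃ (N : ℕ) (u v : Fin N → MvPolynomial Gen ℂ),
      (∀ k, HasCoeffs b (u k) ∧ HasCoeffs b (v k)) ∧ IsDecomposition (PAB A B b) u v) ∧
    (∀ (N : ℕ) (u v : Fin N → MvPolynomial Gen ℂ), IsDecomposition (PAB A B b) u v →
      (∀ k,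
        (Summable fun m : ℕ =>
          PowerSeries.coeff m (act (qParam b) (u k) (FSeries A B (qParam b)))) ∧
        (Summable fun n : ℕ =>
          PowerSeries.coeff n (act (qDual b) (v k) (FSeries (B - A) B (qDual b))))) ∧
      ∀ ε : ℝ, 0 < ε → ε < (cb b).im →
        stateIntegral A B b ε = prefactor A B b *
          ∑ k, bracket (act (qParam b) (u k) (FSeries A B (qParam b))) *
            bracket (act (qDual b) (v k) (FSeries (B - A) B (qDual b)))) := by
  have hq := norm_qParam_lt_one hb
  have hqt := norm_qDual_lt_one hb
  have hBA : 0 < B - A := Nat.sub_pos_of_lt hAB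
  have hco := hasCoeffs_PAB (A := A) (hA.trans hAB) (ne_zero_of_im_sq_pos hb)
  have hdec := exists_isDecomposition hco
  refine ⟨hco, ?_, fun ε hε hε' => ⟨?_, ?_⟩, hdec, fun N u v h => ⟨fun k =>
    ⟨summable_coeff_act hA hq (u k), summable_coeff_act hBA hqt (v k)⟩, fun ε hε hε' => ?_⟩⟩
  -- Convergence of the double series is read off from any one decomposition.
  · obtain ⟨N, u, v, -, h⟩ := hdec
    exact (hasSum_coeff_act2 hA hBA hq hqt h).summable
  · have hc : 0 < (cb b).im := hε.trans hε'
    have h := (stateIntegral_eq_rays hA hAB hb hre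
      (r := ε / (cb b).im) ⟨div_pos hε hc, (div_lt_one hc).mpr hε'⟩).1
    rwa [div_mul_cancel₀ _ hc.ne'] at h
  · rw [bracket2, ← tsum_mul_left]
    exact (hasSum_stateIntegral hA hAB hb hre hε hε').tsum_eq.symm
  · exact (hasSum_stateIntegral hA hAB hb hre hε hε').unique
      ((hasSum_coeff_act2 hA hBA hq hqt h).mul_left _)
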